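/- **Graded cellular algebras with a highest weight theory.** Let $A$ be a finite-dimensional $\mathbb Z$-graded $\mathbb C$-algebra with a cell datum: a finite poset $(\Lambda,\trianglerighteq)$; finite sets $\mathcal T(\lambda,\mu)$ for $\lambda,\mu\in\Lambda$, empty unless $\lambda\trianglerighteq\mu$, with $\mathcal T(\lambda)=\bigsqcup_\mu\mathcal T(\lambda,\mu)$; a function $\deg:\bigsqcup_\lambda\mathcal T(\lambda)\to\mathbb Z$; and a $\mathbb C$-basis $\{c^\lambda_{ST}\mid \lambda\in\Lambda,\ S,T\in\mathcal T(\lambda)\}$ of $A$ such that 1. $c^\lambda_{ST}$ is homogeneous of degree $\deg S+\deg T$; 2. for $a\in A$ there are scalars $r_{SU}(a)$, independent of $T$, with $a\,c^\lambda_{ST}\equiv\sum_U r_{SU}(a)\,c^\lambda_{UT}$ modulo the span of all $c^\mu_{QR}$ with $\mu\triangleright\lambda$; 3. the linear map $c^\lambda_{ST}\mapsto c^\lambda_{TS}$ is an anti-automorphism of $A$; 4. $1_A=\sum_{\lambda}1_\lambda$ is a decomposition into orthogonal idempotents, with $1_\mu c^\lambda_{ST}1_\nu=c^\lambda_{ST}$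 for $S\in\mathcal T(\lambda,\mu)$, $T\in\mathcal T(\lambda,\nu)$; each $\mathcal T(\lambda,\lambda)$ consists of a single element $T^\lambda$, and $c^\lambda_{T^\lambda T^\lambda}=1_\lambda$. The standard module $\Delta(\lambda)$ has basis $c_S$ ($S\in\mathcal T(\lambda)$, in degree $\deg S$) and action $a\,c_S=\sum_U r_{SU}(a)c_U$. The module $L(\lambda)$ is its quotient by the radical of the bilinear form defined by $c^\lambda_{US}c^\lambda_{TV}\equiv\langle c_S,c_T\rangle c^\lambda_{UV}$ modulo the span of the $c^\mu_{QR}$ with $\mu\triangleright\lambda$. The graded decomposition numbers are $d_{\lambda\mu}(t)=\sum_{k\in\mathbb Z}[\Delta(\lambda):L(\mu)\langle k\rangle]\,t^k$, where $[\,:\,]$ is the graded composition multiplicity and $(M\langle k\rangle)_i=M_{i-k}$. **Geometry.** Let $E_r=\bigoplus_{i=1}^r\mathbb R\varepsilon_i$ with the $\varepsilon_i$ orthonormal, let $\Phi\subset E_r$ be an irreducible reduced root system (not necessarily spanning $E_r$) with positive roots $R^+$ and Coxeter number $h$, and let $\rho\in E_r$ and $e\in\mathbb N\cup\{\infty\}$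 with $e>h$. Let $W^e$ be the group generated by the reflections $s_{\alpha,me}(x)=x-(\langle x,\alpha^\vee\rangle-me)\alpha$ for $\alpha\in\Phi$, $m\in\mathbb Z$ (only $m=0$ if $e=\infty$), acting on $E_r$ by $w\cdot x=w(x+\rho)-\rho$, and put $h_{\alpha,me}=\{x\mid\langle x+\rho,\alpha^\vee\rangle=me\}$. An alcove is a non-empty set of the form $\{x\mid (m_\alpha-1)e<\langle x+\rho,\alpha^\vee\rangle<m_\alpha e\ \text{for all }\alpha\in R^+\}$ with $m_\alpha\in\mathbb Z$ (where $0\cdot\infty=0$). Assume that the origin lies in an alcove. A point is $e$-regular if it lies in an alcove. The degree of a sequence of points $(\omega(0),\dots,\omega(n))$ is the sum, over all steps $\omega(k-1)\to\omega(k)$ and all $\alpha\in R^+$, of the following contributions: $+1$ if the step leaves a hyperplane $h_{\alpha,me}$ to the side containing the origin; $-1$ if it arrives on a hyperplane $h_{\alpha,me}$ from the side not containing the origin. Reflecting $\omega$ in $h_{\alpha,me}$ at a point $\omega(k)\in h_{\alpha,me}$ means replacing $\omega(i)$ by $s_{\alpha,me}\cdot\omega(i)$ for all $i\geq k$. A sequence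 is admissible if (i) all its initial segments have degree $0$; (ii) whenever $\omega(k)$ lies on $h_{\alpha,me}$ and on $h_{\beta,m'e}$ with $\alpha\neq\beta$ in $R^+$, then $\langle\alpha,\beta^\vee\rangle=0$; and (iii) no hyperplane $h_{\alpha,me}$ strictly separates two consecutive points $\omega(k-1),\omega(k)$. **Soergel-path basis.** Let $\Lambda\hookrightarrow E_r$ be an embedding; identify $\Lambda$ with its image. The algebra $A$ has a Soergel-path basis if for every $\mu\in\Lambda$ there is a path $\omega^\mu$ from the origin to $\mu$, each of whose steps adds some $\varepsilon_i$, all of whose initial segments have degree $0$, and which is admissible if $\mu$ is $e$-regular, such that, writing $\mathrm{Path}(\lambda,\mu)$ for the set of sequences ending at $\lambda\in E_r$ that are obtained from $\omega^\mu$ by series of reflections, $\mathrm{Path}(\lambda,\mu)=\emptyset$ for $\lambda\notin\Lambda$, and for all $\lambda\in\Lambda$ there is a degree-preserving bijection $\mathcal T(\lambda,\mu)\to\mathrm{Path}(\lambda,\mu)$, with $T^\mu\mapsto\omega^\mu$ when $\lambda=\mu$. **Statement.** Suppose that $A$ has a Soergel-path basis and that $d_{\lambda\mu}(t)\in t\,\mathbb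 N_0[t]$ for all $\lambda\neq\mu$ in $\Lambda$. Let $\mathfrak a,\mathfrak b$ be alcoves and let $\lambda,\lambda',\mu,\mu'\in\Lambda$ with $\lambda,\lambda'\in\mathfrak a$, $\mu,\mu'\in\mathfrak b$, $\mu\in W^e\cdot\lambda$ and $\mu'\in W^e\cdot\lambda'$. Then $$d_{\lambda\mu}(t)=d_{\lambda'\mu'}(t).$$ -/

import Mathlib

noncomputable section

open scoped InnerProductSpace

namespace SoergelPath

universe u v w

/-! ### Graded modules and graded composition multiplicities -/

section GradedModules

variable {A : Type*} [Ring A] [Algebra ℂ A]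
variable {M : Type*} [AddCommGroup M] [Module ℂ M] [Module A M] [IsScalarTower ℂ A M]
variable {N : Type*} [AddCommGroup N] [Module ℂ N] [Module A N]

/-- The degree shift `M⟨k⟩`, with `(M⟨k⟩)_i = M_{i-k}`. -/
def shift (k : ℤ) (gr : ℤ → Submodule ℂ M) : ℤ → Submodule ℂ M := fun i => gr (i - k)

/-- Isomorphism of graded `A`-modules: an `A`-linear equivalence matching the homogeneous
components. -/
def GradedIso (A : Type*) [Ring A] [Algebra ℂ A]
    {M : Type*} [AddCommGroup M] [Module ℂ M] [Module A M]
    {N : Type*} [AddCommGroup N] [Module ℂ N] [Module A N]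
    (grM : ℤ → Submodule ℂ M) (grN : ℤ → Submodule ℂ N) : Prop :=
  ∃ f : M ≃ₗ[A] N, ∀ (i : ℤ) (x : M), x ∈ grM i ↔ f x ∈ grN i

/-- A submodule of a graded module is homogeneous if it is the sum of its intersections with the
homogeneous components. -/
def IsHomogeneousSub (gr : ℤ → Submodule ℂ M) (K : Submodule A M) : Prop :=
  K.restrictScalars ℂ ≤ ⨆ i, K.restrictScalars ℂ ⊓ gr i

/-- The induced grading on a quotient module. -/
def quotGrading (gr : ℤ → Submodule ℂ M) (K : Submodule A M) : ℤ → Submodule ℂ (M ⧸ K) :=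
  fun i => (gr i).map (K.mkQ.restrictScalars ℂ)

/-- The induced grading on a submodule. -/
def subGrading (gr : ℤ → Submodule ℂ M) (K : Submodule A M) : ℤ → Submodule ℂ K :=
  fun i => (gr i).comap (K.subtype.restrictScalars ℂ)

/-- A graded composition series: a chain of homogeneous submodules from `⊥` to `⊤` in which
no further homogeneous submodule can be inserted. -/
structure GradedCompositionSeries (A : Type*) [Ring A] [Algebra ℂ A]
    {M : Type*} [AddCommGroup M] [Module ℂ M] [Module A M] [IsScalarTower ℂ A M]
    (gr : ℤ → Submodule ℂ M) where
  length : ℕ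
  sub : Fin (length + 1) → Submodule A M
  homogeneous : ∀ i, IsHomogeneousSub gr (sub i)
  bot : sub 0 = ⊥
  top : sub (Fin.last length) = ⊤
  lt : ∀ i : Fin length, sub i.castSucc < sub i.succ
  simple : ∀ (i : Fin length) (K : Submodule A M), IsHomogeneousSub gr K →
    sub i.castSucc ≤ K → K ≤ sub i.succ → K = sub i.castSucc ∨ K = sub i.succ

/-- The `i`-th factor `sub (i+1) / sub i` of a graded composition series, with its induced
grading, is isomorphic to the graded module `N`. -/
def GradedCompositionSeries.FactorIso {gr : ℤ → Submodule ℂ M}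
    (s : GradedCompositionSeries A gr) (i : Fin s.length) (grN : ℤ → Submodule ℂ N) : Prop :=
  GradedIso A
    (quotGrading (subGrading gr (s.sub i.succ))
      ((s.sub i.castSucc).submoduleOf (s.sub i.succ))) grN

open Classical in
/-- The multiplicity `[M : N]` of a graded simple module `N` as a graded composition factor of `M`:
the number of factors isomorphic to `N` in a graded composition series of `M`. By the
Jordan-Hölder theorem it does not depend on the series, and one is chosen once and for all
for the graded module `M`. -/
def gradedMult (A : Type*) [Ring A] [Algebra ℂ A]
    {M : Type*} [AddCommGroup M] [Module ℂ M] [Module A M] [IsScalarTower ℂ A M]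
    {N : Type*} [AddCommGroup N] [Module ℂ N] [Module A N]
    (grM : ℤ → Submodule ℂ M) (grN : ℤ → Submodule ℂ N) : ℕ :=
  if h : Nonempty (GradedCompositionSeries A grM) then
    (Finset.univ.filter fun i : Fin h.some.length =>
      h.some.FactorIso i grN).card
  else 0

end GradedModules

/-! ### Graded cellular algebras with a highest weight theory -/

/-- A cell datum with a highest weight theory on the graded algebra `A = ⨁ 𝒜 i`, with weight
poset `Λ`. Here `T l m` is the finite set of tableaux of shape `l` and weight `m`, and
`Σ m, T l m` is the set of all tableaux of shape `l`. -/
structure CellDatum {A : Type u} [Ring A] [Algebra ℂ A] (𝒜 : ℤ → Submodule ℂ A)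
    (Λ : Type v) [PartialOrder Λ] [Fintype Λ] where
  T : Λ → Λ → Type w
  finT : ∀ l m, Fintype (T l m)
  le_of_T : ∀ {l m}, T l m → m ≤ l
  deg : ∀ {l}, (Σ m, T l m) → ℤ
  /-- the basis `c^l_{ST}` -/
  c : Module.Basis (Σ l, (Σ m, T l m) × (Σ m, T l m)) ℂ A
  homogeneous : ∀ (l : Λ) (S U : Σ m, T l m), c ⟨l, S, U⟩ ∈ 𝒜 (deg S + deg U)
  cell : ∀ (l : Λ) (a : A), ∃ r : (Σ m, T l m) → (Σ m, T l m) → ℂ, ∀ S U,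
    a * c ⟨l, S, U⟩ - ∑ V, r S V • c ⟨l, V, U⟩ ∈
      Submodule.span ℂ {x | ∃ (m : Λ) (Q R : Σ n, T m n), l < m ∧ x = c ⟨m, Q, R⟩}
  /-- the anti-involution `*` -/
  star : A →ₗ[ℂ] A
  star_c : ∀ (l : Λ) (S U : Σ m, T l m), star (c ⟨l, S, U⟩) = c ⟨l, U, S⟩
  star_mul : ∀ a b, star (a * b) = star b * star a
  /-- the weight idempotents `1_l` -/
  idem : Λ → A
  idem_complete : CompleteOrthogonalIdempotents idem
  idem_c : ∀ (l m n : Λ) (S : T l m) (U : T l n),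
    idem m * c ⟨l, ⟨m, S⟩, ⟨n, U⟩⟩ * idem n = c ⟨l, ⟨m, S⟩, ⟨n, U⟩⟩
  /-- the unique tableau `T^l` of shape and weight `l` -/
  highest : ∀ l, Unique (T l l)
  c_highest : ∀ l, c ⟨l, ⟨l, (highest l).default⟩, ⟨l, (highest l).default⟩⟩ = idem l

namespace CellDatum

variable {A : Type u} [Ring A] [Algebra ℂ A] {𝒜 : ℤ → Submodule ℂ A}
variable {Λ : Type v} [PartialOrder Λ] [Fintype Λ] (D : CellDatum.{u, v, w} 𝒜 Λ)

attribute [instance] CellDatum.finT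

/-- All tableaux of shape `l`. -/
abbrev Tab (l : Λ) : Type (max v w) := Σ m, D.T l m

/-- The tableau `T^l`. -/
def top (l : Λ) : D.Tab l := ⟨l, (D.highest l).default⟩

/-- The span `A^{▷ l}` of all `c^m_{QR}` with `m ▷ l`. -/
def above (l : Λ) : Submodule ℂ A :=
  Submodule.span ℂ {x | ∃ (m : Λ) (Q R : Σ n, D.T m n), l < m ∧ x = D.c ⟨m, Q, R⟩}

/-- The structure constants `r_{SV}(a)`, read off from `a c^l_{S T^l}`. -/
def r (l : Λ) (a : A) (S V : D.Tab l) : ℂ :=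
  D.c.repr (a * D.c ⟨l, S, D.top l⟩) ⟨l, V, D.top l⟩

lemma repr_above {l : Λ} {x : A} (hx : x ∈ D.above l) (S U : D.Tab l) :
    D.c.repr x ⟨l, S, U⟩ = 0 := by
  classical
  induction hx using Submodule.span_induction with
  | mem x hx =>
    obtain ⟨m, Q, R, hlt, rfl⟩ := hx
    rw [Module.Basis.repr_self, Finsupp.single_apply, if_neg]
    intro h
    exact hlt.ne (congrArg Sigma.fst h).symm
  | zero => simp
  | add x y _ _ hx hy => simp [hx, hy]
  | smul a x _ hx => simp [hx]

lemma repr_sum (l : Λ) (f : D.Tab l → ℂ) (V U : D.Tab l) :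
    D.c.repr (∑ W, f W • D.c ⟨l, W, U⟩) ⟨l, V, U⟩ = f V := by
  classical
  simp only [map_sum, map_smul, Module.Basis.repr_self, Finsupp.coe_finsetSum, Finset.sum_apply,
    Finsupp.smul_apply, Finsupp.single_apply, smul_eq_mul]
  rw [Finset.sum_eq_single V]
  · simp
  · intro W _ hW
    rw [if_neg, mul_zero]
    intro h
    apply hW
    have := eq_of_heq (Sigma.mk.inj h).2
    exact (Prod.mk.inj this).1
  · simp

/-- The scalars `r_{SV}(a)` are the ones in the cellularity condition, for every `U`. -/
lemma mul_c (l : Λ) (a : A) (S U : D.Tab l) :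
    a * D.c ⟨l, S, U⟩ - ∑ V, D.r l a S V • D.c ⟨l, V, U⟩ ∈ D.above l := by
  obtain ⟨q, hq⟩ := D.cell l a
  have key : ∀ S V, D.r l a S V = q S V := by
    intro S V
    have h := D.repr_above (hq S (D.top l)) V (D.top l)
    rw [map_sub, Finsupp.sub_apply, D.repr_sum l (q S), sub_eq_zero] at h
    exact h
  simp only [key]
  exact hq S U

lemma mul_mem_above (l : Λ) (a : A) {x : A} (hx : x ∈ D.above l) : a * x ∈ D.above l := by
  induction hx using Submodule.span_induction with
  | mem x hx =>
    obtain ⟨m, Q, R, hlt, rfl⟩ := hx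
    have h := D.mul_c m a Q R
    have h1 : D.above m ≤ D.above l := by
      apply Submodule.span_mono
      rintro x ⟨n, Q, R, hn, rfl⟩
      exact ⟨n, Q, R, hlt.trans hn, rfl⟩
    rw [← sub_add_cancel (a * D.c ⟨m, Q, R⟩) (∑ V, D.r m a Q V • D.c ⟨m, V, R⟩)]
    refine Submodule.add_mem _ (h1 h) (Submodule.sum_mem _ fun V _ => Submodule.smul_mem _ _ ?_)
    exact Submodule.subset_span ⟨m, V, R, hlt, rfl⟩
  | zero => simp
  | add x y _ _ hx hy => rw [mul_add]; exact Submodule.add_mem _ hx hy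
  | smul b x _ hx => rw [mul_smul_comm]; exact Submodule.smul_mem _ _ hx

lemma star_star (x : A) : D.star (D.star x) = x := by
  have : D.star ∘ₗ D.star = LinearMap.id := by
    apply D.c.ext
    rintro ⟨l, S, U⟩
    simp [D.star_c]
  exact LinearMap.congr_fun this x

lemma star_mem_above (l : Λ) {x : A} (hx : x ∈ D.above l) : D.star x ∈ D.above l := by
  induction hx using Submodule.span_induction with
  | mem x hx =>
    obtain ⟨m, Q, R, hlt, rfl⟩ := hx
    rw [D.star_c]
    exact Submodule.subset_span ⟨m, R, Q, hlt, rfl⟩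
  | zero => simp
  | add x y _ _ hx hy => rw [map_add]; exact Submodule.add_mem _ hx hy
  | smul b x _ hx => rw [map_smul]; exact Submodule.smul_mem _ _ hx

lemma mem_above_mul (l : Λ) (a : A) {x : A} (hx : x ∈ D.above l) : x * a ∈ D.above l := by
  have := D.star_mem_above l (D.mul_mem_above l (D.star a) (D.star_mem_above l hx))
  rwa [D.star_mul, D.star_star, D.star_star] at this

lemma r_add (l : Λ) (a b : A) (S V : D.Tab l) :
    D.r l (a + b) S V = D.r l a S V + D.r l b S V := by
  simp [r, add_mul]

lemma r_smul (l : Λ) (z : ℂ) (a : A) (S V : D.Tab l) :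
    D.r l (z • a) S V = z * D.r l a S V := by
  simp [r]

open Classical in
lemma r_one (l : Λ) (S V : D.Tab l) : D.r l 1 S V = if S = V then 1 else 0 := by
  simp only [r, one_mul, Module.Basis.repr_self, Finsupp.single_apply]
  by_cases h : S = V
  · simp [h]
  · rw [if_neg, if_neg h]
    intro h'
    exact h (Prod.mk.inj (eq_of_heq (Sigma.mk.inj h').2)).1

lemma r_mul (l : Λ) (a b : A) (S V : D.Tab l) :
    D.r l (a * b) S V = ∑ W, D.r l b S W * D.r l a W V := by
  have h1 := D.mul_mem_above l a (D.mul_c l b S (D.top l))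
  have h2 := D.repr_above h1 V (D.top l)
  rw [mul_sub, ← mul_assoc, map_sub, Finsupp.sub_apply, sub_eq_zero] at h2
  rw [r, h2, Finset.mul_sum, map_sum, Finsupp.coe_finsetSum, Finset.sum_apply]
  refine Finset.sum_congr rfl fun W _ => ?_
  rw [mul_smul_comm, map_smul, Finsupp.smul_apply, smul_eq_mul]
  rfl

/-- The standard module `Δ(l)`, with basis `c_S` for `S` a tableau of shape `l`; an element is
given by its coordinates. -/
def Standard (l : Λ) : Type (max v w) := D.Tab l → ℂ

instance (l : Λ) : AddCommGroup (D.Standard l) := inferInstanceAs (AddCommGroup (D.Tab l → ℂ))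

instance (l : Λ) : Module ℂ (D.Standard l) := inferInstanceAs (Module ℂ (D.Tab l → ℂ))

/-- The action `a c_S = ∑_V r_{SV}(a) c_V`. -/
instance (l : Λ) : Module A (D.Standard l) where
  smul a x := fun V => ∑ S, x S * D.r l a S V
  one_smul x := by
    classical
    funext V
    change ∑ S, x S * D.r l 1 S V = x V
    simp only [r_one, mul_ite, mul_one, mul_zero]
    exact (Finset.sum_ite_eq' Finset.univ V x).trans (if_pos (Finset.mem_univ V))
  mul_smul a b x := by
    funext V
    change ∑ S, x S * D.r l (a * b) S V = ∑ W, (∑ S, x S * D.r l b S W) * D.r l a W V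
    simp only [r_mul, Finset.mul_sum, Finset.sum_mul]
    rw [Finset.sum_comm]
    simp only [mul_assoc]
  smul_zero a := by
    funext V
    change ∑ S, (0 : ℂ) * D.r l a S V = 0
    simp
  smul_add a x y := by
    funext V
    change ∑ S, (x S + y S) * D.r l a S V = ∑ S, x S * D.r l a S V + ∑ S, y S * D.r l a S V
    simp [add_mul, Finset.sum_add_distrib]
  add_smul a b x := by
    funext V
    change ∑ S, x S * D.r l (a + b) S V = ∑ S, x S * D.r l a S V + ∑ S, x S * D.r l b S V
    simp [r_add, mul_add, Finset.sum_add_distrib]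
  zero_smul x := by
    funext V
    change ∑ S, x S * D.r l 0 S V = 0
    simp [r]

lemma smul_apply (l : Λ) (a : A) (x : D.Standard l) (V : D.Tab l) :
    (a • x) V = ∑ S, x S * D.r l a S V := rfl

instance (l : Λ) : IsScalarTower ℂ A (D.Standard l) where
  smul_assoc z a x := by
    funext V
    change ∑ S, x S * D.r l (z • a) S V = z * ∑ S, x S * D.r l a S V
    rw [Finset.mul_sum]
    refine Finset.sum_congr rfl fun S _ => ?_
    rw [r_smul]
    ring

/-- The grading on `Δ(l)`: the degree `z` component is spanned by the `c_S` with `deg S = z`. -/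
def standardGrading (l : Λ) : ℤ → Submodule ℂ (D.Standard l) := fun z =>
  { carrier := {x | ∀ S, x S ≠ 0 → D.deg S = z}
    zero_mem' := fun _ h => absurd rfl h
    add_mem' := by
      intro x y hx hy S h
      by_cases h1 : x S = 0
      · refine hy S fun h2 => h ?_
        change x S + y S = 0
        rw [h1, h2, add_zero]
      · exact hx S h1
    smul_mem' := by
      intro b x hx S h
      refine hx S fun h1 => h ?_
      change b * x S = 0
      rw [h1, mul_zero] }

/-- The matrix of the bilinear form: `⟨c_S, c_U⟩` is the coefficient of `c_{VV}` in
`c_{VS} c_{UV}`, where `V = T^l`. -/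
def gram (l : Λ) (S U : D.Tab l) : ℂ :=
  D.c.repr (D.c ⟨l, D.top l, S⟩ * D.c ⟨l, U, D.top l⟩) ⟨l, D.top l, D.top l⟩

lemma gram_smul (l : Λ) (a : A) (S U : D.Tab l) :
    ∑ W, D.r l a S W * D.gram l W U = ∑ W, D.r l (D.star a) U W * D.gram l S W := by
  have h1 := D.mem_above_mul l (D.c ⟨l, U, D.top l⟩)
    (D.star_mem_above l (D.mul_c l a S (D.top l)))
  have h2 := D.mul_mem_above l (D.c ⟨l, D.top l, S⟩) (D.mul_c l (D.star a) U (D.top l))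
  have e1 := D.repr_above h1 (D.top l) (D.top l)
  have e2 := D.repr_above h2 (D.top l) (D.top l)
  simp only [map_sub, D.star_mul, D.star_c, map_sum, map_smul, sub_mul, mul_sub, Finset.sum_mul,
    Finset.mul_sum, smul_mul_assoc, mul_smul_comm, Finsupp.sub_apply, Finsupp.coe_finsetSum,
    Finset.sum_apply, Finsupp.smul_apply, smul_eq_mul, sub_eq_zero] at e1 e2
  simp only [gram]
  rw [← e1, ← e2, mul_assoc]

/-- The bilinear form on `Δ(l)`. -/
def form (l : Λ) (x y : D.Standard l) : ℂ := ∑ S, ∑ U, x S * y U * D.gram l S U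

lemma form_smul (l : Λ) (a : A) (x y : D.Standard l) :
    D.form l (a • x) y = D.form l x (D.star a • y) := by
  have h : ∀ S U, x S * y U * ∑ W, D.r l a S W * D.gram l W U =
      x S * y U * ∑ W, D.r l (D.star a) U W * D.gram l S W := fun S U => by
    rw [D.gram_smul]
  have h' := Finset.sum_congr rfl fun S (_ : S ∈ Finset.univ) =>
    Finset.sum_congr rfl fun U (_ : U ∈ Finset.univ) => h S U
  simp only [form, smul_apply, Finset.sum_mul, Finset.mul_sum] at h' ⊢
  calc _ = ∑ S, ∑ U, ∑ W, x S * y U * (D.r l a S W * D.gram l W U) := by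
        rw [Finset.sum_congr rfl fun W _ => Finset.sum_comm]
        rw [Finset.sum_comm]
        refine Finset.sum_congr rfl fun S _ => ?_
        rw [Finset.sum_comm]
        refine Finset.sum_congr rfl fun U _ => Finset.sum_congr rfl fun W _ => ?_
        ring
    _ = _ := h'
    _ = _ := by
        refine Finset.sum_congr rfl fun S _ => ?_
        rw [Finset.sum_comm]
        refine Finset.sum_congr rfl fun U _ => Finset.sum_congr rfl fun W _ => ?_
        ring

/-- The radical of the bilinear form on `Δ(l)`. -/
def radical (l : Λ) : Submodule A (D.Standard l) where
  carrier := {x | ∀ y, D.form l x y = 0}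
  zero_mem' := by
    intro y
    change ∑ S, ∑ U, (0 : ℂ) * y U * D.gram l S U = 0
    simp
  add_mem' := by
    intro x x' hx hx' y
    have h : D.form l (x + x') y = D.form l x y + D.form l x' y := by
      change ∑ S, ∑ U, (x S + x' S) * y U * D.gram l S U = _
      simp [form, add_mul, Finset.sum_add_distrib]
    rw [h, hx, hx', add_zero]
  smul_mem' := by
    intro a x hx y
    rw [form_smul]
    exact hx _

/-- The simple module `L(l)`. -/
abbrev Simple (l : Λ) : Type (max v w) := D.Standard l ⧸ D.radical l

/-- The grading on `L(l)`. -/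
def simpleGrading (l : Λ) : ℤ → Submodule ℂ (D.Simple l) :=
  quotGrading (D.standardGrading l) (D.radical l)

/-- The graded multiplicity `[Δ(l) : L(m)⟨k⟩]`. -/
def decMult (l m : Λ) (k : ℤ) : ℕ :=
  gradedMult A (D.standardGrading l) (shift k (D.simpleGrading m))

open Classical in
/-- The basis vector `c_{T^m}` of `Δ(m)`. -/
def topVec (m : Λ) : D.Standard m := fun S => if S = D.top m then 1 else 0

lemma topVec_notMem_radical (m : Λ) : D.topVec m ∉ D.radical m := by
  classical
  intro h
  have h1 : D.form m (D.topVec m) (D.topVec m) = D.gram m (D.top m) (D.top m) := by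
    simp [form, topVec]
  have h2 : D.gram m (D.top m) (D.top m) = 1 := by
    have hc : D.c ⟨m, D.top m, D.top m⟩ = D.idem m := D.c_highest m
    rw [gram, hc, (D.idem_complete.idem m).eq, ← hc, Module.Basis.repr_self]
    simp
  have h3 := h (D.topVec m)
  rw [h1, h2] at h3
  exact one_ne_zero h3

lemma decMult_support (l m : Λ) (k : ℤ) (hk : D.decMult l m k ≠ 0) :
    k ∈ (Finset.univ.image fun S : D.Tab l => D.deg S - D.deg (D.top m)) := by
  classical
  unfold decMult gradedMult at hk
  split_ifs at hk with h
  · obtain ⟨i, hi⟩ := Finset.card_ne_zero.mp hk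
    obtain ⟨f, hf⟩ := (Finset.mem_filter.mp hi).2
    let v : D.Simple m := (D.radical m).mkQ (D.topVec m)
    have hv0 : v ≠ 0 := by
      intro h0
      exact D.topVec_notMem_radical m ((Submodule.Quotient.mk_eq_zero _).mp h0)
    have hv : v ∈ shift k (D.simpleGrading m) (k + D.deg (D.top m)) := by
      change v ∈ D.simpleGrading m (k + D.deg (D.top m) - k)
      rw [add_sub_cancel_left]
      refine ⟨D.topVec m, ?_, rfl⟩
      intro S hS
      by_cases hST : S = D.top m
      · rw [hST]
      · exact absurd (if_neg hST) hS
    have hx := (hf (k + D.deg (D.top m)) (f.symm v)).mpr (by rwa [f.apply_symm_apply])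
    obtain ⟨y, hy, hyx⟩ := hx
    have hy0 : (y : D.Standard l) ≠ 0 := by
      intro h0
      have h1 : y = 0 := Subtype.ext h0
      rw [h1, map_zero] at hyx
      exact hv0 (by simpa using hyx.symm)
    obtain ⟨S, hS⟩ := Function.ne_iff.mp hy0
    have hd : D.deg S = k + D.deg (D.top m) := hy S hS
    refine Finset.mem_image.mpr ⟨S, Finset.mem_univ _, ?_⟩
    rw [hd, add_sub_cancel_right]
  · exact absurd rfl hk

/-- The graded decomposition number `d_{lm}(t) = ∑_k [Δ(l) : L(m)⟨k⟩] t^k`. -/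
def decNumber (l m : Λ) : LaurentPolynomial ℕ :=
  .ofCoeff (Finsupp.onFinset _ (D.decMult l m) (D.decMult_support l m))

end CellDatum

/-! ### The alcove geometry -/

/-- The Euclidean space `E_r` with orthonormal basis `ε_1, …, ε_r`. -/
abbrev E (r : ℕ) := EuclideanSpace ℝ (Fin r)

/-- The pairing `⟨x, α^∨⟩ = 2⟨x, α⟩ / ⟨α, α⟩` with the coroot of `α`. -/
def corootPairing {r : ℕ} (α x : E r) : ℝ := 2 * ⟪x, α⟫_ℝ / ⟪α, α⟫_ℝ

/-- Irreducible reduced (crystallographic) root systems in `E_r`; they need not span `E_r`. -/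
structure IsIrredRootSystem {r : ℕ} (Φ : Finset (E r)) : Prop where
  nonempty : Φ.Nonempty
  ne_zero : ∀ α ∈ Φ, α ≠ 0
  refl_mem : ∀ α ∈ Φ, ∀ β ∈ Φ, β - corootPairing α β • α ∈ Φ
  integral : ∀ α ∈ Φ, ∀ β ∈ Φ, ∃ z : ℤ, corootPairing α β = z
  reduced : ∀ α ∈ Φ, ∀ b : ℝ, b • α ∈ Φ → b = 1 ∨ b = -1
  irreducible : ∀ Ψ : Finset (E r), Ψ ⊆ Φ → Ψ.Nonempty →
    (∀ α ∈ Ψ, ∀ β ∈ Φ, β ∉ Ψ → ⟪α, β⟫_ℝ = 0) → Ψ = Φ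

/-- `P` is a set of positive roots of `Φ`. -/
def IsPositiveSystem {r : ℕ} (Φ P : Finset (E r)) : Prop :=
  ∃ f : E r →ₗ[ℝ] ℝ, (∀ α ∈ Φ, f α ≠ 0) ∧ ∀ α, α ∈ P ↔ α ∈ Φ ∧ 0 < f α

/-- The Coxeter number `h = |Φ| / rank Φ` of an irreducible root system. -/
def coxeterNumber {r : ℕ} (Φ : Finset (E r)) : ℕ :=
  Φ.card / Module.finrank ℝ (Submodule.span ℝ (Φ : Set (E r)))

/-- The value `m e` for `e ∈ ℕ ∪ {∞}`, with `0 ∞ = 0` and `m ∞ = ±∞` otherwise. -/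
def level (e : ℕ∞) (m : ℤ) : EReal :=
  if e = ⊤ then (if m < 0 then ⊥ else if m = 0 then 0 else ⊤)
  else ((m * (e.toNat : ℝ) : ℝ) : EReal)

/-- The finite values among the `m e`: all integer multiples of `e` if `e` is finite, and only `0`
if `e = ∞`. -/
def levels (e : ℕ∞) : Set ℝ := {b | ∃ m : ℤ, (b : EReal) = level e m}

/-- The affine reflection `s_{α,b}(x) = x - (⟨x, α^∨⟩ - b) α`. -/
def affineReflection {r : ℕ} (α : E r) (b : ℝ) (x : E r) : E r := x - (corootPairing α x - b) • α

/-- The parameters: a root system `Φ` in `E_r` with positive roots `P`, a shift `ρ ∈ E_r` and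
`e ∈ ℕ ∪ {∞}`. -/
structure Geometry (r : ℕ) where
  Φ : Finset (E r)
  P : Finset (E r)
  ρ : E r
  e : ℕ∞

namespace Geometry

variable {r : ℕ} (G : Geometry r)

/-- The affine reflection group `W^e`. -/
def W : Subgroup (Equiv.Perm (E r)) :=
  Subgroup.closure {g | ∃ α ∈ G.Φ, ∃ b ∈ levels G.e, ∀ x, g x = affineReflection α b x}

/-- `y` lies in the orbit `W^e · x` for the shifted action `w · x = w(x + ρ) - ρ`. -/
def Linked (x y : E r) : Prop := ∃ g ∈ G.W, y = g (x + G.ρ) - G.ρ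

/-- The position `⟨x + ρ, α^∨⟩ - b` of `x` relative to the hyperplane `h_{α,b}`. -/
def height (α : E r) (b : ℝ) (x : E r) : ℝ := corootPairing α (x + G.ρ) - b

/-- The hyperplane `h_{α,b}`. -/
def hyperplane (α : E r) (b : ℝ) : Set (E r) := {x | G.height α b x = 0}

/-- The side of `h_{α,b}` that contains the origin. -/
def minusSide (α : E r) (b : ℝ) : Set (E r) := {x | 0 < G.height α b x * G.height α b 0}

/-- The side of `h_{α,b}` that does not contain the origin. -/
def plusSide (α : E r) (b : ℝ) : Set (E r) := {x | G.height α b x * G.height α b 0 < 0}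

/-- Alcoves: non-empty sets given by `(m_α - 1)e < ⟨x + ρ, α^∨⟩ < m_α e` for all positive `α`. -/
def IsAlcove (a : Set (E r)) : Prop :=
  a.Nonempty ∧ ∃ m : E r → ℤ, a = {x | ∀ α ∈ G.P,
    level G.e (m α - 1) < (corootPairing α (x + G.ρ) : EReal) ∧
    (corootPairing α (x + G.ρ) : EReal) < level G.e (m α)}

/-- A point is `e`-regular if it lies in an alcove. -/
def IsRegular (x : E r) : Prop := ∃ a, G.IsAlcove a ∧ x ∈ a

/-- The standing assumptions on the geometry. -/
structure IsAdmissibleGeometry : Prop where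
  rootSystem : IsIrredRootSystem G.Φ
  positive : IsPositiveSystem G.Φ G.P
  coxeter_lt : (coxeterNumber G.Φ : ℕ∞) < G.e
  /-- the origin lies in an alcove -/
  origin : G.IsRegular 0

open Classical in
/-- The contribution `d_α` to the degree of a step from `x` to `y`: `+1` for stepping off a
hyperplane towards the origin, `-1` for stepping onto a hyperplane from the side away from the
origin. -/
def stepDegree (α x y : E r) : ℤ :=
  (if ∃ b ∈ levels G.e, x ∈ G.hyperplane α b ∧ y ∈ G.minusSide α b then 1 else 0) +
  (if ∃ b ∈ levels G.e, x ∈ G.plusSide α b ∧ y ∈ G.hyperplane α b then -1 else 0)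

/-- The degree `deg(p_{≤ j})` of the initial subpath of length `j`. -/
def degreeUpTo {n : ℕ} (p : Fin (n + 1) → E r) (j : ℕ) : ℤ :=
  ∑ k ∈ Finset.univ.filter (fun k : Fin n => (k : ℕ) < j), ∑ α ∈ G.P, G.stepDegree α (p k.castSucc) (p k.succ)

/-- The degree of a path of length `n`. -/
def degree {n : ℕ} (p : Fin (n + 1) → E r) : ℤ := G.degreeUpTo p n

/-- `q` is the reflection `s^k_{α,b} · p` of the path `p` in some hyperplane `h_{α,b}` at some point
`p k` on that hyperplane. -/
def IsReflectionOf {n : ℕ} (p q : Fin (n + 1) → E r) : Prop :=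
  ∃ α ∈ G.Φ, ∃ b ∈ levels G.e, ∃ k, p k ∈ G.hyperplane α b ∧
    (∀ i ≤ k, q i = p i) ∧ ∀ i, k ≤ i → q i = affineReflection α b (p i + G.ρ) - G.ρ

/-- `q` is obtained from `p` by a series of reflections. -/
def Reachable {n : ℕ} (p q : Fin (n + 1) → E r) : Prop :=
  Relation.ReflTransGen G.IsReflectionOf p q

/-- Admissible paths. The last condition says that the path crosses hyperplanes only at its own
points `p k`, never in the interior of a step. -/
structure IsAdmissible {n : ℕ} (p : Fin (n + 1) → E r) : Prop where
  degree_zero : ∀ j ≤ n, G.degreeUpTo p j = 0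
  orthogonal : ∀ k, ∀ α ∈ G.P, ∀ β ∈ G.P, ∀ b ∈ levels G.e, ∀ b' ∈ levels G.e, α ≠ β →
    p k ∈ G.hyperplane α b → p k ∈ G.hyperplane β b' → corootPairing β α = 0
  no_jump : ∀ k : Fin n, ∀ α ∈ G.P, ∀ b ∈ levels G.e,
    0 ≤ G.height α b (p k.castSucc) * G.height α b (p k.succ)

end Geometry

/-- The path `k ↦ ε_{w 1} + ⋯ + ε_{w k}` starting at the origin. -/
def wordPath {r n : ℕ} (w : Fin n → Fin r) (k : Fin (n + 1)) : E r :=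
  ∑ i ∈ Finset.univ.filter (fun i : Fin n => (i : ℕ) < k), EuclideanSpace.single (w i) 1

/-! ### Soergel-path bases -/

/-- A Soergel-path basis for the cell datum `D`, with respect to the geometry `G` and the embedding
`ι` of the weights in `E_r`. The tableaux of weight `m` are in degree-preserving bijection with all
the paths obtained from the distinguished path `ω m` by reflections; a tableau of shape `l`
corresponds to a path that ends at `l`, and `ω m` corresponds to `T^m`. -/
structure SoergelPathBasis {A : Type u} [Ring A] [Algebra ℂ A] {𝒜 : ℤ → Submodule ℂ A}
    {Λ : Type v} [PartialOrder Λ] [Fintype Λ] (D : CellDatum.{u, v, w} 𝒜 Λ)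
    {r : ℕ} (G : Geometry r) (ι : Λ ↪ E r) where
  len : Λ → ℕ
  word : ∀ m, Fin (len m) → Fin r
  ω : ∀ m, Fin (len m + 1) → E r
  ω_eq : ∀ m, ω m = wordPath (word m)
  ω_last : ∀ m, ω m (Fin.last _) = ι m
  ω_degree : ∀ m, ∀ j ≤ len m, G.degreeUpTo (ω m) j = 0
  ω_admissible : ∀ m, G.IsRegular (ι m) → G.IsAdmissible (ω m)
  /-- every path obtained from a distinguished path ends at a weight -/
  last_mem : ∀ m q, G.Reachable (ω m) q → ∃ l, q (Fin.last _) = ι l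
  /-- the bijection onto `Path(l, m)` -/
  toPath : ∀ l m, D.T l m ≃ {q : Fin (len m + 1) → E r //
    G.Reachable (ω m) q ∧ q (Fin.last _) = ι l}
  toPath_degree : ∀ l m (S : D.T l m), G.degree (toPath l m S).1 = D.deg ⟨m, S⟩
  toPath_highest : ∀ m, (toPath m m (D.highest m).default).1 = ω m

end SoergelPath

end

/-! The column of the decomposition matrix at an `e`-regular weight m is a Kazhdan–Lusztig element,
and such an element is determined by an alcove. For a regular weight n let x_n in W^e be the element
that carries the alcove of the origin to the alcove of n, and form d_m = ∑_l d_{lm}(t) x_l in the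
free ℤ[t,t⁻¹]-module on W^e. This module carries a bar involution that is unitriangular for the
length, so a bar-invariant element with all coefficients in tℤ[t] vanishes (`eq_zero_of_bar_eq`).
Since d_{mm} = 1 and the other entries lie in tℕ₀[t], bar-invariance of d_m and d_{m'} forces d_m =
d_{m'} as soon as x_m = x_{m'}. The coefficient of d_m at x_l is the single entry d_{lm}, because
W^e acts freely on alcoves and linked weights in one alcove coincide (`eq_of_alcoveElt_eq`).

Bar-invariance of d_m combines geometry and algebra.

Geometry: the path ω^m is folded by reflections into the closure of the alcove of the origin
(`Good.exists_folded`). The paths reachable from it correspond to choices, each time the folded path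
leaves some hyperplanes, of the subset of these at which to fold (`Folded.reachable_iff`). The
hyperplanes through one point are orthogonal, hence are walls of the alcove with commuting
reflections. Up to a telescoping potential, the degree of a path is a sum of signs over the
hyperplanes left without folding (`Folded.sum_degree_foldPath`). These signs are the exponents in
the wall-crossing operators w ↦ t^{±1} w + ws, which commute with bar. Hence the sum of t^{deg}
x_{end} over all paths is a product of such operators applied to 1, and is bar-invariant
(`exists_bar_character`).

Algebra: counted by degree, the tableaux of shape l and weight m give the graded character of 1_m
Δ(l), which is ∑_n d_{ln} ch(1_m L(n)) (`standardChar_eq`). The form on L(n) is nondegenerate and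
pairs degree j with degree -j, so ch(1_m L(n)) is symmetric under t ↦ t⁻¹ (`simpleDim_neg`). The
invariant element from the geometry is thus d_m plus a combination with symmetric coefficients of
the d_n with n > m, and descending induction gives the invariance of d_m (`bar_decPoly`).

The bar involution is built from the sets of separating hyperplanes alone. The cocycle rule for
these sets gives the exchange property. Operators commuting with all left multiplications are
determined by their value at 1, so the bar image of w does not depend on the reduced word, without
any appeal to braid relations. -/

noncomputable section
open scoped LaurentPolynomial
namespace SoergelPath

/-! ### Inversion cocycles and the bar involution -/

/-- An inversion cocycle on a group: `N w` is the set of reflections separating the base chamber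
from its translate under `w`, and `S` is a generating set of simple reflections. -/
structure IsInversionCocycle {Γ : Type*} [Group Γ] (N : Γ → Set Γ) (S : Set Γ) : Prop where
  mem_mul : ∀ w v t, t ∈ N (w * v) ↔ Xor (t ∈ N w) (w⁻¹ * t * w ∈ N v)
  mul_self : ∀ s ∈ S, s * s = 1
  simple : ∀ s ∈ S, N s = {s}
  closure : Subgroup.closure S = ⊤

namespace IsInversionCocycle

variable {Γ : Type*} [Group Γ] {N : Γ → Set Γ} {S : Set Γ}

/-- The word length with respect to `S`. -/
def wordLength (S : Set Γ) (w : Γ) : ℕ :=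
  sInf {n | ∃ l : List Γ, (∀ x ∈ l, x ∈ S) ∧ l.prod = w ∧ l.length = n}

/-! ### Word length, exchange property and descents. -/

section Length

variable (h : IsInversionCocycle N S)
include h

lemma notMem_one (t : Γ) : t ∉ N 1 := by
  have := h.mem_mul 1 1 t
  simp only [mul_one, inv_one, one_mul, xor_self] at this
  exact this.mp

lemma inv_simple {s : Γ} (hs : s ∈ S) : s⁻¹ = s :=
  inv_eq_of_mul_eq_one_left (h.mul_self s hs)

lemma mul_mul_cancel {s : Γ} (hs : s ∈ S) (w : Γ) : w * s * s = w := by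
  rw [mul_assoc, h.mul_self s hs, mul_one]

lemma exists_word (w : Γ) : ∃ l : List Γ, (∀ x ∈ l, x ∈ S) ∧ l.prod = w := by
  have hw : w ∈ Subgroup.closure S := by rw [h.closure]; trivial
  induction hw using Subgroup.closure_induction with
  | mem x hx => exact ⟨[x], by simpa using hx, by simp⟩
  | one => exact ⟨[], by simp, rfl⟩
  | mul x y _ _ hx hy =>
    obtain ⟨l, hl, rfl⟩ := hx
    obtain ⟨l', hl', rfl⟩ := hy
    refine ⟨l ++ l', fun x hx => ?_, List.prod_append⟩
    rcases List.mem_append.mp hx with h1 | h1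
    · exact hl x h1
    · exact hl' x h1
  | inv x _ hx =>
    obtain ⟨l, hl, rfl⟩ := hx
    refine ⟨l.reverse, fun x hx => hl x (List.mem_reverse.mp hx), ?_⟩
    rw [List.prod_inv_reverse, List.map_congr_left (fun x hx => h.inv_simple (hl x hx)),
      List.map_id']

lemma exists_minimal_word (w : Γ) :
    ∃ l : List Γ, (∀ x ∈ l, x ∈ S) ∧ l.prod = w ∧ l.length = wordLength S w := by
  obtain ⟨l, hl, hw⟩ := h.exists_word w
  exact Nat.sInf_mem (s := {n | ∃ l : List Γ, (∀ x ∈ l, x ∈ S) ∧ l.prod = w ∧ l.length = n})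
    ⟨_, l, hl, hw, rfl⟩

omit h in
lemma wordLength_le {l : List Γ} (hl : ∀ x ∈ l, x ∈ S) : wordLength S l.prod ≤ l.length :=
  Nat.sInf_le ⟨l, hl, rfl, rfl⟩

lemma wordLength_inv (w : Γ) : wordLength S w⁻¹ = wordLength S w := by
  have key : ∀ w, wordLength S w⁻¹ ≤ wordLength S w := by
    intro w
    obtain ⟨l, hl, rfl, hn⟩ := h.exists_minimal_word w
    rw [← hn, List.prod_inv_reverse,
      List.map_congr_left (fun x hx => h.inv_simple (hl x hx)), List.map_id', ← List.length_reverse]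
    exact wordLength_le fun x hx => hl x (List.mem_reverse.mp hx)
  exact le_antisymm (key w) (by simpa using key w⁻¹)

lemma wordLength_mul_le (w : Γ) {s : Γ} (hs : s ∈ S) :
    wordLength S (w * s) ≤ wordLength S w + 1 := by
  obtain ⟨l, hl, rfl, hn⟩ := h.exists_minimal_word w
  rw [← hn, show l.prod * s = (l ++ [s]).prod by simp]
  refine (wordLength_le fun x hx => ?_).trans (by simp)
  rcases List.mem_append.mp hx with h1 | h1
  · exact hl x h1
  · rw [List.mem_singleton.mp h1]; exact hs

/-- The exchange property. -/
lemma exists_word_of_mem (l : List Γ) (hl : ∀ x ∈ l, x ∈ S) (t : Γ) (ht : t ∈ N l.prod) :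
    ∃ l' : List Γ, (∀ x ∈ l', x ∈ S) ∧ l'.prod = t * l.prod ∧ l'.length + 1 = l.length := by
  induction l generalizing t with
  | nil => exact absurd ht (h.notMem_one t)
  | cons s l ih =>
    have hs : s ∈ S := hl s List.mem_cons_self
    have hl' : ∀ x ∈ l, x ∈ S := fun x hx => hl x (List.mem_cons_of_mem _ hx)
    rw [List.prod_cons, h.mem_mul, h.simple s hs] at ht
    -- Either `t = s` and multiplication by `t` cancels the first letter, or the conjugate of `t` by
    -- `s` is an inversion of the tail and a letter is deleted there.
    rcases ht with ⟨h1, -⟩ | ⟨h1, -⟩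
    · refine ⟨l, hl', ?_, rfl⟩
      rw [Set.mem_singleton_iff.mp h1, List.prod_cons, ← mul_assoc, h.mul_self s hs, one_mul]
    · obtain ⟨l', hl1, hp, hn⟩ := ih hl' _ h1
      refine ⟨s :: l', fun x hx => ?_, ?_, by simp [hn]⟩
      · rcases List.mem_cons.mp hx with rfl | hx
        · exact hs
        · exact hl1 x hx
      · rw [List.prod_cons, hp, List.prod_cons]; group

lemma wordLength_lt_of_mem {w s : Γ} (hd : w * s * w⁻¹ ∈ N w) :
    wordLength S (w * s) < wordLength S w := by
  obtain ⟨l, hl, rfl, hn⟩ := h.exists_minimal_word w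
  obtain ⟨l', hl', hp, hn'⟩ := h.exists_word_of_mem l hl _ hd
  have := wordLength_le hl'
  rw [hp, inv_mul_cancel_right] at this
  omega

/-- The elements `w` and `w * s` share the wall with reflection `w * s * w⁻¹`, and crossing it
toggles membership. So exactly one of the two has `s` as a right descent. -/
lemma mem_conj_mul_iff (w : Γ) {s : Γ} (hs : s ∈ S) :
    w * s * s * (w * s)⁻¹ ∈ N (w * s) ↔ ¬ w * s * w⁻¹ ∈ N w := by
  have e : w * s * s * (w * s)⁻¹ = w * s * w⁻¹ := by
    rw [mul_inv_rev, h.inv_simple hs, mul_assoc (w * s) s, ← mul_assoc s s, h.mul_self s hs,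
      one_mul]
  have e' : w⁻¹ * (w * s * w⁻¹) * w = s := by group
  rw [e, h.mem_mul, e', h.simple s hs, xor_comm]
  simp [Xor]

lemma wordLength_of_notMem {w s : Γ} (hs : s ∈ S) (hd : ¬ w * s * w⁻¹ ∈ N w) :
    wordLength S (w * s) = wordLength S w + 1 := by
  have h1 := h.wordLength_lt_of_mem ((h.mem_conj_mul_iff w hs).mpr hd)
  rw [h.mul_mul_cancel hs] at h1
  have h2 := h.wordLength_mul_le w hs
  omega

lemma exists_descent {w : Γ} (hw : w ≠ 1) : ∃ s ∈ S, w * s * w⁻¹ ∈ N w := by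
  obtain ⟨l, hl, rfl, hn⟩ := h.exists_minimal_word w
  rcases List.eq_nil_or_concat l with rfl | ⟨l', s, rfl⟩
  · exact absurd rfl hw
  · have hs : s ∈ S := hl s (by simp)
    refine ⟨s, hs, ?_⟩
    by_contra hd
    have h1 := h.wordLength_of_notMem hs hd
    have hl' : ∀ x ∈ l', x ∈ S := fun x hx => hl x (by simp [hx])
    have h2 := wordLength_le hl'
    simp only [List.prod_concat, h.mul_mul_cancel hs, List.length_concat] at h1 hn
    omega

/-- The last letter of a reduced word of a nontrivial element is a descent and yields an inversion.
Geometrically this is the freeness of the action on alcoves. -/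
lemma eq_one_of_forall_notMem {w : Γ} (hw : ∀ t, t ∉ N w) : w = 1 := by
  by_contra hne
  obtain ⟨s, -, hs⟩ := h.exists_descent hne
  exact hw _ hs

end Length

/-! The module on which the wall-crossing operators act. -/

open LaurentPolynomial Finsupp

variable (N)

open Classical in
/-- The right wall-crossing operator of the simple reflection `s`. -/
def wallCross (s : Γ) : (Γ →₀ ℤ[T;T⁻¹]) →ₗ[ℤ[T;T⁻¹]] (Γ →₀ ℤ[T;T⁻¹]) :=
  Finsupp.linearCombination _ fun w =>
    (if w * s * w⁻¹ ∈ N w then T (-1) else T 1 : ℤ[T;T⁻¹]) • single w 1 + single (w * s) 1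

open Classical in
/-- Left multiplication by the simple reflection `s`. -/
def leftMul (s : Γ) : (Γ →₀ ℤ[T;T⁻¹]) →ₗ[ℤ[T;T⁻¹]] (Γ →₀ ℤ[T;T⁻¹]) :=
  Finsupp.linearCombination _ fun w =>
    (if s ∈ N w then T (-1) - T 1 else 0 : ℤ[T;T⁻¹]) • single w 1 + single (s * w) 1

open Classical in
lemma wallCross_single (s w : Γ) : wallCross N s (single w 1) =
    (if w * s * w⁻¹ ∈ N w then T (-1) else T 1 : ℤ[T;T⁻¹]) • single w 1 + single (w * s) 1 := by
  simp [wallCross]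

open Classical in
lemma leftMul_single (s w : Γ) : leftMul N s (single w 1) =
    (if s ∈ N w then T (-1) - T 1 else 0 : ℤ[T;T⁻¹]) • single w 1 + single (s * w) 1 := by
  simp [leftMul]

omit [Group Γ] in
lemma endo_ext {f g : (Γ →₀ ℤ[T;T⁻¹]) →ₗ[ℤ[T;T⁻¹]] (Γ →₀ ℤ[T;T⁻¹])}
    (H : ∀ w, f (single w 1) = g (single w 1)) : f = g := by
  ext w : 2
  simpa using H w

/-- Right multiplication by `s`. -/
def rightMul (s : Γ) : (Γ →₀ ℤ[T;T⁻¹]) →ₗ[ℤ[T;T⁻¹]] (Γ →₀ ℤ[T;T⁻¹]) :=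
  wallCross N s - (T 1 : ℤ[T;T⁻¹]) • LinearMap.id

/-- The image of `rightMul` under the bar involution. -/
def rightMulBar (s : Γ) : (Γ →₀ ℤ[T;T⁻¹]) →ₗ[ℤ[T;T⁻¹]] (Γ →₀ ℤ[T;T⁻¹]) :=
  wallCross N s - (T (-1) : ℤ[T;T⁻¹]) • LinearMap.id

/-- The action of a word, first letter first. -/
def rightMulWord : List Γ → (Γ →₀ ℤ[T;T⁻¹]) →ₗ[ℤ[T;T⁻¹]] (Γ →₀ ℤ[T;T⁻¹])
  | [] => LinearMap.id
  | s :: l => rightMulWord l ∘ₗ rightMul N s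

/-- The bar-conjugate action of a word, first letter first. -/
def rightMulBarWord : List Γ → (Γ →₀ ℤ[T;T⁻¹]) →ₗ[ℤ[T;T⁻¹]] (Γ →₀ ℤ[T;T⁻¹])
  | [] => LinearMap.id
  | s :: l => rightMulBarWord l ∘ₗ rightMulBar N s

lemma rightMulWord_append (l l' : List Γ) :
    rightMulWord N (l ++ l') = rightMulWord N l' ∘ₗ rightMulWord N l := by
  induction l with
  | nil => rfl
  | cons s l ih => rw [List.cons_append, rightMulWord, ih, rightMulWord, LinearMap.comp_assoc]

lemma rightMulBarWord_append (l l' : List Γ) :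
    rightMulBarWord N (l ++ l') = rightMulBarWord N l' ∘ₗ rightMulBarWord N l := by
  induction l with
  | nil => rfl
  | cons s l ih =>
    rw [List.cons_append, rightMulBarWord, ih, rightMulBarWord, LinearMap.comp_assoc]

variable {N}

/-! ### Hecke operators and the bar involution. -/

section Bar

variable (h : IsInversionCocycle N S)
include h

/-- Passing from `w` to `u * w` or to `w * s` affects the descent condition of the other operator
only if `w * s * w⁻¹ = u`. In that case `w * s = u * w` and the identity is a computation in the
span of `w` and `u * w`; otherwise the operators commute term by term. -/
lemma leftMul_wallCross {s u : Γ} (hs : s ∈ S) (hu : u ∈ S) (x : Γ →₀ ℤ[T;T⁻¹]) :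
    leftMul N u (wallCross N s x) = wallCross N s (leftMul N u x) := by
  classical
  suffices H : leftMul N u ∘ₗ wallCross N s = wallCross N s ∘ₗ leftMul N u from
    LinearMap.congr_fun H x
  apply endo_ext
  intro w
  have e1 : u ∈ N (w * s) ↔ Xor (u ∈ N w) (w * s * w⁻¹ = u) := by
    rw [h.mem_mul, h.simple s hs, Set.mem_singleton_iff]
    have : w⁻¹ * u * w = s ↔ w * s * w⁻¹ = u := by
      constructor
      · rintro rfl; group
      · rintro rfl; group
    rw [this]
  have e3 : u * w * s * (u * w)⁻¹ ∈ N (u * w) ↔ Xor (w * s * w⁻¹ = u) (w * s * w⁻¹ ∈ N w) := by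
    rw [h.mem_mul, h.simple u hu, Set.mem_singleton_iff]
    have a1 : u * w * s * (u * w)⁻¹ = u ↔ w * s * w⁻¹ = u := by
      rw [show u * w * s * (u * w)⁻¹ = u * (w * s * w⁻¹) * u⁻¹ by group, mul_inv_eq_iff_eq_mul,
        mul_right_inj]
    have a2 : u⁻¹ * (u * w * s * (u * w)⁻¹) * u = w * s * w⁻¹ := by group
    rw [a1, a2]
  simp only [LinearMap.comp_apply, wallCross_single, leftMul_single, map_add, map_smul]
  by_cases heq : w * s * w⁻¹ = u
  · have e4 : w * s = u * w := by rw [← heq]; group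
    have e5 : u * (u * w) = w := by rw [← mul_assoc, h.mul_self u hu, one_mul]
    have e6 : u * w * s = w := by rw [← e4, h.mul_mul_cancel hs]
    have d1 : w * s * w⁻¹ ∈ N w ↔ u ∈ N w := by rw [heq]
    have d2 : u * w * s * (u * w)⁻¹ ∈ N (u * w) ↔ ¬ u ∈ N w := by
      rw [e3, d1]; simp [heq, Xor]
    have d3 : u ∈ N (w * s) ↔ ¬ u ∈ N w := by rw [e1]; simp [heq, Xor]
    simp only [d1, d2, d3]
    simp only [e4, e5, e6]
    by_cases hw : u ∈ N w
    · simp only [hw, not_true, if_true, if_false]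
      module
    · simp only [hw, not_false_iff, if_true, if_false]
      module
  · have d2 : u * w * s * (u * w)⁻¹ ∈ N (u * w) ↔ w * s * w⁻¹ ∈ N w := by
      rw [e3]; simp [heq, Xor]
    have d3 : u ∈ N (w * s) ↔ u ∈ N w := by rw [e1]; simp [heq, Xor]
    simp only [d2, d3, ← mul_assoc]
    module

/-- Up to a multiple of `single w 1`, left multiplication by `u` sends `single w 1` to `single (u *
w) 1`, so agreement at the identity propagates along words. This takes the place of braid relations.
-/
lemma eq_of_commute_leftMul {f g : (Γ →₀ ℤ[T;T⁻¹]) →ₗ[ℤ[T;T⁻¹]] (Γ →₀ ℤ[T;T⁻¹])}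
    (hf : ∀ u ∈ S, ∀ x, leftMul N u (f x) = f (leftMul N u x))
    (hg : ∀ u ∈ S, ∀ x, leftMul N u (g x) = g (leftMul N u x))
    (hfg : f (single 1 1) = g (single 1 1)) : f = g := by
  apply endo_ext
  intro w
  obtain ⟨l, hl, rfl⟩ := h.exists_word w
  induction l with
  | nil => exact hfg
  | cons u l ih =>
    have hu : u ∈ S := hl u List.mem_cons_self
    have ih := ih fun x hx => hl x (List.mem_cons_of_mem _ hx)
    have h1 := hf u hu (single l.prod 1)
    rw [ih, hg u hu, leftMul_single] at h1
    simp only [map_add, map_smul, ih] at h1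
    rw [List.prod_cons]
    exact (add_left_cancel h1).symm

lemma leftMul_rightMulWord {l : List Γ} (hl : ∀ s ∈ l, s ∈ S) {u : Γ} (hu : u ∈ S)
    (x : Γ →₀ ℤ[T;T⁻¹]) :
    leftMul N u (rightMulWord N l x) = rightMulWord N l (leftMul N u x) := by
  induction l generalizing x with
  | nil => rfl
  | cons s l ih =>
    rw [rightMulWord, LinearMap.comp_apply, LinearMap.comp_apply,
      ih fun s hs => hl s (List.mem_cons_of_mem _ hs)]
    congr 1
    simp only [rightMul, LinearMap.sub_apply, LinearMap.smul_apply, LinearMap.id_apply, map_sub,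
      map_smul]
    rw [h.leftMul_wallCross (hl s List.mem_cons_self) hu]

omit h in
lemma rightMul_of_notMem {w s : Γ} (hd : ¬ w * s * w⁻¹ ∈ N w) :
    rightMul N s (single w 1) = single (w * s) 1 := by
  simp only [rightMul, LinearMap.sub_apply, wallCross_single, if_neg hd, LinearMap.smul_apply,
    LinearMap.id_apply]
  abel

/-- The quadratic relation. It says that the product of `wallCross - T 1` and `wallCross - T (-1)`
is the identity, so `rightMulBar` is the inverse of `rightMul`. -/
lemma wallCross_sq {s : Γ} (hs : s ∈ S) (x : Γ →₀ ℤ[T;T⁻¹]) :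
    wallCross N s (wallCross N s x) = (T 1 + T (-1) : ℤ[T;T⁻¹]) • wallCross N s x := by
  classical
  suffices H : wallCross N s ∘ₗ wallCross N s = (T 1 + T (-1) : ℤ[T;T⁻¹]) • wallCross N s from
    LinearMap.congr_fun H x
  apply endo_ext
  intro w
  have h11 : (T 1 * T (-1) : ℤ[T;T⁻¹]) = 1 := by rw [← T_add]; simp
  have e := h.mem_conj_mul_iff w hs
  simp only [LinearMap.comp_apply, LinearMap.smul_apply, wallCross_single, map_add, map_smul]
  by_cases hd : w * s * w⁻¹ ∈ N w
  · rw [if_pos hd, if_neg (by rw [e]; exact fun hh => hh hd), h.mul_mul_cancel hs]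
    simp only [smul_add, smul_smul, add_mul, h11, add_smul, one_smul]
    abel
  · rw [if_neg hd, if_pos (e.mpr hd), h.mul_mul_cancel hs]
    simp only [smul_add, smul_smul, add_mul, mul_comm (T (-1) : ℤ[T;T⁻¹]) (T 1), h11, add_smul,
      one_smul]
    abel

lemma rightMul_rightMulBar {s : Γ} (hs : s ∈ S) (x : Γ →₀ ℤ[T;T⁻¹]) :
    rightMul N s (rightMulBar N s x) = x := by
  have h11 : (T (-1) * T 1 : ℤ[T;T⁻¹]) = 1 := by rw [← T_add]; simp
  simp only [rightMul, rightMulBar, LinearMap.sub_apply, LinearMap.smul_apply, LinearMap.id_apply,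
    map_sub, map_smul, h.wallCross_sq hs, smul_sub, smul_smul, h11, one_smul, add_smul]
  abel

lemma rightMulBar_rightMul {s : Γ} (hs : s ∈ S) (x : Γ →₀ ℤ[T;T⁻¹]) :
    rightMulBar N s (rightMul N s x) = x := by
  have h11 : (T 1 * T (-1) : ℤ[T;T⁻¹]) = 1 := by rw [← T_add]; simp
  simp only [rightMul, rightMulBar, LinearMap.sub_apply, LinearMap.smul_apply, LinearMap.id_apply,
    map_sub, map_smul, h.wallCross_sq hs, smul_sub, smul_smul, h11, one_smul, add_smul]
  abel

lemma rightMulBarWord_rightMulWord {l : List Γ} (hl : ∀ s ∈ l, s ∈ S) (x : Γ →₀ ℤ[T;T⁻¹]) :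
    rightMulBarWord N l.reverse (rightMulWord N l x) = x := by
  induction l generalizing x with
  | nil => rfl
  | cons s l ih =>
    rw [List.reverse_cons, rightMulBarWord_append, rightMulWord, LinearMap.comp_apply,
      LinearMap.comp_apply, ih fun s hs => hl s (List.mem_cons_of_mem _ hs)]
    exact h.rightMulBar_rightMul (hl s List.mem_cons_self) x

lemma rightMulWord_rightMulBarWord {l : List Γ} (hl : ∀ s ∈ l, s ∈ S) (x : Γ →₀ ℤ[T;T⁻¹]) :
    rightMulWord N l (rightMulBarWord N l.reverse x) = x := by
  induction l generalizing x with
  | nil => rfl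
  | cons s l ih =>
    rw [List.reverse_cons, rightMulBarWord_append, rightMulWord, LinearMap.comp_apply,
      LinearMap.comp_apply]
    change rightMulWord N l (rightMul N s (rightMulBar N s (rightMulBarWord N l.reverse x))) = x
    rw [h.rightMul_rightMulBar (hl s List.mem_cons_self),
      ih fun s hs => hl s (List.mem_cons_of_mem _ hs)]

/-- Reduced words act on the base element as expected. -/
lemma rightMulWord_single_one {l : List Γ} (hl : ∀ s ∈ l, s ∈ S)
    (hred : l.length = wordLength S l.prod) :
    rightMulWord N l (single 1 1) = single l.prod 1 := by
  induction l using List.reverseRecOn with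
  | nil => rfl
  | append_singleton l s ih =>
    have hs : s ∈ S := hl s (by simp)
    have hl' : ∀ s ∈ l, s ∈ S := fun x hx => hl x (by simp [hx])
    have h1 := wordLength_le hl'
    have hd : ¬ l.prod * s * l.prod⁻¹ ∈ N l.prod := by
      intro hd
      have h2 := h.wordLength_lt_of_mem hd
      simp only [List.length_append, List.length_singleton, List.prod_append,
        List.prod_singleton] at hred
      omega
    have h2 := h.wordLength_of_notMem hs hd
    rw [rightMulWord_append, LinearMap.comp_apply, ih hl' ?_]
    · simp only [rightMulWord, LinearMap.comp_apply, LinearMap.id_apply,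
        rightMul_of_notMem hd, List.prod_append, List.prod_singleton]
    · simp only [List.length_append, List.length_singleton, List.prod_append,
        List.prod_singleton] at hred
      omega

/-- The bar-conjugate action of a reduced word depends only on its product. -/
lemma rightMulBarWord_eq {l l' : List Γ} (hl : ∀ s ∈ l, s ∈ S) (hl' : ∀ s ∈ l', s ∈ S)
    (hred : l.length = wordLength S l.prod) (hred' : l'.length = wordLength S l'.prod)
    (he : l.prod = l'.prod) : rightMulBarWord N l = rightMulBarWord N l' := by
  have hrev : ∀ {l : List Γ}, (∀ s ∈ l, s ∈ S) → l.reverse.prod = l.prod⁻¹ := by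
    intro l hl
    rw [List.prod_inv_reverse,
      List.map_congr_left (fun x hx => h.inv_simple (hl x hx)), List.map_id']
  have hm : ∀ {l : List Γ}, (∀ s ∈ l, s ∈ S) → ∀ s ∈ l.reverse, s ∈ S :=
    fun hl s hs => hl s (List.mem_reverse.mp hs)
  -- Both reversed words are reduced words of the inverse element, so their right actions agree at
  -- the identity and hence everywhere. The two operators in the claim are the inverses of these.
  have key : rightMulWord N l.reverse = rightMulWord N l'.reverse := by
    refine h.eq_of_commute_leftMul (fun u hu x => h.leftMul_rightMulWord (hm hl) hu x)
      (fun u hu x => h.leftMul_rightMulWord (hm hl') hu x) ?_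
    rw [h.rightMulWord_single_one (hm hl), h.rightMulWord_single_one (hm hl'), hrev hl, hrev hl',
      he]
    · rw [hrev hl', h.wordLength_inv, List.length_reverse, hred']
    · rw [hrev hl, h.wordLength_inv, List.length_reverse, hred]
  ext1 w
  ext1
  have h1 := fun x => h.rightMulBarWord_rightMulWord (hm hl) x
  have h2 := fun x => h.rightMulWord_rightMulBarWord (hm hl') x
  simp only [List.reverse_reverse] at h1 h2
  simp only [LinearMap.comp_apply]
  rw [← h2 (lsingle w 1), ← key, h1, key, h2]

/-- The image of a basis element under the bar involution. -/
def barBasis (w : Γ) : Γ →₀ ℤ[T;T⁻¹] :=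
  rightMulBarWord N (h.exists_minimal_word w).choose (single 1 1)

lemma barBasis_eq {l : List Γ} (hl : ∀ s ∈ l, s ∈ S) (hred : l.length = wordLength S l.prod) :
    h.barBasis l.prod = rightMulBarWord N l (single 1 1) := by
  obtain ⟨h1, h2, h3⟩ := (h.exists_minimal_word l.prod).choose_spec
  rw [barBasis, h.rightMulBarWord_eq h1 hl (by rw [h3, h2]) hred h2]

lemma barBasis_one : h.barBasis 1 = single 1 1 := by
  have h0 : wordLength S (1 : Γ) = 0 :=
    Nat.le_zero.mp (wordLength_le (S := S) (l := []) (by simp))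
  have := h.barBasis_eq (l := []) (by simp) (by simp [h0])
  exact this

lemma barBasis_mul {w s : Γ} (hs : s ∈ S) (hd : ¬ w * s * w⁻¹ ∈ N w) :
    h.barBasis (w * s) = rightMulBar N s (h.barBasis w) := by
  obtain ⟨l, hl, rfl, hn⟩ := h.exists_minimal_word w
  have hl' : ∀ x ∈ l ++ [s], x ∈ S := by
    intro x hx
    rcases List.mem_append.mp hx with h1 | h1
    · exact hl x h1
    · rw [List.mem_singleton.mp h1]; exact hs
  have hp : (l ++ [s]).prod = l.prod * s := by simp
  have h1 := h.barBasis_eq hl' (by rw [hp, h.wordLength_of_notMem hs hd, ← hn]; simp)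
  rw [hp] at h1
  rw [h1, h.barBasis_eq hl hn, rightMulBarWord_append]
  rfl

/-- The bar involution. -/
def bar : (Γ →₀ ℤ[T;T⁻¹]) →+ (Γ →₀ ℤ[T;T⁻¹]) :=
  Finsupp.liftAddHom fun w =>
    ((LinearMap.toSpanSingleton ℤ[T;T⁻¹] _ (h.barBasis w)).toAddMonoidHom).comp
      (invert (R := ℤ)).toRingEquiv.toAddEquiv.toAddMonoidHom

lemma bar_single (w : Γ) (f : ℤ[T;T⁻¹]) : h.bar (single w f) = invert f • h.barBasis w := by
  simp [bar]

lemma bar_smul (f : ℤ[T;T⁻¹]) (x : Γ →₀ ℤ[T;T⁻¹]) : h.bar (f • x) = invert f • h.bar x := by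
  induction x using Finsupp.induction_linear with
  | zero => simp
  | add x y hx hy => rw [smul_add, map_add, hx, hy, map_add, smul_add]
  | single w g => rw [Finsupp.smul_single, bar_single, bar_single, smul_eq_mul, map_mul, mul_smul]

/-- The operator is both `rightMul` plus `T 1` and `rightMulBar` plus `T (-1)`, two expressions that
bar exchanges. At a non-descent this is the recursion `barBasis_mul`; at a descent the recursion is
applied to `w * s`, followed by the quadratic relation. -/
lemma bar_wallCross {s : Γ} (hs : s ∈ S) (x : Γ →₀ ℤ[T;T⁻¹]) :
    h.bar (wallCross N s x) = wallCross N s (h.bar x) := by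
  have h11 : (T 1 * T (-1) : ℤ[T;T⁻¹]) = 1 := by rw [← T_add]; simp
  induction x using Finsupp.induction_linear with
  | zero => simp
  | add x y hx hy => rw [map_add, map_add, hx, hy, map_add, map_add]
  | single w g =>
    have e : single w g = g • (single w 1 : Γ →₀ ℤ[T;T⁻¹]) := by simp
    rw [e, map_smul, bar_smul, bar_smul, map_smul]
    congr 1
    rw [wallCross_single, map_add, bar_smul, bar_single, bar_single, map_one, one_smul, one_smul]
    by_cases hd : w * s * w⁻¹ ∈ N w
    · have hd' : ¬ w * s * s * (w * s)⁻¹ ∈ N (w * s) := by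
        rw [h.mem_conj_mul_iff w hs]; exact fun hh => hh hd
      have h1 := h.barBasis_mul hs hd'
      rw [h.mul_mul_cancel hs] at h1
      rw [if_pos hd, h1, rightMulBar, invert_T, neg_neg]
      simp only [LinearMap.sub_apply, LinearMap.smul_apply, LinearMap.id_apply, map_sub, map_smul,
        h.wallCross_sq hs, smul_sub, smul_smul, h11, one_smul, add_smul]
      abel
    · rw [if_neg hd, h.barBasis_mul hs hd, rightMulBar, invert_T]
      simp only [LinearMap.sub_apply, LinearMap.smul_apply, LinearMap.id_apply]
      abel

/-- Unitriangularity with respect to length, by induction along a descent `s` of `w`. The element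
for `w` is `rightMulBar N s` of the one for `w * s`, and for `v` at least as long as `w` its
coordinate at `v` is the previous coordinate at `v * s`. -/
lemma barBasis_apply (w : Γ) : h.barBasis w w = 1 ∧
    ∀ v, v ≠ w → wordLength S w ≤ wordLength S v → h.barBasis w v = 0 := by
  classical
  induction hn : wordLength S w using Nat.strong_induction_on generalizing w with
  | _ n ih =>
  by_cases hw : w = 1
  · subst hw
    rw [barBasis_one]
    exact ⟨single_eq_same, fun v hv _ => single_eq_of_ne hv⟩
  obtain ⟨s, hs, hd⟩ := h.exists_descent hw
  have hlt := h.wordLength_lt_of_mem hd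
  have hd' : ¬ w * s * s * (w * s)⁻¹ ∈ N (w * s) := by
    rw [h.mem_conj_mul_iff w hs]; exact fun hh => hh hd
  have h1 := h.barBasis_mul hs hd'
  rw [h.mul_mul_cancel hs] at h1
  obtain ⟨e1, e2⟩ := ih _ (hn ▸ hlt) (w * s) rfl
  have hlw : wordLength S w = wordLength S (w * s) + 1 := by
    have := h.wordLength_of_notMem hs hd'
    rwa [h.mul_mul_cancel hs] at this
  have key : ∀ v, wordLength S w ≤ wordLength S v →
      h.barBasis w v = h.barBasis (w * s) (v * s) := by
    intro v hv
    have hv0 : h.barBasis (w * s) v = 0 := by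
      refine e2 v ?_ (by omega)
      rintro rfl
      omega
    -- The coordinate at `v` of the image only involves the coordinates of `x` at `v` and at `v *
    -- s`.
    have gen : ∀ x : Γ →₀ ℤ[T;T⁻¹], x v = 0 → rightMulBar N s x v = x (v * s) := by
      intro x hx
      have : ∀ x : Γ →₀ ℤ[T;T⁻¹], ∃ f : ℤ[T;T⁻¹], rightMulBar N s x v = f * x v + x (v * s) := by
        refine fun x => ⟨(if v * s * v⁻¹ ∈ N v then T (-1) else T 1) - T (-1), ?_⟩
        induction x using Finsupp.induction_linear with
        | zero => simp
        | add x y hx hy => rw [map_add, Finsupp.add_apply, hx, hy]; simp; ring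
        | single u g =>
          have e : single u g = g • (single u 1 : Γ →₀ ℤ[T;T⁻¹]) := by simp
          have hus : u * s = v ↔ u = v * s :=
            ⟨fun hh => by rw [← hh, h.mul_mul_cancel hs], fun hh => by
              rw [hh, h.mul_mul_cancel hs]⟩
          rw [e, map_smul, rightMulBar]
          simp only [LinearMap.sub_apply, wallCross_single, LinearMap.smul_apply,
            LinearMap.id_apply, Finsupp.smul_apply, Finsupp.sub_apply, Finsupp.add_apply,
            Finsupp.single_apply, hus, smul_eq_mul]
          by_cases huv : u = v
          · subst huv; simp only [if_true]; split_ifs <;> ring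
          · simp [huv]
      obtain ⟨f, hf⟩ := this x
      rw [hf, hx, mul_zero, zero_add]
    rw [h1]
    exact gen _ hv0
  constructor
  · rw [key w le_rfl, e1]
  · intro v hv hle
    rw [← hn] at hle
    rw [key v hle]
    refine e2 _ (fun hh => hv (mul_right_cancel hh)) ?_
    have := h.wordLength_mul_le (v * s) hs
    rw [h.mul_mul_cancel hs] at this
    omega

/-- A bar-invariant element whose coefficients only involve positive powers of `T` vanishes. -/
lemma eq_zero_of_bar_eq {x : Γ →₀ ℤ[T;T⁻¹]} (hx : h.bar x = x)
    (hpos : ∀ w, ∀ k : ℤ, k ≤ 0 → (x w).coeff k = 0) : x = 0 := by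
  classical
  by_contra hne
  -- At an element of maximal length in the support only its own term contributes to the bar image.
  -- Its coefficient is therefore symmetric under inversion of `T`, and positivity of the exponents
  -- kills it.
  obtain ⟨w, hw, hmax⟩ := Finset.exists_max_image x.support (wordLength S)
    (Finsupp.support_nonempty_iff.mpr hne)
  have hc : h.bar x w = invert (x w) := by
    rw [bar, Finsupp.liftAddHom_apply, Finsupp.sum, Finsupp.finsetSum_apply,
      Finset.sum_eq_single w]
    · simp [(h.barBasis_apply w).1]
    · intro v hv hvw
      have := (h.barBasis_apply v).2 w hvw.symm (hmax v hv)
      simp [this]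
    · intro hw'; exact absurd hw hw'
  rw [hx] at hc
  refine Finsupp.mem_support_iff.mp hw ?_
  ext k
  rcases le_or_gt k 0 with hk | hk
  · exact hpos w k hk
  · rw [hc, invert_apply]
    exact hpos w (-k) (by omega)

end Bar

end IsInversionCocycle
end SoergelPath
end

noncomputable section
open scoped LaurentPolynomial InnerProductSpace
namespace SoergelPath

/-! ### The affine reflection group -/

section Levels

/-- As `ENat.toNat ⊤ = 0`, the multiples of `e.toNat` are just `0` when `e = ∞`, so one formula
covers both cases. -/
lemma mem_levels {e : ℕ∞} {b : ℝ} : b ∈ levels e ↔ ∃ m : ℤ, b = m * (e.toNat : ℝ) := by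
  unfold levels level
  by_cases he : e = ⊤
  · subst he
    simp only [if_true, ENat.toNat_top, Nat.cast_zero, mul_zero, exists_const]
    constructor
    · rintro ⟨m, hm⟩
      split_ifs at hm
      · exact absurd hm (EReal.coe_ne_bot b)
      · exact_mod_cast hm
      · exact absurd hm (EReal.coe_ne_top b)
    · rintro rfl
      exact ⟨0, by simp⟩
  · simp only [if_neg he, Set.mem_ofPred_eq, EReal.coe_eq_coe_iff]

lemma level_monotone (e : ℕ∞) : Monotone (level e) := by
  intro m n hmn
  unfold level
  by_cases he : e = ⊤
  · simp only [he, if_true]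
    split_ifs <;> first | exact bot_le | exact le_top | exact le_rfl | omega
  · simp only [if_neg he, EReal.coe_le_coe_iff]
    have : (m : ℝ) ≤ n := by exact_mod_cast hmn
    gcongr

lemma zero_mem_levels (e : ℕ∞) : (0 : ℝ) ∈ levels e := mem_levels.mpr ⟨0, by simp⟩

lemma add_mem_levels {e : ℕ∞} {b c : ℝ} (hb : b ∈ levels e) (hc : c ∈ levels e) :
    b + c ∈ levels e := by
  obtain ⟨m, rfl⟩ := mem_levels.mp hb
  obtain ⟨n, rfl⟩ := mem_levels.mp hc
  exact mem_levels.mpr ⟨m + n, by push_cast; ring⟩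

lemma neg_mem_levels {e : ℕ∞} {b : ℝ} (hb : b ∈ levels e) : -b ∈ levels e := by
  obtain ⟨m, rfl⟩ := mem_levels.mp hb
  exact mem_levels.mpr ⟨-m, by push_cast; ring⟩

lemma sub_mem_levels {e : ℕ∞} {b c : ℝ} (hb : b ∈ levels e) (hc : c ∈ levels e) :
    b - c ∈ levels e := by
  rw [sub_eq_add_neg]; exact add_mem_levels hb (neg_mem_levels hc)

lemma mul_int_mem_levels {e : ℕ∞} {b : ℝ} (hb : b ∈ levels e) (z : ℤ) : b * z ∈ levels e := by
  obtain ⟨m, rfl⟩ := mem_levels.mp hb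
  exact mem_levels.mpr ⟨m * z, by push_cast; ring⟩

end Levels

section Pairing

variable {r : ℕ}

lemma corootPairing_add (α x y : E r) :
    corootPairing α (x + y) = corootPairing α x + corootPairing α y := by
  simp only [corootPairing, inner_add_left]; ring

lemma corootPairing_sub (α x y : E r) :
    corootPairing α (x - y) = corootPairing α x - corootPairing α y := by
  simp only [corootPairing, inner_sub_left]; ring

lemma corootPairing_smul (α x : E r) (c : ℝ) :
    corootPairing α (c • x) = c * corootPairing α x := by
  simp only [corootPairing, real_inner_smul_left]; ring

lemma corootPairing_neg_left (α x : E r) : corootPairing (-α) x = -corootPairing α x := by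
  simp only [corootPairing, inner_neg_right, inner_neg_left]; ring

lemma corootPairing_self {α : E r} (hα : α ≠ 0) : corootPairing α α = 2 := by
  have : ⟪α, α⟫_ℝ ≠ 0 := inner_self_ne_zero.mpr hα
  simp only [corootPairing]; field_simp

lemma corootPairing_isometry (L : E r ≃ₗᵢ[ℝ] E r) (α x : E r) :
    corootPairing (L α) (L x) = corootPairing α x := by
  simp only [corootPairing, L.inner_map_map]

/-- The position of `y` relative to the hyperplane `⟨y, α^∨⟩ = b`. -/
def ht (α : E r) (b : ℝ) (y : E r) : ℝ := corootPairing α y - b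

lemma ht_neg (α : E r) (b : ℝ) (y : E r) : ht (-α) (-b) y = -ht α b y := by
  rw [ht, corootPairing_neg_left, ht]; ring

lemma affineReflection_eq (α : E r) (b : ℝ) (y : E r) :
    affineReflection α b y = y - ht α b y • α := rfl

lemma ht_affineReflection (α β : E r) (b c : ℝ) (y : E r) :
    ht β c (affineReflection α b y) = ht β c y - ht α b y * corootPairing β α := by
  rw [affineReflection_eq]
  simp only [ht, corootPairing_sub, corootPairing_smul]
  ring

lemma affineReflection_involutive (α : E r) (b : ℝ) :
    Function.Involutive (affineReflection α b) := by
  intro y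
  by_cases hα : α = 0
  · subst hα; simp [affineReflection]
  · rw [affineReflection_eq, ht_affineReflection, corootPairing_self hα, affineReflection_eq]
    module

/-- The reflection in the hyperplane `⟨y, α^∨⟩ = b`, as a permutation. -/
def refl (α : E r) (b : ℝ) : Equiv.Perm (E r) := (affineReflection_involutive α b).toPerm

@[simp] lemma refl_apply (α : E r) (b : ℝ) (y : E r) : refl α b y = affineReflection α b y := rfl

lemma refl_mul_self (α : E r) (b : ℝ) : refl α b * refl α b = 1 :=
  Equiv.ext fun y => affineReflection_involutive α b y

lemma refl_neg (α : E r) (b : ℝ) : refl (-α) (-b) = refl α b := by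
  ext1 y
  simp only [refl_apply, affineReflection_eq, ht_neg]
  module

lemma affineReflection_of_ht_eq_zero {α : E r} {b : ℝ} {y : E r} (hy : ht α b y = 0) :
    affineReflection α b y = y := by
  rw [affineReflection_eq, hy, zero_smul, sub_zero]

lemma refl_commute {α β : E r} (h : corootPairing β α = 0) (h' : corootPairing α β = 0) (b c : ℝ) :
    refl α b * refl β c = refl β c * refl α b := by
  ext1 y
  simp only [Equiv.Perm.mul_apply, refl_apply]
  rw [affineReflection_eq α b (affineReflection β c y),
    affineReflection_eq β c (affineReflection α b y), ht_affineReflection, ht_affineReflection, h,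
    h', affineReflection_eq, affineReflection_eq]
  module

/-- The permutation `t` (a reflection) separates `x` from `y`. -/
def SepBy (t : Equiv.Perm (E r)) (x y : E r) : Prop := ⟪x - t x, y - t y⟫_ℝ < 0

/-- The displacement of a point under a reflection is its height times the root, so the sign of the
inner product compares sides. Since `SepBy` uses only the reflection itself, inversions become sets
of group elements, and the choice between a root and its negative is irrelevant. -/
lemma sepBy_refl {α : E r} (hα : α ≠ 0) (b : ℝ) (x y : E r) :
    SepBy (refl α b) x y ↔ ht α b x * ht α b y < 0 := by
  have h1 : 0 < ⟪α, α⟫_ℝ := real_inner_self_pos.mpr hα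
  simp only [SepBy, refl_apply, affineReflection_eq, sub_sub_cancel, real_inner_smul_left,
    real_inner_smul_right, ← mul_assoc]
  constructor
  · intro h; by_contra hn; push Not at hn; nlinarith [mul_nonneg hn h1.le]
  · intro h; nlinarith [mul_neg_of_neg_of_pos h h1]

end Pairing

namespace Geometry

variable {r : ℕ} (G : Geometry r)

/-- `t` is one of the reflections generating the group. -/
def IsRefl (t : Equiv.Perm (E r)) : Prop := ∃ α ∈ G.Φ, ∃ b ∈ levels G.e, t = refl α b

/-- The point `y` lies on no hyperplane. -/
def Reg (y : E r) : Prop := ∀ α ∈ G.Φ, ∀ b ∈ levels G.e, ht α b y ≠ 0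

/-- `y` is in the closure of the alcove of `v`. -/
def Near (v y : E r) : Prop := ∀ α ∈ G.Φ, ∀ b ∈ levels G.e, 0 ≤ ht α b y * ht α b v

variable {G}

lemma refl_mem_W {α : E r} (hα : α ∈ G.Φ) {b : ℝ} (hb : b ∈ levels G.e) : refl α b ∈ G.W :=
  Subgroup.subset_closure ⟨α, hα, b, hb, fun _ => rfl⟩

variable (G) in
/-- Affine isometries preserving the hyperplane arrangement, in coordinates. -/
def Preserves (g : Equiv.Perm (E r)) (L : E r ≃ₗᵢ[ℝ] E r) (τ : E r) : Prop :=
  (∀ y, g y = L y + τ) ∧ (∀ α, α ∈ G.Φ ↔ L α ∈ G.Φ) ∧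
    ∀ α ∈ G.Φ, corootPairing α τ ∈ levels G.e

variable (hΦ : IsIrredRootSystem G.Φ)
include hΦ

lemma neg_mem {α : E r} (hα : α ∈ G.Φ) : -α ∈ G.Φ := by
  have := hΦ.refl_mem α hα α hα
  rw [corootPairing_self (hΦ.ne_zero α hα)] at this
  convert this using 1
  module

lemma exists_preserves {g : Equiv.Perm (E r)} (hg : g ∈ G.W) : ∃ L τ, G.Preserves g L τ := by
  unfold W at hg
  induction hg using Subgroup.closure_induction with
  | mem g hg =>
    obtain ⟨β, hβ, b, hb, hg⟩ := hg
    have hβ0 := hΦ.ne_zero β hβ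
    have hL : ∀ y, (Submodule.reflection (ℝ ∙ β)ᗮ) y = y - corootPairing β y • β := by
      intro y
      rw [Submodule.reflection_orthogonal_apply, Submodule.reflection_singleton_apply,
        corootPairing, real_inner_self_eq_norm_sq, real_inner_comm, ← Nat.cast_smul_eq_nsmul ℝ,
        smul_smul]
      simp only [RCLike.ofReal_real_eq_id, id, mul_div_assoc, Nat.cast_ofNat]
      abel
    refine ⟨Submodule.reflection (ℝ ∙ β)ᗮ, b • β, fun y => ?_, fun α => ⟨fun hα => ?_, fun hα => ?_⟩,
      fun α hα => ?_⟩
    · rw [hg, hL, affineReflection]; module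
    · rw [hL]; exact hΦ.refl_mem β hβ α hα
    · have := hΦ.refl_mem β hβ _ hα
      rw [← hL, Submodule.reflection_reflection] at this
      exact this
    -- Integrality of the root system keeps the translation part `b • β` compatible with the levels.
    · obtain ⟨z, hz⟩ := hΦ.integral α hα β hβ
      rw [corootPairing_smul, hz]
      exact mul_int_mem_levels hb z
  | one =>
    refine ⟨LinearIsometryEquiv.refl ℝ _, 0, by simp, by simp, fun α _ => ?_⟩
    simpa [corootPairing] using zero_mem_levels G.e
  | mul g g' _ _ hg hg' =>
    obtain ⟨L, τ, h1, h2, h3⟩ := hg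
    obtain ⟨L', τ', h1', h2', h3'⟩ := hg'
    refine ⟨L'.trans L, L τ' + τ, fun y => ?_, fun α => ?_, fun α hα => ?_⟩
    · rw [Equiv.Perm.mul_apply, h1', h1, map_add, add_assoc]; rfl
    · rw [h2', h2]; rfl
    · rw [corootPairing_add]
      refine add_mem_levels ?_ (h3 α hα)
      have e : α = L (L.symm α) := by simp
      rw [e, corootPairing_isometry]
      exact h3' _ ((h2 _).mpr (by rwa [← e]))
  | inv g _ hg =>
    obtain ⟨L, τ, h1, h2, h3⟩ := hg
    refine ⟨L.symm, -L.symm τ, fun y => ?_, fun α => ?_, fun α hα => ?_⟩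
    · rw [Equiv.Perm.inv_eq_iff_eq, h1]; simp
    · rw [h2 (L.symm α)]; simp
    · have e : α = L.symm (L α) := by simp
      rw [← neg_one_smul ℝ, corootPairing_smul, e, corootPairing_isometry, neg_one_mul]
      exact neg_mem_levels (h3 _ ((h2 _).mp hα))

omit hΦ in
lemma Preserves.ht {g : Equiv.Perm (E r)} {L : E r ≃ₗᵢ[ℝ] E r} {τ : E r} (h : G.Preserves g L τ)
    (α : E r) (b : ℝ) (y : E r) :
    ht (L α) (b + corootPairing (L α) τ) (g y) = SoergelPath.ht α b y := by
  rw [SoergelPath.ht, h.1, corootPairing_add, corootPairing_isometry, SoergelPath.ht]; ring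

omit hΦ in
lemma Preserves.ht' {g : Equiv.Perm (E r)} {L : E r ≃ₗᵢ[ℝ] E r} {τ : E r} (h : G.Preserves g L τ)
    (α : E r) (b : ℝ) (y : E r) :
    SoergelPath.ht α b (g y) = SoergelPath.ht (L.symm α) (b - corootPairing α τ) y := by
  have := h.ht (L.symm α) (b - corootPairing α τ) y
  simpa using this

omit hΦ in
lemma Preserves.mem_symm {g : Equiv.Perm (E r)} {L : E r ≃ₗᵢ[ℝ] E r} {τ : E r}
    (h : G.Preserves g L τ) {α : E r} (hα : α ∈ G.Φ) : L.symm α ∈ G.Φ := by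
  rw [h.2.1]; simpa using hα

omit hΦ in
lemma Preserves.conj {g : Equiv.Perm (E r)} {L : E r ≃ₗᵢ[ℝ] E r} {τ : E r} (h : G.Preserves g L τ)
    (α : E r) (b : ℝ) : g * refl α b * g⁻¹ = refl (L α) (b + corootPairing (L α) τ) := by
  rw [mul_inv_eq_iff_eq_mul]
  ext1 y
  simp only [Equiv.Perm.mul_apply, refl_apply, affineReflection_eq, h.ht]
  rw [h.1, h.1, map_sub, map_smul]
  abel

lemma isRefl_conj {g : Equiv.Perm (E r)} (hg : g ∈ G.W) {t : Equiv.Perm (E r)} (ht : G.IsRefl t) :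
    G.IsRefl (g * t * g⁻¹) := by
  obtain ⟨L, τ, h⟩ := exists_preserves hΦ hg
  obtain ⟨α, hα, b, hb, rfl⟩ := ht
  have hL := (h.2.1 α).mp hα
  exact ⟨L α, hL, _, add_mem_levels hb (h.2.2 _ hL), h.conj α b⟩

/-- Conjugation transports displacements by the linear part of the isometry, which preserves inner
products. -/
lemma sepBy_conj {g : Equiv.Perm (E r)} (hg : g ∈ G.W) (t : Equiv.Perm (E r)) (x y : E r) :
    SepBy (g⁻¹ * t * g) x y ↔ SepBy t (g x) (g y) := by
  obtain ⟨L, τ, h⟩ := exists_preserves hΦ hg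
  have key : ∀ z, g z - t (g z) = L (z - (g⁻¹ * t * g) z) := by
    intro z
    have : t (g z) = g ((g⁻¹ * t * g) z) := by
      simp [Equiv.Perm.mul_apply]
    rw [this, h.1, h.1 ((g⁻¹ * t * g) z), map_sub]; abel
  rw [SepBy, SepBy, key, key, L.inner_map_map]

lemma reg_apply {g : Equiv.Perm (E r)} (hg : g ∈ G.W) {y : E r} (hy : G.Reg y) : G.Reg (g y) := by
  obtain ⟨L, τ, h⟩ := exists_preserves hΦ hg
  intro α hα b hb
  rw [h.ht']
  exact hy _ (h.mem_symm hα) _ (sub_mem_levels hb (h.2.2 _ hα))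

lemma near_apply {g : Equiv.Perm (E r)} (hg : g ∈ G.W) {v y : E r} (hy : G.Near v y) :
    G.Near (g v) (g y) := by
  obtain ⟨L, τ, h⟩ := exists_preserves hΦ hg
  intro α hα b hb
  rw [h.ht', h.ht']
  exact hy _ (h.mem_symm hα) _ (sub_mem_levels hb (h.2.2 _ hα))

omit hΦ in
/-- The reflections separating `v` from `w v`. -/
def inversions (v : E r) (w : G.W) : Set G.W := {t | G.IsRefl t ∧ SepBy t v ((w : Equiv.Perm (E r)) v)}

omit hΦ in
/-- The reflections in the walls of the alcove of `v`. -/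
def walls (v : E r) : Set G.W := {t | G.IsRefl t ∧ inversions v t = {t}}

lemma mem_inversions_mul {v : E r} (hv : G.Reg v) (w u t : G.W) :
    t ∈ inversions v (w * u) ↔ Xor (t ∈ inversions v w) (w⁻¹ * t * w ∈ inversions v u) := by
  have e : G.IsRefl ((w⁻¹ * t * w : G.W) : Equiv.Perm (E r)) ↔ G.IsRefl t := by
    constructor
    · intro h
      have := isRefl_conj hΦ w.2 h
      convert this using 1
      simp [mul_assoc]
    · intro h
      have := isRefl_conj hΦ (w⁻¹).2 h
      simpa using this
  by_cases ht : G.IsRefl t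
  · have h2 : SepBy ((w⁻¹ * t * w : G.W) : Equiv.Perm (E r)) v ((u : Equiv.Perm (E r)) v) ↔ _ :=
      sepBy_conj hΦ w.2 t v _
    simp only [inversions, Set.mem_ofPred_eq, e, ht, true_and, h2]
    obtain ⟨α, hα, b, hb, htt⟩ := ht
    have hα0 := hΦ.ne_zero α hα
    simp only [htt, sepBy_refl hα0, Subgroup.coe_mul, Equiv.Perm.mul_apply]
    -- The cocycle rule is a sign count for the three nonzero heights at `v`, `w v` and `w (u v)`:
    -- the outer two differ in sign exactly when one of the two consecutive pairs does.
    have n1 := hv α hα b hb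
    have n2 := reg_apply hΦ w.2 hv α hα b hb
    have n3 := reg_apply hΦ w.2 (reg_apply hΦ u.2 hv) α hα b hb
    generalize SoergelPath.ht α b v = x at *
    generalize SoergelPath.ht α b (w.1 v) = y at *
    generalize SoergelPath.ht α b (w.1 (u.1 v)) = z at *
    rcases lt_or_gt_of_ne n1 with h1 | h1 <;> rcases lt_or_gt_of_ne n2 with h2 | h2 <;>
      rcases lt_or_gt_of_ne n3 with h3 | h3 <;>
      simp [Xor, mul_neg_iff, h1, h2, h3, not_lt_of_gt h1, not_lt_of_gt h2,
        not_lt_of_gt h3]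
  · simp only [inversions, Set.mem_ofPred_eq, e, ht, false_and, xor_self]

end Geometry
end SoergelPath
end

/-! ### Generation of the group by the walls of an alcove, and freeness on alcoves. -/

noncomputable section
open scoped LaurentPolynomial InnerProductSpace
namespace SoergelPath

lemma finite_levels_near (e : ℕ∞) (p C : ℝ) : {b | b ∈ levels e ∧ |p - b| < C}.Finite := by
  rcases Nat.eq_zero_or_pos e.toNat with h0 | h0
  · refine (Set.finite_singleton (0 : ℝ)).subset ?_
    rintro b ⟨hb, -⟩
    obtain ⟨m, rfl⟩ := mem_levels.mp hb
    simp [h0]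
  · have h1 : (1 : ℝ) ≤ e.toNat := by exact_mod_cast h0
    refine ((Set.finite_Icc (-⌈|p| + C⌉) ⌈|p| + C⌉).image
      (fun m : ℤ => (m : ℝ) * (e.toNat : ℝ))).subset ?_
    rintro b ⟨hb, hC⟩
    obtain ⟨m, rfl⟩ := mem_levels.mp hb
    refine ⟨m, ?_, rfl⟩
    have h2 : |(m : ℝ)| ≤ |p| + C := by
      have h3 : |(m : ℝ) * e.toNat| ≤ |p| + |p - m * e.toNat| := by
        have := abs_sub p (p - m * e.toNat)
        simpa using this
      rw [abs_mul, Nat.abs_cast] at h3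
      nlinarith [abs_nonneg (m : ℝ)]
    have h4 : |(m : ℝ)| ≤ ⌈|p| + C⌉ := h2.trans (Int.le_ceil _)
    have h5 : |m| ≤ ⌈|p| + C⌉ := by exact_mod_cast h4
    exact abs_le.mp h5

namespace Geometry

variable {r : ℕ} {G : Geometry r}

variable (hΦ : IsIrredRootSystem G.Φ)
include hΦ

/-- The quantity `|ht α b v| * ‖α‖` is twice the distance from `v` to the hyperplane. Local
finiteness is what the induction in `mem_closure_walls` runs on. -/
lemma finite_hyperplanes_near (v : E r) (C : ℝ) :
    {x : E r × ℝ | x.1 ∈ G.Φ ∧ x.2 ∈ levels G.e ∧ |ht x.1 x.2 v| * ‖x.1‖ < C}.Finite := by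
  refine (Set.Finite.biUnion G.Φ.finite_toSet fun α _ =>
    (finite_levels_near G.e (corootPairing α v) (C / ‖α‖)).image (fun b => (α, b))).subset ?_
  rintro ⟨α, b⟩ ⟨hα, hb, hC⟩
  refine Set.mem_biUnion hα ⟨b, ⟨hb, ?_⟩, rfl⟩
  rw [lt_div_iff₀ (norm_pos_iff.mpr (hΦ.ne_zero α hα))]
  exact hC

/-- The distance comparison behind the generation of the group by the walls of an alcove: here
`A`, `B` are the positions of a point relative to two hyperplanes with roots `α`, `β`. -/
lemma dist_lt_of_separates {α β : E r} (hα : α ∈ G.Φ) (hβ : β ∈ G.Φ) {b c : ℝ} {v : E r}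
    (hA : ht α b v ≠ 0) (hB : ht β c v ≠ 0) (hne : refl β c ≠ refl α b)
    (hsep : ht β c v * (ht β c v - ht α b v * corootPairing β α / 2) ≤ 0) :
    |ht β c v| * ‖β‖ < |ht α b v| * ‖α‖ ∧
      |ht α b v - ht β c v * corootPairing α β| < |ht α b v| := by
  -- The hypothesis `hsep` says that the foot of the perpendicular from `v` to the first hyperplane
  -- is on the second hyperplane or beyond it. So the second hyperplane is nearer to `v`, and
  -- reflection in it moves `v` closer to the first.
  have hα0 := hΦ.ne_zero α hα
  have hβ0 := hΦ.ne_zero β hβ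
  set A := ht α b v with hAdef
  set B := ht β c v with hBdef
  -- For parallel hyperplanes reducedness leaves `β = α` or `β = -α`, and `hne` makes the
  -- inequalities strict.
  by_cases hpar : |⟪α, β⟫_ℝ / (‖α‖ * ‖β‖)| = 1
  · obtain ⟨-, k, -, hk⟩ := (abs_real_inner_div_norm_mul_norm_eq_one_iff _ _).mp hpar
    have h2 := corootPairing_self hα0
    rcases hΦ.reduced α hα k (hk ▸ hβ) with rfl | rfl
    · rw [one_smul] at hk
      subst hk
      rw [h2] at hsep ⊢
      have hAB : A ≠ B := by
        intro h
        apply hne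
        have : b = c := by simp only [hAdef, hBdef, ht] at h; linarith
        rw [this]
      have hlt : |B| < |A| := by
        have h3 : B * B ≤ A * B := by nlinarith
        rcases lt_or_gt_of_ne hB with h4 | h4
        · have h5 : A ≤ B := by nlinarith
          rw [abs_of_neg h4, abs_of_neg (by linarith)]
          exact neg_lt_neg (lt_of_le_of_ne h5 hAB)
        · have h5 : B ≤ A := by nlinarith
          rw [abs_of_pos h4, abs_of_pos (by linarith)]
          exact lt_of_le_of_ne h5 hAB.symm
      refine ⟨mul_lt_mul_of_pos_right hlt (norm_pos_iff.mpr hα0), ?_⟩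
      have h3 : 0 < B * (A - B) :=
        lt_of_le_of_ne (by nlinarith) (mul_ne_zero hB (sub_ne_zero.mpr hAB)).symm
      rw [← sq_lt_sq]
      nlinarith
    · rw [neg_one_smul] at hk
      subst hk
      rw [corootPairing_neg_left, h2] at hsep
      rw [show corootPairing α (-α) = -2 by
        rw [← neg_one_smul ℝ, corootPairing_smul, h2]; ring, norm_neg]
      have hAB : A ≠ -B := by
        intro h
        apply hne
        have h4 : B = -ht α (-c) v := by rw [hBdef, ← ht_neg, neg_neg]
        have : b = -c := by simp only [h4, hAdef, ht] at h; linarith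
        rw [this, ← refl_neg, neg_neg]
      have h3 : B * B ≤ -(A * B) := by nlinarith
      have hlt : |B| < |A| := by
        rcases lt_or_gt_of_ne hB with h4 | h4
        · have h5 : -B ≤ A := by nlinarith
          rw [abs_of_neg h4, abs_of_pos (by linarith)]
          exact lt_of_le_of_ne h5 hAB.symm
        · have h5 : A ≤ -B := by nlinarith
          rw [abs_of_pos h4, abs_of_neg (by linarith)]
          have := lt_of_le_of_ne h5 hAB
          linarith
      refine ⟨mul_lt_mul_of_pos_right hlt (norm_pos_iff.mpr hα0), ?_⟩
      have h6 : 0 < B * (-B - A) :=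
        lt_of_le_of_ne (by nlinarith) (mul_ne_zero hB (sub_ne_zero.mpr hAB.symm)).symm
      rw [← sq_lt_sq]
      nlinarith
  -- For non-parallel roots the strict inequalities come from strict Cauchy–Schwarz.
  · have hna : 0 < ‖α‖ := norm_pos_iff.mpr hα0
    have hnb : 0 < ‖β‖ := norm_pos_iff.mpr hβ0
    have hcs : ⟪α, β⟫_ℝ ^ 2 < ‖α‖ ^ 2 * ‖β‖ ^ 2 := by
      have h1 := abs_real_inner_div_norm_mul_norm_le_one α β
      have h2 := lt_of_le_of_ne h1 hpar
      rw [abs_div, div_lt_one (by positivity), abs_of_pos (mul_pos hna hnb)] at h2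
      rw [← mul_pow, ← sq_abs]
      exact pow_lt_pow_left₀ h2 (abs_nonneg _) (by norm_num)
    set i := ⟪α, β⟫_ℝ with hi
    have ep : corootPairing β α = 2 * i / ‖β‖ ^ 2 := by
      rw [corootPairing, real_inner_self_eq_norm_sq]
    have eq : corootPairing α β = 2 * i / ‖α‖ ^ 2 := by
      rw [corootPairing, real_inner_self_eq_norm_sq, real_inner_comm]
    rw [ep] at hsep
    rw [eq]
    have h1 : B ^ 2 * ‖β‖ ^ 2 ≤ A * B * i := by
      have h2 : B * (B - A * (2 * i / ‖β‖ ^ 2) / 2) * ‖β‖ ^ 2 = B ^ 2 * ‖β‖ ^ 2 - A * B * i := by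
        field_simp
      have h3 := mul_nonpos_of_nonpos_of_nonneg hsep (sq_nonneg ‖β‖)
      linarith
    have hB2 : 0 < B ^ 2 := by positivity
    have h4 : 0 < A * B * i := lt_of_lt_of_le (by positivity) h1
    have hi2 : 0 < i ^ 2 := by
      have : i ≠ 0 := by rintro h; rw [h, mul_zero] at h4; exact lt_irrefl _ h4
      positivity
    have h5 : B ^ 2 * ‖β‖ ^ 4 ≤ A ^ 2 * i ^ 2 := by
      have h6 : (B ^ 2 * ‖β‖ ^ 2) ^ 2 ≤ (A * B * i) ^ 2 := pow_le_pow_left₀ (by positivity) h1 2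
      have h7 : B ^ 2 * (B ^ 2 * ‖β‖ ^ 4) ≤ B ^ 2 * (A ^ 2 * i ^ 2) := by nlinarith
      exact le_of_mul_le_mul_left h7 hB2
    have hA2 : 0 < A ^ 2 := by positivity
    constructor
    · have h8 : (|B| * ‖β‖) ^ 2 < (|A| * ‖α‖) ^ 2 := by
        rw [mul_pow, mul_pow, sq_abs, sq_abs]
        have h9 : (B ^ 2 * ‖β‖ ^ 2) * ‖β‖ ^ 2 < (A ^ 2 * ‖α‖ ^ 2) * ‖β‖ ^ 2 := by
          nlinarith [mul_lt_mul_of_pos_left hcs hA2]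
        exact lt_of_mul_lt_mul_right h9 (by positivity)
      exact lt_of_pow_lt_pow_left₀ 2 (by positivity) h8
    · rw [← sq_lt_sq]
      have h10 : (A - B * (2 * i / ‖α‖ ^ 2)) ^ 2 =
          A ^ 2 - 4 * (A * B * i * ‖α‖ ^ 2 - B ^ 2 * i ^ 2) / ‖α‖ ^ 4 := by
        field_simp; ring
      have h11 : 0 < A * B * i * ‖α‖ ^ 2 - B ^ 2 * i ^ 2 := by
        have h12 := mul_lt_mul_of_pos_left hcs hB2
        have h13 := mul_le_mul_of_nonneg_right h1 (sq_nonneg ‖α‖)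
        nlinarith
      rw [h10]
      have : 0 < 4 * (A * B * i * ‖α‖ ^ 2 - B ^ 2 * i ^ 2) / ‖α‖ ^ 4 := by positivity
      linarith

lemma mem_inversions_self {v : E r} (hv : G.Reg v) {t : G.W} (ht : G.IsRefl t) :
    t ∈ inversions v t := by
  refine ⟨ht, ?_⟩
  obtain ⟨α, hα, b, hb, htt⟩ := ht
  have hα0 := hΦ.ne_zero α hα
  rw [htt, sepBy_refl hα0, refl_apply, ht_affineReflection, corootPairing_self hα0]
  have := hv α hα b hb
  have : 0 < SoergelPath.ht α b v ^ 2 := by positivity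
  nlinarith

/-- If the reflection `s` is not in a wall, some other hyperplane separates `v` from `s v`. The
reflection `t'` in a suitable such hyperplane and the conjugate of `s` by `t'` both belong to
hyperplanes closer to `v`, and `s` is a product of these two. The induction is on the number of
hyperplanes closer than that of `s`. -/
lemma mem_closure_walls {v : E r} (hv : G.Reg v) {α : E r} (hα : α ∈ G.Φ) {b : ℝ}
    (hb : b ∈ levels G.e) :
    (⟨refl α b, refl_mem_W hα hb⟩ : G.W) ∈ Subgroup.closure (walls (G := G) v) := by
  induction hn : {x : E r × ℝ | x.1 ∈ G.Φ ∧ x.2 ∈ levels G.e ∧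
      |ht x.1 x.2 v| * ‖x.1‖ < |ht α b v| * ‖α‖}.ncard using Nat.strong_induction_on
      generalizing α b with
  | _ n ih =>
  have step : ∀ {β : E r} (hβ : β ∈ G.Φ) {c : ℝ} (hc : c ∈ levels G.e),
      |ht β c v| * ‖β‖ < |ht α b v| * ‖α‖ →
      (⟨refl β c, refl_mem_W hβ hc⟩ : G.W) ∈ Subgroup.closure (walls (G := G) v) := by
    intro β hβ c hc hlt
    refine ih _ ?_ hβ hc rfl
    rw [← hn]
    refine Set.ncard_lt_ncard ⟨fun x hx => ⟨hx.1, hx.2.1, hx.2.2.trans hlt⟩, fun hsub => ?_⟩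
      (finite_hyperplanes_near hΦ v _)
    exact lt_irrefl _ (hsub (show (β, c) ∈ _ from ⟨hβ, hc, hlt⟩)).2.2
  set s : G.W := ⟨refl α b, refl_mem_W hα hb⟩ with hs
  have hsr : G.IsRefl s := ⟨α, hα, b, hb, rfl⟩
  by_cases hw : s ∈ walls v
  · exact Subgroup.subset_closure hw
  have hss := mem_inversions_self hΦ hv hsr
  obtain ⟨t, ht, hts⟩ : ∃ t ∈ inversions v s, t ≠ s := by
    by_contra hcon
    push Not at hcon
    exact hw ⟨hsr, Set.eq_singleton_iff_unique_mem.mpr ⟨hss, hcon⟩⟩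
  -- after replacing `t` by `s t s` if necessary, `t` does not separate the far half
  obtain ⟨β, hβ, c, hc, hne, hsep⟩ : ∃ β ∈ G.Φ, ∃ c ∈ levels G.e, refl β c ≠ refl α b ∧
      SoergelPath.ht β c v * (SoergelPath.ht β c v -
        SoergelPath.ht α b v * corootPairing β α / 2) ≤ 0 := by
    obtain ⟨⟨β, hβ, c, hc, htt⟩, hsep⟩ := ht
    have hne : refl β c ≠ refl α b := fun h => hts (Subtype.ext (htt.trans h))
    rw [htt, sepBy_refl (hΦ.ne_zero β hβ)] at hsep
    have hsv : (s : Equiv.Perm (E r)) v = affineReflection α b v := rfl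
    rw [hsv] at hsep
    by_cases h0 : SoergelPath.ht β c v * (SoergelPath.ht β c v -
        SoergelPath.ht α b v * corootPairing β α / 2) ≤ 0
    · exact ⟨β, hβ, c, hc, hne, h0⟩
    · obtain ⟨L, τ, hL⟩ := exists_preserves hΦ s.2
      have hLβ := (hL.2.1 β).mp hβ
      refine ⟨L β, hLβ, c + corootPairing (L β) τ, add_mem_levels hc (hL.2.2 _ hLβ), ?_, ?_⟩
      · rw [← hL.conj]
        intro h
        apply hne
        have h' : s.1 * refl β c * s.1⁻¹ = s.1 := h
        rw [mul_inv_eq_iff_eq_mul, mul_right_inj] at h'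
        exact h'
      · have e1 : ∀ y, SoergelPath.ht (L β) (c + corootPairing (L β) τ) y =
            SoergelPath.ht β c (affineReflection α b y) := by
          intro y
          rw [← hL.ht β c]
          congr 1
          exact (affineReflection_involutive α b y).symm
        have e2 := e1 v
        have e3 := e1 (affineReflection α b v)
        rw [affineReflection_involutive] at e3
        rw [ht_affineReflection] at e3 e2 hsep
        rw [e2] at e3 ⊢
        have e4 : SoergelPath.ht α b v * corootPairing (L β) α =
            -(SoergelPath.ht α b v * corootPairing β α) := by linarith
        rw [e4]
        generalize SoergelPath.ht α b v * corootPairing β α = X at *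
        generalize SoergelPath.ht β c v = B at *
        push Not at h0
        have h1 : (B * (B - X)) * (B * (B - X / 2)) < 0 := mul_neg_of_neg_of_pos hsep h0
        by_contra hcon
        push Not at hcon
        nlinarith [mul_nonneg (sq_nonneg B) hcon.le]
  obtain ⟨h1, h2⟩ := dist_lt_of_separates hΦ hα hβ (hv α hα b hb) (hv β hβ c hc) hne hsep
  set t' : G.W := ⟨refl β c, refl_mem_W hβ hc⟩ with ht'
  have m1 : t' ∈ Subgroup.closure (walls (G := G) v) := step hβ hc h1
  obtain ⟨L, τ, hL⟩ := exists_preserves hΦ t'.2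
  have hLα := (hL.2.1 α).mp hα
  have hcL := add_mem_levels hb (hL.2.2 _ hLα)
  have m2 : (⟨refl (L α) (b + corootPairing (L α) τ), refl_mem_W hLα hcL⟩ : G.W) ∈
      Subgroup.closure (walls (G := G) v) := by
    refine step hLα hcL ?_
    have e1 : SoergelPath.ht (L α) (b + corootPairing (L α) τ) v =
        SoergelPath.ht α b (affineReflection β c v) := by
      rw [← hL.ht α b]
      congr 1
      exact (affineReflection_involutive β c v).symm
    rw [e1, ht_affineReflection, L.norm_map]
    exact mul_lt_mul_of_pos_right h2 (norm_pos_iff.mpr (hΦ.ne_zero α hα))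
  have e : s = t'⁻¹ * ⟨refl (L α) (b + corootPairing (L α) τ), refl_mem_W hLα hcL⟩ * t' := by
    apply Subtype.ext
    have := hL.conj α b
    change refl α b = t'.1⁻¹ * refl (L α) (b + corootPairing (L α) τ) * t'.1
    rw [← this]
    group
  rw [e]
  exact Subgroup.mul_mem _ (Subgroup.mul_mem _ (Subgroup.inv_mem _ m1) m2) m1

lemma isInversionCocycle {v : E r} (hv : G.Reg v) :
    IsInversionCocycle (inversions (G := G) v) (walls v) where
  mem_mul := mem_inversions_mul hΦ hv
  mul_self := by
    rintro s ⟨⟨α, hα, b, hb, hs⟩, -⟩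
    exact Subtype.ext (by rw [Subgroup.coe_mul, hs, refl_mul_self]; rfl)
  simple := fun s hs => hs.2
  closure := by
    rw [eq_top_iff]
    have key : ∀ g (hg : g ∈ G.W), (⟨g, hg⟩ : G.W) ∈ Subgroup.closure (walls (G := G) v) := by
      intro g hg
      have hg' := hg
      unfold W at hg'
      induction hg' using Subgroup.closure_induction with
      | mem g h =>
        obtain ⟨α, hα, b, hb, h⟩ := h
        obtain rfl : g = refl α b := Equiv.ext h
        exact mem_closure_walls hΦ hv hα hb
      | one => exact Subgroup.one_mem _
      | mul x y hx hy h1 h2 => exact Subgroup.mul_mem _ (h1 hx) (h2 hy)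
      | inv x hx h1 => exact Subgroup.inv_mem _ (h1 hx)
    exact fun g _ => key g.1 g.2

/-- No hyperplane separates `v` from its image under `z⁻¹ * z'`, so this element has no inversions.
-/
lemma eq_of_near {v : E r} (hv : G.Reg v) {z z' : G.W} (h : G.Near (z.1 v) (z'.1 v)) :
    z = z' := by
  have : z⁻¹ * z' = 1 := by
    refine (isInversionCocycle hΦ hv).eq_one_of_forall_notMem (w := z⁻¹ * z') fun t ht => ?_
    obtain ⟨⟨α, hα, b, hb, htt⟩, hsep⟩ := ht
    have h1 := near_apply hΦ (z⁻¹).2 h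
    rw [htt, sepBy_refl (hΦ.ne_zero α hα)] at hsep
    have h2 := h1 α hα b hb
    simp only [Subgroup.coe_mul, Equiv.Perm.mul_apply, Subgroup.coe_inv] at hsep h2
    have e : z.1⁻¹ (z.1 v) = v := by simp
    rw [e] at h2
    nlinarith
  rwa [inv_mul_eq_one] at this

/-- Reflections in the hyperplanes through a point in the closure of an alcove are wall
reflections of this alcove, when these hyperplanes are pairwise orthogonal. -/
lemma conj_mem_walls {v : E r} (hv : G.Reg v) {z : G.W} {y : E r} (hy : G.Near (z.1 v) y)
    {α : E r} (hα : α ∈ G.Φ) {b : ℝ} (hb : b ∈ levels G.e) (h0 : ht α b y = 0)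
    (horth : ∀ β ∈ G.Φ, ∀ c ∈ levels G.e, ht β c y = 0 →
      refl β c = refl α b ∨ corootPairing β α = 0) :
    z⁻¹ * ⟨refl α b, refl_mem_W hα hb⟩ * z ∈ walls (G := G) v := by
  set s : G.W := ⟨refl α b, refl_mem_W hα hb⟩ with hs
  have hr : G.IsRefl ((z⁻¹ * s * z : G.W) : Equiv.Perm (E r)) := by
    have := isRefl_conj hΦ (z⁻¹).2 (⟨α, hα, b, hb, rfl⟩ : G.IsRefl s)
    simpa using this
  refine ⟨hr, Set.eq_singleton_iff_unique_mem.mpr ⟨mem_inversions_self hΦ hv hr, ?_⟩⟩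
  rintro t ⟨ht, hsep⟩
  have ht' := isRefl_conj hΦ z.2 ht
  obtain ⟨β, hβ, c, hc, htt⟩ := ht'
  have e1 : t.1 = z.1⁻¹ * refl β c * z.1 := by rw [← htt]; group
  rw [e1, sepBy_conj hΦ z.2, sepBy_refl (hΦ.ne_zero β hβ)] at hsep
  have e2 : z.1 ((z⁻¹ * s * z : G.W).1 v) = affineReflection α b (z.1 v) := by
    simp [Equiv.Perm.mul_apply, hs]
  rw [e2] at hsep
  have fin : refl β c = refl α b → t = z⁻¹ * s * z := by
    intro h
    apply Subtype.ext
    rw [e1, h]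
    rfl
  -- A hyperplane through `y` is the given one or orthogonal to it, and reflection preserves the
  -- sides of an orthogonal one. A hyperplane missing `y` has `z v` and its mirror image both on the
  -- side of `y`, hence separates nothing.
  by_cases hcy : SoergelPath.ht β c y = 0
  · rcases horth β hβ c hc hcy with h | h
    · exact fin h
    · rw [ht_affineReflection, h, mul_zero, sub_zero] at hsep
      nlinarith [mul_self_nonneg (SoergelPath.ht β c (z.1 v))]
  · exfalso
    have h1 := hy β hβ c hc
    have h2 := near_apply hΦ (refl_mem_W hα hb) hy β hβ c hc
    rw [refl_apply, refl_apply, affineReflection_of_ht_eq_zero h0] at h2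
    have h3 : 0 < SoergelPath.ht β c y ^ 2 := by positivity
    nlinarith [mul_nonneg h1 h2]

/-! ### Alcoves, regular points and signs of heights. -/

omit hΦ in
lemma height_eq (α : E r) (b : ℝ) (x : E r) : G.height α b x = ht α b (x + G.ρ) := rfl

lemma forall_roots_of_forall_positive (hP : IsPositiveSystem G.Φ G.P) {p : E r → ℝ → Prop}
    (hneg : ∀ α b, p α b → p (-α) (-b)) (h : ∀ α ∈ G.P, ∀ b ∈ levels G.e, p α b) :
    ∀ α ∈ G.Φ, ∀ b ∈ levels G.e, p α b := by
  intro α hα b hb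
  obtain ⟨f, hf, hP⟩ := hP
  rcases lt_or_gt_of_ne (hf α hα) with h1 | h1
  · have h2 := h (-α) ((hP _).mpr ⟨neg_mem hΦ hα, by rw [map_neg]; linarith⟩) (-b)
      (neg_mem_levels hb)
    simpa using hneg _ _ h2
  · exact h α ((hP _).mpr ⟨hα, h1⟩) b hb

lemma pos_of_mem_alcove (hP : IsPositiveSystem G.Φ G.P) {a : Set (E r)} (ha : G.IsAlcove a)
    {x y : E r} (hx : x ∈ a) (hy : y ∈ a) :
    ∀ α ∈ G.Φ, ∀ b ∈ levels G.e, 0 < ht α b (x + G.ρ) * ht α b (y + G.ρ) := by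
  refine forall_roots_of_forall_positive hΦ hP (fun α b h => by rw [ht_neg, ht_neg]; linarith) ?_
  obtain ⟨-, m, rfl⟩ := ha
  intro α hα b hb
  obtain ⟨n, hn⟩ := hb
  obtain ⟨x1, x2⟩ := hx α hα
  obtain ⟨y1, y2⟩ := hy α hα
  rcases le_or_gt n (m α - 1) with h | h
  · have h1 := level_monotone G.e h
    rw [← hn] at h1
    have h2 := EReal.coe_lt_coe_iff.mp (lt_of_le_of_lt h1 x1)
    have h3 := EReal.coe_lt_coe_iff.mp (lt_of_le_of_lt h1 y1)
    exact mul_pos (sub_pos.mpr h2) (sub_pos.mpr h3)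
  · have h1 := level_monotone G.e (show m α ≤ n by omega)
    rw [← hn] at h1
    have h2 := EReal.coe_lt_coe_iff.mp (lt_of_lt_of_le x2 h1)
    have h3 := EReal.coe_lt_coe_iff.mp (lt_of_lt_of_le y2 h1)
    exact mul_pos_of_neg_of_neg (sub_neg.mpr h2) (sub_neg.mpr h3)

lemma reg_of_isRegular (hP : IsPositiveSystem G.Φ G.P) {x : E r} (hx : G.IsRegular x) :
    G.Reg (x + G.ρ) := by
  obtain ⟨a, ha, hx⟩ := hx
  intro α hα b hb h
  have := pos_of_mem_alcove hΦ hP ha hx hx α hα b hb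
  rw [h] at this
  simp at this

omit hΦ in
lemma isRegular_of_reg (he : G.e ≠ 0) (hP : G.P ⊆ G.Φ) {x : E r} (hx : G.Reg (x + G.ρ)) :
    G.IsRegular x := by
  have key : ∀ α ∈ G.P, ∃ m : ℤ, level G.e (m - 1) < (corootPairing α (x + G.ρ) : EReal) ∧
      (corootPairing α (x + G.ρ) : EReal) < level G.e m := by
    intro α hα
    set p := corootPairing α (x + G.ρ) with hp
    have hne : ∀ b ∈ levels G.e, p ≠ b := fun b hb h => hx α (hP hα) b hb (sub_eq_zero.mpr h)
    -- For `e = ∞` the finite end of each interval is `0`, so the index is `0` on the negative side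
    -- and `1` on the positive side; for finite `e` it comes from a floor.
    by_cases htop : G.e = ⊤
    · rcases lt_or_gt_of_ne (hne 0 (zero_mem_levels _)) with h | h
      · refine ⟨0, ?_, ?_⟩
        · simp [level, htop]
        · simpa [level, htop] using h
      · refine ⟨1, ?_, ?_⟩
        · simpa [level, htop] using h
        · simp [level, htop]
    · have hpos : (0 : ℝ) < G.e.toNat := by
        have : G.e.toNat ≠ 0 := by simp [ENat.toNat_eq_zero, he, htop]
        exact_mod_cast Nat.pos_of_ne_zero this
      refine ⟨⌊p / G.e.toNat⌋ + 1, ?_, ?_⟩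
      · simp only [level, if_neg htop, EReal.coe_lt_coe_iff, add_sub_cancel_right]
        refine lt_of_le_of_ne ?_ (hne _ (mem_levels.mpr ⟨_, rfl⟩)).symm
        rw [← le_div_iff₀ hpos]
        exact Int.floor_le _
      · simp only [level, if_neg htop, EReal.coe_lt_coe_iff]
        rw [← div_lt_iff₀ hpos]
        push_cast
        exact Int.lt_floor_add_one _
  choose! m hm using key
  exact ⟨{x | ∀ α ∈ G.P, level G.e (m α - 1) < (corootPairing α (x + G.ρ) : EReal) ∧
    (corootPairing α (x + G.ρ) : EReal) < level G.e (m α)}, ⟨⟨x, hm⟩, m, rfl⟩, hm⟩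

end Geometry
end SoergelPath
end

noncomputable section
open scoped LaurentPolynomial InnerProductSpace
namespace SoergelPath
namespace Geometry

variable {r : ℕ} {G : Geometry r}

/-! ### Folding a path into the fundamental alcove -/

variable (G) in
/-- Reflection of a path (in shifted coordinates, indexed by `ℕ`) at one of its points. -/
def ReflStep (p q : ℕ → E r) : Prop :=
  ∃ α ∈ G.Φ, ∃ b ∈ levels G.e, ∃ k, ht α b (p k) = 0 ∧ (∀ i ≤ k, q i = p i) ∧
    ∀ i, k ≤ i → q i = affineReflection α b (p i)

variable (G) in
/-- The hyperplanes through `y` are pairwise orthogonal. -/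
def Orth (y : E r) : Prop :=
  ∀ α ∈ G.Φ, ∀ β ∈ G.Φ, ∀ b ∈ levels G.e, ∀ c ∈ levels G.e, ht α b y = 0 → ht β c y = 0 →
    (β = α ∨ β = -α) ∨ corootPairing β α = 0

variable (G) in
/-- The properties of an admissible path of length `n` starting at `v` that are stable under
reflections. -/
structure Good (n : ℕ) (v : E r) (p : ℕ → E r) : Prop where
  start : p 0 = v
  const : ∀ k, n ≤ k → p k = p n
  reg : G.Reg (p n)
  orth : ∀ k, G.Orth (p k)
  near : ∀ k, G.Near (p k) (p (k + 1))

lemma ReflStep.symm {p q : ℕ → E r} (h : G.ReflStep p q) : G.ReflStep q p := by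
  obtain ⟨α, hα, b, hb, k, h0, h1, h2⟩ := h
  refine ⟨α, hα, b, hb, k, by rw [h1 k le_rfl, h0], fun i hi => (h1 i hi).symm, fun i hi => ?_⟩
  rw [h2 i hi, affineReflection_involutive]

lemma refl_eq_of_ht_eq_zero {α β y : E r} {b c : ℝ} (hb : ht α b y = 0) (hc : ht β c y = 0)
    (h : β = α ∨ β = -α) : refl β c = refl α b := by
  rcases h with rfl | rfl
  · rw [show c = b by rw [ht] at hb hc; linarith]
  · rw [← refl_neg α b, show c = -b by
      rw [ht, corootPairing_neg_left] at hc; rw [ht] at hb; linarith]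

variable (hΦ : IsIrredRootSystem G.Φ)
include hΦ

lemma orth_apply {g : Equiv.Perm (E r)} (hg : g ∈ G.W) {y : E r} (hy : G.Orth y) :
    G.Orth (g y) := by
  obtain ⟨L, τ, h⟩ := exists_preserves hΦ hg
  intro α hα β hβ b hb c hc h1 h2
  rw [h.ht'] at h1 h2
  rcases hy _ (h.mem_symm hα) _ (h.mem_symm hβ) _ (sub_mem_levels hb (h.2.2 _ hα)) _
    (sub_mem_levels hc (h.2.2 _ hβ)) h1 h2 with (h3 | h3) | h3
  · exact Or.inl (Or.inl (L.symm.injective h3))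
  · exact Or.inl (Or.inr (L.symm.injective (by rw [h3, map_neg])))
  · right
    rwa [corootPairing_isometry] at h3

lemma Good.reflStep {n : ℕ} {v : E r} {p q : ℕ → E r} (hp : G.Good n v p) (h : G.ReflStep p q) :
    G.Good n v q := by
  obtain ⟨α, hα, b, hb, k, h0, h1, h2⟩ := h
  have hs := refl_mem_W hα hb
  refine ⟨by rw [h1 0 (Nat.zero_le k), hp.start], fun i hi => ?_, ?_, fun i => ?_, fun i => ?_⟩
  · rcases le_total k n with hk | hk
    · rw [h2 i (hk.trans hi), h2 n hk, hp.const i hi]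
    · rw [h1 n hk]
      rcases le_total i k with hik | hik
      · rw [h1 i hik, hp.const i hi]
      · rw [h2 i hik, hp.const i hi, ← hp.const k hk, affineReflection_of_ht_eq_zero h0]
  · rcases le_total n k with hk | hk
    · rw [h1 n hk]; exact hp.reg
    · rw [h2 n hk]; exact reg_apply hΦ hs hp.reg
  · rcases le_total i k with hk | hk
    · rw [h1 i hk]; exact hp.orth i
    · rw [h2 i hk]; exact orth_apply hΦ hs (hp.orth i)
  · rcases le_or_gt k i with hk | hk
    · rw [h2 i hk, h2 (i + 1) (by omega)]; exact near_apply hΦ hs (hp.near i)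
    · rw [h1 i hk.le, h1 (i + 1) hk]; exact hp.near i

omit hΦ in
lemma near_self (v : E r) : G.Near v v := fun _ _ _ _ => mul_self_nonneg _

omit hΦ in
open Classical in
/-- The positive roots of the hyperplanes through `y` that separate `v` from `y'`. -/
def badRoots (v y y' : E r) : Finset (E r) :=
  G.P.filter fun α => corootPairing α y ∈ levels G.e ∧
    ht α (corootPairing α y) y' * ht α (corootPairing α y) v < 0

/-- Reflecting at the point `p m` in a hyperplane that separates `v` from `p (m + 1)` removes it
from the bad set and adds none, so finitely many reflections suffice. Hyperplanes missing `p m` are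
harmless: `v` and `p (m + 1)` both lie weakly on the side of `p m`. -/
lemma Good.exists_near_succ (hP : IsPositiveSystem G.Φ G.P) {n : ℕ} {v : E r}
    (m : ℕ) {p : ℕ → E r} (hp : G.Good n v p) (hm : ∀ k ≤ m, G.Near v (p k)) :
    ∃ q, Relation.ReflTransGen G.ReflStep p q ∧ G.Good n v q ∧ ∀ k ≤ m + 1, G.Near v (q k) := by
  classical
  have hPΦ : ∀ α ∈ G.P, α ∈ G.Φ := by
    obtain ⟨f, -, hf⟩ := hP
    exact fun α hα => ((hf α).mp hα).1
  induction hN : (badRoots (G := G) v (p m) (p (m + 1))).card using Nat.strong_induction_on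
    generalizing p with
  | _ N ih =>
  rcases Finset.eq_empty_or_nonempty (badRoots (G := G) v (p m) (p (m + 1))) with he | ⟨α, hα⟩
  · refine ⟨p, .refl, hp, fun k hk => ?_⟩
    rcases Nat.le_succ_iff.mp hk with hk | rfl
    · exact hm k hk
    refine forall_roots_of_forall_positive hΦ hP
      (fun α b h => by rw [ht_neg, ht_neg]; linarith) fun β hβ c hc => ?_
    by_contra hneg
    push Not at hneg
    by_cases h0 : ht β c (p m) = 0
    · have : β ∈ badRoots (G := G) v (p m) (p (m + 1)) := by
        have e : corootPairing β (p m) = c := by rw [ht] at h0; linarith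
        exact Finset.mem_filter.mpr ⟨hβ, by rw [e]; exact hc, by rw [e]; exact hneg⟩
      rw [he] at this
      simp at this
    · have h1 := hm m le_rfl β (hPΦ β hβ) c hc
      have h2 := hp.near m β (hPΦ β hβ) c hc
      have h3 : 0 < ht β c (p m) ^ 2 := by positivity
      nlinarith [mul_nonneg h1 h2]
  · obtain ⟨hαP, hb, hneg⟩ := Finset.mem_filter.mp hα
    have hαΦ := hPΦ α hαP
    set b := corootPairing α (p m) with hbdef
    have h0 : ht α b (p m) = 0 := sub_self _
    let q : ℕ → E r := fun i => if i ≤ m then p i else affineReflection α b (p i)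
    have hstep : G.ReflStep p q := by
      refine ⟨α, hαΦ, b, hb, m, h0, fun i hi => if_pos hi, fun i hi => ?_⟩
      rcases hi.eq_or_lt with rfl | hi
      · simp only [q, le_rfl, if_true]
        rw [affineReflection_of_ht_eq_zero h0]
      · exact if_neg (by omega)
    have hqm : q m = p m := if_pos le_rfl
    have hqm1 : q (m + 1) = affineReflection α b (p (m + 1)) := if_neg (by omega)
    have hα' : α ∉ badRoots (G := G) v (q m) (q (m + 1)) := by
      intro h
      obtain ⟨-, -, h⟩ := Finset.mem_filter.mp h
      rw [hqm, hqm1, ← hbdef, ht_affineReflection, corootPairing_self (hΦ.ne_zero α hαΦ)] at h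
      linarith
    have hsub : badRoots (G := G) v (q m) (q (m + 1)) ⊂
        badRoots (G := G) v (p m) (p (m + 1)) := by
      refine (Finset.ssubset_iff_of_subset ?_).mpr ⟨α, hα, hα'⟩
      intro β hβ
      obtain ⟨hβP, hc, h⟩ := Finset.mem_filter.mp hβ
      refine Finset.mem_filter.mpr ⟨hβP, by rwa [hqm] at hc, ?_⟩
      rw [hqm] at hc h
      have hβ0 : ht β (corootPairing β (p m)) (p m) = 0 := sub_self _
      -- Equal hyperplanes would keep `α` bad; for an orthogonal one the reflection does not change
      -- the height of `p (m + 1)`.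
      rcases hp.orth m α hαΦ β (hPΦ β hβP) b hb _ hc h0 hβ0 with h1 | h1
      · exfalso
        have e := refl_eq_of_ht_eq_zero h0 hβ0 h1
        have h2 := (sepBy_refl (hΦ.ne_zero β (hPΦ β hβP)) _ _ _).mpr h
        rw [e, sepBy_refl (hΦ.ne_zero α hαΦ)] at h2
        exact hα' (Finset.mem_filter.mpr ⟨hαP, by rw [hqm]; exact hb, by rw [hqm]; exact h2⟩)
      · rwa [hqm1, ht_affineReflection, h1, mul_zero, sub_zero] at h
    obtain ⟨q', h1, h2, h3⟩ := ih _ (hN ▸ Finset.card_lt_card hsub) (hp.reflStep hΦ hstep)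
      (fun k hk => by simp only [q, if_pos hk]; exact hm k hk) rfl
    exact ⟨q', .head hstep h1, h2, h3⟩

lemma Good.exists_folded (hP : IsPositiveSystem G.Φ G.P) {n : ℕ} {v : E r}
    {p : ℕ → E r} (hp : G.Good n v p) :
    ∃ q, Relation.ReflTransGen G.ReflStep p q ∧ G.Good n v q ∧ ∀ k, G.Near v (q k) := by
  have key : ∀ m, ∃ q, Relation.ReflTransGen G.ReflStep p q ∧ G.Good n v q ∧
      ∀ k ≤ m, G.Near v (q k) := by
    intro m
    induction m with
    | zero =>
      refine ⟨p, .refl, hp, fun k hk => ?_⟩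
      rw [Nat.le_zero.mp hk, hp.start]
      exact near_self v
    | succ m ih =>
      obtain ⟨q, h1, h2, h3⟩ := ih
      obtain ⟨q', h1', h2', h3'⟩ := h2.exists_near_succ hΦ hP m h3
      exact ⟨q', h1.trans h1', h2', h3'⟩
  obtain ⟨q, h1, h2, h3⟩ := key n
  refine ⟨q, h1, h2, fun k => ?_⟩
  rcases le_total k n with hk | hk
  · exact h3 k hk
  · rw [h2.const k hk]; exact h3 n le_rfl

end Geometry
end SoergelPath
end

noncomputable section
open scoped LaurentPolynomial InnerProductSpace
namespace SoergelPath

/-! ### Products of commuting families and families of choices -/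

section Choices

variable {ι Γ : Type*}

/-- The product of `f` over a finite set, in some order. -/
def prodOver [Monoid Γ] (f : ι → Γ) (I : Finset ι) : Γ := (I.toList.map f).prod

lemma prodOver_empty [Monoid Γ] (f : ι → Γ) : prodOver f ∅ = 1 := by simp [prodOver]

lemma prodOver_insert [Monoid Γ] [DecidableEq ι] {f : ι → Γ} {a : ι} {I : Finset ι} (ha : a ∉ I)
    (hc : ∀ x ∈ insert a I, ∀ y ∈ insert a I, Commute (f x) (f y)) :
    prodOver f (insert a I) = f a * prodOver f I := by
  have h1 := (Finset.toList_insert ha).map f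
  rw [prodOver, h1.prod_eq', List.map_cons, List.prod_cons, prodOver]
  rw [List.pairwise_map]
  refine List.Pairwise.imp_of_mem (R := fun _ _ => True) ?_ (List.pairwise_of_forall fun _ _ => trivial)
  intro x y hx hy _
  exact hc x (Finset.mem_toList.mp hx) y (Finset.mem_toList.mp hy)

lemma prodOver_commute [Monoid Γ] {f : ι → Γ} {g : Γ} {I : Finset ι}
    (hc : ∀ x ∈ I, Commute g (f x)) : Commute g (prodOver f I) := by
  refine Commute.list_prod_right _ _ fun y hy => ?_
  obtain ⟨x, hx, rfl⟩ := List.mem_map.mp hy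
  exact hc x (Finset.mem_toList.mp hx)

open Classical in
/-- The families of subsets `c k ⊆ D k` for `k < m`, extended by `∅`. -/
def choices (D : ℕ → Finset ι) : ℕ → Finset (ℕ → Finset ι)
  | 0 => {fun _ => ∅}
  | m + 1 => (choices D m ×ˢ (D m).powerset).image fun x => Function.update x.1 m x.2

lemma mem_choices {D : ℕ → Finset ι} {m : ℕ} {c : ℕ → Finset ι} :
    c ∈ choices D m ↔ (∀ k < m, c k ⊆ D k) ∧ ∀ k, m ≤ k → c k = ∅ := by
  classical
  induction m generalizing c with
  | zero =>
    simp only [choices, Finset.mem_singleton, Nat.not_lt_zero, false_imp_iff, implies_true,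
      true_and, Nat.zero_le, true_imp_iff]
    exact funext_iff
  | succ m ih =>
    simp only [choices, Finset.mem_image, Finset.mem_product, Finset.mem_powerset, ih, Prod.exists]
    constructor
    · rintro ⟨c, I, ⟨⟨h1, h2⟩, hI⟩, rfl⟩
      refine ⟨fun k hk => ?_, fun k hk => ?_⟩
      · rcases Nat.lt_succ_iff_lt_or_eq.mp hk with hk | rfl
        · rw [Function.update_of_ne hk.ne]; exact h1 k hk
        · rw [Function.update_self]; exact hI
      · rw [Function.update_of_ne (by omega)]; exact h2 k (by omega)
    · rintro ⟨h1, h2⟩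
      refine ⟨Function.update c m ∅, c m, ⟨⟨fun k hk => ?_, fun k hk => ?_⟩, h1 m (by omega)⟩, ?_⟩
      · rw [Function.update_of_ne hk.ne]; exact h1 k (by omega)
      · rcases hk.eq_or_lt with rfl | hk
        · rw [Function.update_self]
        · rw [Function.update_of_ne hk.ne']; exact h2 k hk
      · simp

-- A member of `choices D m` is empty at `m`, so it can be recovered from its update there: the
-- image defining the next stage is taken along an injective map.
open Classical in
lemma sum_choices_succ {M : Type*} [AddCommMonoid M] (D : ℕ → Finset ι) (m : ℕ)
    (f : (ℕ → Finset ι) → M) : ∑ c ∈ choices D (m + 1), f c =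
      ∑ c ∈ choices D m, ∑ I ∈ (D m).powerset, f (Function.update c m I) := by
  rw [choices, Finset.sum_image, Finset.sum_product]
  rintro ⟨c, I⟩ hc ⟨c', I'⟩ hc' h
  simp only [Finset.coe_product, Set.mem_prod, Finset.mem_coe] at hc hc'
  have h1 := (mem_choices.mp hc.1).2 m le_rfl
  have h2 := (mem_choices.mp hc'.1).2 m le_rfl
  have h3 := congrFun h m
  simp only [Function.update_self] at h3
  refine Prod.ext (funext fun k => ?_) h3
  by_cases hk : k = m
  · subst hk; exact h1.trans h2.symm
  · have := congrFun h k
    simpa [Function.update_of_ne hk] using this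

end Choices

namespace Geometry

variable {r : ℕ} {G : Geometry r}

/-! ### The degree of a step -/

open Classical in
variable (G) in
/-- The degree contribution of a step from `y` to `y'`, relative to the base point `v`. -/
def stepDeg (v α y y' : E r) : ℤ :=
  (if ∃ b ∈ levels G.e, ht α b y = 0 ∧ 0 < ht α b y' * ht α b v then 1 else 0) +
  (if ∃ b ∈ levels G.e, ht α b y * ht α b v < 0 ∧ ht α b y' = 0 then -1 else 0)

lemma stepDegree_eq (α x x' : E r) :
    G.stepDegree α x x' = G.stepDeg (0 + G.ρ) α (x + G.ρ) (x' + G.ρ) := rfl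

lemma stepDeg_neg (v α y y' : E r) : G.stepDeg v (-α) y y' = G.stepDeg v α y y' := by
  have key : ∀ α : E r, ∀ p : ℝ → ℝ → ℝ → Prop, (∀ a b c, p a b c → p (-a) (-b) (-c)) →
      (∃ b ∈ levels G.e, p (ht α b v) (ht α b y) (ht α b y')) →
      ∃ b ∈ levels G.e, p (ht (-α) b v) (ht (-α) b y) (ht (-α) b y') := by
    rintro α p hp ⟨b, hb, h⟩
    refine ⟨-b, neg_mem_levels hb, ?_⟩
    rw [ht_neg, ht_neg, ht_neg]
    exact hp _ _ _ h
  have key' : ∀ p : ℝ → ℝ → ℝ → Prop, (∀ a b c, p a b c → p (-a) (-b) (-c)) →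
      ((∃ b ∈ levels G.e, p (ht (-α) b v) (ht (-α) b y) (ht (-α) b y')) ↔
      ∃ b ∈ levels G.e, p (ht α b v) (ht α b y) (ht α b y')) := fun p hp =>
    ⟨fun h => by simpa using key (-α) p hp h, key α p hp⟩
  have e1 := key' (fun a b c => b = 0 ∧ 0 < c * a) (fun a b c h => ⟨by simp [h.1], by
    nlinarith [h.2]⟩)
  have e2 := key' (fun a b c => b * a < 0 ∧ c = 0) (fun a b c h => ⟨by nlinarith [h.1], by
    simp [h.2]⟩)
  classical
  exact congrArg₂ (· + ·) (if_congr e1 rfl rfl) (if_congr e2 rfl rfl)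

lemma Preserves.stepDeg {g : Equiv.Perm (E r)} {L : E r ≃ₗᵢ[ℝ] E r} {τ : E r}
    (h : G.Preserves g L τ) (v y y' : E r) {α : E r} (hα : α ∈ G.Φ) :
    G.stepDeg (g v) (L α) (g y) (g y') = G.stepDeg v α y y' := by
  have key : ∀ p : ℝ → ℝ → ℝ → Prop,
      ((∃ b ∈ levels G.e, p (SoergelPath.ht (L α) b (g v)) (SoergelPath.ht (L α) b (g y))
        (SoergelPath.ht (L α) b (g y'))) ↔
      ∃ b ∈ levels G.e, p (SoergelPath.ht α b v) (SoergelPath.ht α b y)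
        (SoergelPath.ht α b y')) := by
    intro p
    have hτ := h.2.2 _ ((h.2.1 α).mp hα)
    constructor
    · rintro ⟨b, hb, hp⟩
      rw [h.ht', h.ht', h.ht', L.symm_apply_apply] at hp
      exact ⟨_, sub_mem_levels hb hτ, hp⟩
    · rintro ⟨b, hb, hp⟩
      refine ⟨_, add_mem_levels hb hτ, ?_⟩
      rwa [h.ht, h.ht, h.ht]
  have e1 := key (fun a b c => b = 0 ∧ 0 < c * a)
  have e2 := key (fun a b c => b * a < 0 ∧ c = 0)
  classical
  exact congrArg₂ (· + ·) (if_congr e1 rfl rfl) (if_congr e2 rfl rfl)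

variable (hΦ : IsIrredRootSystem G.Φ)
include hΦ

lemma sum_roots (hP : IsPositiveSystem G.Φ G.P) {f : E r → ℤ} (hf : ∀ α, f (-α) = f α) :
    ∑ α ∈ G.Φ, f α = 2 * ∑ α ∈ G.P, f α := by
  classical
  obtain ⟨φ, h1, h2⟩ := hP
  have hsub : G.P ⊆ G.Φ := fun α hα => ((h2 α).mp hα).1
  rw [← Finset.sum_sdiff hsub, two_mul]
  congr 1
  refine Finset.sum_nbij' (fun α => -α) (fun α => -α) ?_ ?_ (by simp) (by simp) (by simp [hf])
  · intro α hα
    obtain ⟨h3, h4⟩ := Finset.mem_sdiff.mp hα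
    rw [h2] at h4 ⊢
    refine ⟨neg_mem hΦ h3, ?_⟩
    rw [map_neg]
    rcases lt_or_gt_of_ne (h1 α h3) with h | h
    · linarith
    · exact absurd ⟨h3, h⟩ h4
  · intro α hα
    rw [h2] at hα
    refine Finset.mem_sdiff.mpr ⟨neg_mem hΦ hα.1, fun h => ?_⟩
    rw [h2, map_neg] at h
    linarith [h.2, hα.2]

/-- The element `g` need not permute the positive roots, but it permutes all roots, and the step
degree does not see the sign of a root. Both sides are half of a sum over `G.Φ`. -/
lemma sum_stepDeg (hP : IsPositiveSystem G.Φ G.P) {g : Equiv.Perm (E r)} (hg : g ∈ G.W)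
    (v y y' : E r) :
    ∑ α ∈ G.P, G.stepDeg (g v) α (g y) (g y') = ∑ α ∈ G.P, G.stepDeg v α y y' := by
  obtain ⟨L, τ, h⟩ := exists_preserves hΦ hg
  have e1 := sum_roots hΦ hP (f := fun α => G.stepDeg (g v) α (g y) (g y')) fun α => stepDeg_neg _ α _ _
  have e2 := sum_roots hΦ hP (f := fun α => G.stepDeg v α y y') fun α => stepDeg_neg _ α _ _
  have e3 : ∑ α ∈ G.Φ, G.stepDeg (g v) α (g y) (g y') = ∑ α ∈ G.Φ, G.stepDeg v α y y' := by
    symm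
    refine Finset.sum_nbij' (fun α => L α) (fun α => L.symm α) (fun α hα => (h.2.1 α).mp hα)
      (fun α hα => h.mem_symm hα) (by simp) (by simp) fun α hα => (h.stepDeg v y y' hα).symm
  linarith

end Geometry
end SoergelPath
end

noncomputable section
open scoped LaurentPolynomial InnerProductSpace
namespace SoergelPath
namespace Geometry

variable {r : ℕ} {G : Geometry r}

/-! ### Foldings of a path in the fundamental alcove -/

open Classical in
variable (G) in
/-- The positive roots of the hyperplanes through `y k`. -/
def onRoots (y : ℕ → E r) (k : ℕ) : Finset (E r) :=
  G.P.filter fun α => corootPairing α (y k) ∈ levels G.e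

open Classical in
variable (G) in
/-- The positive roots of the hyperplanes through `y k` that do not contain `y (k + 1)`. -/
def leaving (y : ℕ → E r) (k : ℕ) : Finset (E r) :=
  (G.onRoots y k).filter fun α => corootPairing α (y (k + 1)) ≠ corootPairing α (y k)

open Classical in
variable (G) in
/-- The reflection in the hyperplane through `y k` with root `α`. -/
def wallRefl (y : ℕ → E r) (k : ℕ) (α : E r) : G.W :=
  if h : α ∈ G.Φ ∧ corootPairing α (y k) ∈ levels G.e then
    ⟨refl α (corootPairing α (y k)), refl_mem_W h.1 h.2⟩ else 1

variable (G) in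
/-- The group element by which the `k`-th point is moved when the path `y` is folded at the
hyperplanes given by `c`. -/
def foldElt (y : ℕ → E r) (c : ℕ → Finset (E r)) : ℕ → G.W
  | 0 => 1
  | k + 1 => foldElt y c k * prodOver (G.wallRefl y k) (c k)

variable (G) in
/-- The path obtained from `y` by folding at the hyperplanes given by `c`. -/
def foldPath (y : ℕ → E r) (c : ℕ → Finset (E r)) (k : ℕ) : E r := (G.foldElt y c k).1 (y k)

lemma foldElt_congr {y : ℕ → E r} {c c' : ℕ → Finset (E r)} {k : ℕ} (h : ∀ j < k, c j = c' j) :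
    G.foldElt y c k = G.foldElt y c' k := by
  induction k with
  | zero => rfl
  | succ k ih =>
    rw [foldElt, foldElt, ih fun j hj => h j (by omega), h k (by omega)]

lemma mem_onRoots {y : ℕ → E r} {k : ℕ} {α : E r} :
    α ∈ G.onRoots y k ↔ α ∈ G.P ∧ corootPairing α (y k) ∈ levels G.e := by
  classical
  exact Finset.mem_filter

lemma mem_leaving {y : ℕ → E r} {k : ℕ} {α : E r} :
    α ∈ G.leaving y k ↔ α ∈ G.onRoots y k ∧
      corootPairing α (y (k + 1)) ≠ corootPairing α (y k) := by
  classical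
  exact Finset.mem_filter

lemma leaving_subset (y : ℕ → E r) (k : ℕ) : G.leaving y k ⊆ G.onRoots y k :=
  Finset.filter_subset _ _

/-- A path in the closure of the alcove of `v` with orthogonality. -/
structure Folded (G : Geometry r) (n : ℕ) (v : E r) (y : ℕ → E r) : Prop where
  rootSystem : IsIrredRootSystem G.Φ
  positive : IsPositiveSystem G.Φ G.P
  good : G.Good n v y
  near_base : ∀ k, G.Near v (y k)
  reg_base : G.Reg v

namespace Folded

variable {n : ℕ} {v : E r} {y : ℕ → E r} (hy : G.Folded n v y)
include hy

lemma mem_roots {α : E r} (hα : α ∈ G.P) : α ∈ G.Φ := by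
  obtain ⟨f, -, hf⟩ := hy.positive
  exact ((hf α).mp hα).1

lemma ne_zero {α : E r} (hα : α ∈ G.P) : α ≠ 0 := hy.rootSystem.ne_zero α (hy.mem_roots hα)

lemma coe_wallRefl {k : ℕ} {α : E r} (hα : α ∈ G.onRoots y k) :
    (G.wallRefl y k α).1 = refl α (corootPairing α (y k)) := by
  obtain ⟨h1, h2⟩ := mem_onRoots.mp hα
  rw [wallRefl, dif_pos ⟨hy.mem_roots h1, h2⟩]

lemma pairing_eq_zero {k : ℕ} {α β : E r} (hα : α ∈ G.onRoots y k) (hβ : β ∈ G.onRoots y k)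
    (hne : α ≠ β) : corootPairing β α = 0 := by
  obtain ⟨h1, h2⟩ := mem_onRoots.mp hα
  obtain ⟨h3, h4⟩ := mem_onRoots.mp hβ
  rcases hy.good.orth k α (hy.mem_roots h1) β (hy.mem_roots h3) _ h2 _ h4 (sub_self _) (sub_self _)
    with (h | h) | h
  · exact absurd h.symm hne
  · obtain ⟨f, -, hf⟩ := hy.positive
    have h5 := ((hf α).mp h1).2
    have h6 := ((hf β).mp h3).2
    rw [h, map_neg] at h6
    linarith
  · exact h

lemma wallRefl_mem_walls {k : ℕ} {α : E r} (hα : α ∈ G.onRoots y k) :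
    G.wallRefl y k α ∈ walls (G := G) v := by
  obtain ⟨h1, h2⟩ := mem_onRoots.mp hα
  have h3 := hy.mem_roots h1
  have := conj_mem_walls hy.rootSystem hy.reg_base (z := 1) (y := y k) (hy.near_base k) h3 h2
    (sub_self _) fun β hβ c hc h0 => by
      rcases hy.good.orth k α h3 β hβ _ h2 c hc (sub_self _) h0 with h | h
      · exact Or.inl (refl_eq_of_ht_eq_zero (sub_self _) h0 h)
      · exact Or.inr h
  rw [inv_one, one_mul, mul_one] at this
  rwa [wallRefl, dif_pos ⟨h3, h2⟩]

lemma wallRefl_commute {k : ℕ} {α β : E r} (hα : α ∈ G.onRoots y k) (hβ : β ∈ G.onRoots y k) :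
    Commute (G.wallRefl y k α) (G.wallRefl y k β) := by
  by_cases h : α = β
  · rw [h]
  · apply Subtype.ext
    rw [Subgroup.coe_mul, Subgroup.coe_mul, hy.coe_wallRefl hα, hy.coe_wallRefl hβ]
    exact refl_commute (hy.pairing_eq_zero hα hβ h) (hy.pairing_eq_zero hβ hα (Ne.symm h)) _ _

lemma wallRefl_mul_self {k : ℕ} {α : E r} (hα : α ∈ G.onRoots y k) :
    G.wallRefl y k α * G.wallRefl y k α = 1 :=
  (isInversionCocycle hy.rootSystem hy.reg_base).mul_self _ (hy.wallRefl_mem_walls hα)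

lemma prodOver_wallRefl_insert [DecidableEq (E r)] {k : ℕ} {α : E r} {I : Finset (E r)}
    (hI : insert α I ⊆ G.onRoots y k) (hα : α ∉ I) :
    prodOver (G.wallRefl y k) (insert α I) = G.wallRefl y k α * prodOver (G.wallRefl y k) I :=
  prodOver_insert hα fun _ hx _ hx' => hy.wallRefl_commute (hI hx) (hI hx')

lemma prodOver_symmDiff [DecidableEq (E r)] {k : ℕ} {α : E r} {I : Finset (E r)}
    (hα : α ∈ G.onRoots y k) (hI : I ⊆ G.onRoots y k) :
    prodOver (G.wallRefl y k) (symmDiff I {α}) =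
      G.wallRefl y k α * prodOver (G.wallRefl y k) I := by
  by_cases h : α ∈ I
  · have e : symmDiff I {α} = I.erase α := by
      ext x; simp only [Finset.mem_symmDiff, Finset.mem_singleton, Finset.mem_erase]
      by_cases hx : x = α <;> simp [hx, h]
    have h1 := hy.prodOver_wallRefl_insert (k := k) (α := α) (I := I.erase α)
      (by rwa [Finset.insert_erase h]) (Finset.notMem_erase α I)
    rw [Finset.insert_erase h] at h1
    rw [e, h1, ← mul_assoc, hy.wallRefl_mul_self hα, one_mul]
  · have e : symmDiff I {α} = insert α I := by
      ext x; simp only [Finset.mem_symmDiff, Finset.mem_singleton, Finset.mem_insert]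
      by_cases hx : x = α <;> simp [hx, h]
    rw [e, hy.prodOver_wallRefl_insert (Finset.insert_subset hα hI) h]

-- By orthogonality only the factor with root `α` itself changes this height.
open Classical in
lemma ht_prodOver {k : ℕ} {α : E r} {I : Finset (E r)} (hα : α ∈ G.onRoots y k)
    (hI : I ⊆ G.onRoots y k) (x : E r) :
    ht α (corootPairing α (y k)) ((prodOver (G.wallRefl y k) I).1 x) =
      if α ∈ I then -ht α (corootPairing α (y k)) x else ht α (corootPairing α (y k)) x := by
  induction I using Finset.induction_on with
  | empty => simp [prodOver_empty]
  | insert β I hβ ih =>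
    have hβ' := hI (Finset.mem_insert_self _ _)
    rw [hy.prodOver_wallRefl_insert hI hβ, Subgroup.coe_mul, Equiv.Perm.mul_apply,
      hy.coe_wallRefl hβ', refl_apply, ht_affineReflection]
    have ih := ih fun x hx => hI (Finset.mem_insert_of_mem hx)
    by_cases h : α = β
    · subst h
      rw [ih, if_neg hβ, corootPairing_self (hy.ne_zero (mem_onRoots.mp hα).1),
        if_pos (Finset.mem_insert_self _ _)]
      ring
    · rw [hy.pairing_eq_zero hβ' hα (Ne.symm h), mul_zero, sub_zero, ih]
      simp [h]

lemma prodOver_apply_self {k : ℕ} {I : Finset (E r)} (hI : I ⊆ G.onRoots y k) :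
    (prodOver (G.wallRefl y k) I).1 (y k) = y k := by
  classical
  induction I using Finset.induction_on with
  | empty => simp [prodOver_empty]
  | insert β I hβ ih =>
    rw [hy.prodOver_wallRefl_insert hI hβ, Subgroup.coe_mul, Equiv.Perm.mul_apply,
      hy.coe_wallRefl (hI (Finset.mem_insert_self _ _)), refl_apply,
      ih fun x hx => hI (Finset.mem_insert_of_mem hx)]
    exact affineReflection_of_ht_eq_zero (sub_self _)

lemma leaving_eq_empty {k : ℕ} (hk : n ≤ k) : G.leaving y k = ∅ := by
  refine Finset.eq_empty_of_forall_notMem fun α h => (mem_leaving.mp h).2 ?_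
  rw [hy.good.const k hk, hy.good.const (k + 1) (by omega)]

lemma onRoots_eq_empty {k : ℕ} (hk : G.Reg (y k)) : G.onRoots y k = ∅ :=
  Finset.eq_empty_of_forall_notMem fun α h =>
    hk α (hy.mem_roots (mem_onRoots.mp h).1) _ (mem_onRoots.mp h).2 (sub_self _)

/-- The reflections used at `y k` fix `y k`. Hence both ends of the step from `k` to `k + 1` are
images of points of `y` under one group element. -/
lemma foldPath_eq {c : ℕ → Finset (E r)} {k : ℕ} (hc : c k ⊆ G.leaving y k) :
    G.foldPath y c k = (G.foldElt y c (k + 1)).1 (y k) := by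
  rw [foldPath, foldElt, Subgroup.coe_mul, Equiv.Perm.mul_apply,
    hy.prodOver_apply_self (hc.trans (leaving_subset y k))]

/-- Distinct families of choices give distinct paths. -/
lemma foldPath_injective {c c' : ℕ → Finset (E r)} (hc : ∀ k, c k ⊆ G.leaving y k)
    (hc' : ∀ k, c' k ⊆ G.leaving y k) (h : G.foldPath y c = G.foldPath y c') : c = c' := by
  classical
  funext k
  induction k using Nat.strong_induction_on with
  | _ k ih =>
  have e1 : G.foldElt y c k = G.foldElt y c' k := foldElt_congr ih
  have e2 := congrFun h (k + 1)
  rw [foldPath, foldPath, foldElt, foldElt, e1, Subgroup.coe_mul, Equiv.Perm.mul_apply,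
    Subgroup.coe_mul, Equiv.Perm.mul_apply] at e2
  have e3 := (G.foldElt y c' k).1.injective e2
  -- As `y (k + 1)` is off each hyperplane in `leaving`, the sign of its transformed height reveals
  -- whether that hyperplane was folded. This is why choices are restricted to `leaving`.
  have key : ∀ α ∈ G.leaving y k, (α ∈ c k ↔ α ∈ c' k) := by
    intro α hα
    have hon := leaving_subset y k hα
    have e4 := congrArg (ht α (corootPairing α (y k))) e3
    rw [hy.ht_prodOver hon ((hc k).trans (leaving_subset y k)),
      hy.ht_prodOver hon ((hc' k).trans (leaving_subset y k))] at e4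
    have h0 : ht α (corootPairing α (y k)) (y (k + 1)) ≠ 0 :=
      fun h => (mem_leaving.mp hα).2 (sub_eq_zero.mp h)
    by_cases h1 : α ∈ c k <;> by_cases h2 : α ∈ c' k <;> simp only [h1, h2, if_true, if_false] at e4 ⊢
    · exact absurd (by linarith) h0
    · exact absurd (by linarith) h0
  ext α
  constructor
  · intro h1; exact (key α (hc k h1)).mp h1
  · intro h1; exact (key α (hc' k h1)).mpr h1

lemma isRefl_conj_wallRefl {k : ℕ} {α : E r} (hα : α ∈ G.onRoots y k) (g : G.W) :
    ∃ β ∈ G.Φ, ∃ b ∈ levels G.e, (g * G.wallRefl y k α * g⁻¹).1 = refl β b := by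
  obtain ⟨h1, h2⟩ := mem_onRoots.mp hα
  refine isRefl_conj hy.rootSystem g.2 ⟨α, hy.mem_roots h1, _, h2, hy.coe_wallRefl hα⟩

omit hy in
lemma foldElt_of_forall_empty {c : ℕ → Finset (E r)} {m : ℕ} (hc : ∀ k, m ≤ k → c k = ∅) {k : ℕ}
    (hk : m ≤ k) : G.foldElt y c k = G.foldElt y c m := by
  induction k, hk using Nat.le_induction with
  | base => rfl
  | succ k hk ih => rw [foldElt, hc k hk, prodOver_empty, mul_one, ih]

/-- Every folding is obtained by a series of reflections. -/
lemma reachable_foldPath {c : ℕ → Finset (E r)} {m : ℕ} (hc : ∀ k, c k ⊆ G.leaving y k)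
    (hm : ∀ k, m ≤ k → c k = ∅) :
    Relation.ReflTransGen G.ReflStep y (G.foldPath y c) := by
  classical
  induction m generalizing c with
  | zero =>
    have : G.foldPath y c = y := by
      funext k
      rw [foldPath, foldElt_of_forall_empty hm (Nat.zero_le k)]
      rfl
    rw [this]
  | succ m ih =>
    -- The hyperplanes at the last folding point are used one at a time. Adding a root to `I`
    -- reflects the current path at that point in the hyperplane of the conjugated wall reflection.
    have key : ∀ I ⊆ G.leaving y m,
        Relation.ReflTransGen G.ReflStep y (G.foldPath y (Function.update c m I)) := by
      intro I hI
      induction I using Finset.induction_on with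
      | empty =>
        refine ih (fun k => ?_) (fun k hk => ?_)
        · by_cases h : k = m
          · subst h; simp
          · rw [Function.update_of_ne h]; exact hc k
        · by_cases h : k = m
          · subst h; simp
          · rw [Function.update_of_ne h]; exact hm k (by omega)
      | insert α I hα ihI =>
        refine (ihI fun x hx => hI (Finset.mem_insert_of_mem hx)).tail ?_
        have hon := leaving_subset y m (hI (Finset.mem_insert_self _ _))
        have hw : ∀ J, ∀ i ≤ m, G.foldElt y (Function.update c m J) i = G.foldElt y c i :=
          fun J i hi => foldElt_congr fun j hj => Function.update_of_ne (by omega) _ _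
        have hw' : ∀ J, ∀ i, m + 1 ≤ i → G.foldElt y (Function.update c m J) i =
            G.foldElt y c m * prodOver (G.wallRefl y m) J := by
          intro J i hi
          rw [foldElt_of_forall_empty (m := m + 1) (fun k hk => by
            rw [Function.update_of_ne (by omega)]; exact hm k hk) hi, foldElt, hw J m le_rfl,
            Function.update_self]
        obtain ⟨β, hβ, b, hb, he⟩ := hy.isRefl_conj_wallRefl hon (G.foldElt y c m)
        have hfix : affineReflection β b ((G.foldElt y c m).1 (y m)) =
            (G.foldElt y c m).1 (y m) := by
          rw [← refl_apply, ← he]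
          simp only [Subgroup.coe_mul, Equiv.Perm.mul_apply, Subgroup.coe_inv]
          have e1 : (G.foldElt y c m).1⁻¹ ((G.foldElt y c m).1 (y m)) = y m := by simp
          rw [e1, hy.coe_wallRefl hon, refl_apply, affineReflection_of_ht_eq_zero (sub_self _)]
        refine ⟨β, hβ, b, hb, m, ?_, fun i hi => ?_, fun i hi => ?_⟩
        · rw [foldPath, hw I m le_rfl]
          have h1 := congrArg (fun x => ⟪x, β⟫_ℝ) hfix
          simp only [affineReflection_eq, inner_sub_left, real_inner_smul_left] at h1
          have h2 : ⟪β, β⟫_ℝ ≠ 0 := inner_self_ne_zero.mpr (hy.rootSystem.ne_zero β hβ)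
          have h3 : ht β b ((G.foldElt y c m).1 (y m)) * ⟪β, β⟫_ℝ = 0 := by linarith
          exact (mul_eq_zero.mp h3).resolve_right h2
        · rw [foldPath, foldPath, hw _ i hi, hw _ i hi]
        · rcases hi.eq_or_lt with rfl | hi
          · rw [foldPath, foldPath, hw _ m le_rfl, hw _ m le_rfl, hfix]
          · rw [foldPath, foldPath, hw' _ i hi, hw' _ i hi,
              hy.prodOver_wallRefl_insert (hI.trans (leaving_subset y m)) hα, ← refl_apply, ← he,
              ← Equiv.Perm.mul_apply, ← Subgroup.coe_mul]
            congr 2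
            group
    have := key (c m) (hc m)
    rwa [Function.update_eq_self] at this

/-- The foldings are stable under reflections. -/
lemma exists_foldPath_of_reflStep {c : ℕ → Finset (E r)} (hc : ∀ k, c k ⊆ G.leaving y k)
    {q : ℕ → E r} (hq : G.ReflStep (G.foldPath y c) q) :
    ∃ c', (∀ k, c' k ⊆ G.leaving y k) ∧ q = G.foldPath y c' := by
  classical
  obtain ⟨α, hα, b, hb, k, h0, h1, h2⟩ := hq
  obtain ⟨L, τ, hL⟩ := exists_preserves hy.rootSystem (G.foldElt y c k).2
  -- the hyperplane, transported back to `y k`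
  obtain ⟨β, hβ, b', hb', hβ0, he⟩ : ∃ β ∈ G.P, ∃ b' ∈ levels G.e, ht β b' (y k) = 0 ∧
      refl α b * (G.foldElt y c k).1 = (G.foldElt y c k).1 * refl β b' := by
    have h3 := h0
    rw [foldPath, hL.ht'] at h3
    have hβ := hL.mem_symm hα
    have hb' := sub_mem_levels hb (hL.2.2 _ hα)
    have he : refl α b * (G.foldElt y c k).1 =
        (G.foldElt y c k).1 * refl (L.symm α) (b - corootPairing α τ) := by
      have := hL.conj (L.symm α) (b - corootPairing α τ)
      rw [L.apply_symm_apply, sub_add_cancel, mul_inv_eq_iff_eq_mul] at this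
      exact this.symm
    obtain ⟨f, hf, hfP⟩ := hy.positive
    rcases lt_or_gt_of_ne (hf _ hβ) with h | h
    · refine ⟨-L.symm α, (hfP _).mpr ⟨neg_mem hy.rootSystem hβ, by rw [map_neg]; linarith⟩, _,
        neg_mem_levels hb', ?_, ?_⟩
      · rw [ht_neg, h3, neg_zero]
      · rw [refl_neg, he]
    · exact ⟨_, (hfP _).mpr ⟨hβ, h⟩, _, hb', h3, he⟩
  -- The path `y` may stay on the hyperplane after time `k`, but not forever, since its endpoint is
  -- regular. Reflecting at the last time `K` of this stay has the same effect as reflecting at `k`.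
  have hex : ∃ j, k ≤ j ∧ ht β b' (y j) ≠ 0 := by
    refine ⟨max k n, le_max_left _ _, ?_⟩
    rw [hy.good.const _ (le_max_right _ _)]
    exact hy.good.reg β (hy.mem_roots hβ) b' hb'
  obtain ⟨hkj, hj0⟩ := Nat.find_spec hex
  have hmin : ∀ i, k ≤ i → i < Nat.find hex → ht β b' (y i) = 0 := by
    intro i hi hlt
    by_contra hcon
    exact Nat.find_min hex hlt ⟨hi, hcon⟩
  generalize Nat.find hex = j at hkj hj0 hmin
  obtain ⟨K, rfl⟩ : ∃ K, j = K + 1 := by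
    rcases j with _ | K
    · rw [Nat.le_zero.mp hkj] at hβ0
      exact absurd hβ0 hj0
    · exact ⟨K, rfl⟩
  have hkK : k ≤ K := by
    rcases hkj.eq_or_lt with rfl | h
    · exact absurd hβ0 hj0
    · omega
  have hpair : ∀ i, k ≤ i → i ≤ K → corootPairing β (y i) = b' := fun i hi hiK =>
    sub_eq_zero.mp (hmin i hi (by omega))
  have hon : ∀ i, k ≤ i → i ≤ K → β ∈ G.onRoots y i := fun i hi hiK =>
    mem_onRoots.mpr ⟨hβ, by rw [hpair i hi hiK]; exact hb'⟩
  have hcoe : ∀ i, k ≤ i → i ≤ K → (G.wallRefl y i β).1 = refl β b' := fun i hi hiK => by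
    rw [hy.coe_wallRefl (hon i hi hiK), hpair i hi hiK]
  set g : G.W := ⟨refl α b, refl_mem_W hα hb⟩ with hg
  -- During the stay the pulled-back hyperplane is the same one, and its reflection commutes with
  -- all folds made there.
  have hcomm : ∀ i, k ≤ i → i ≤ K → g * G.foldElt y c i = G.foldElt y c i * G.wallRefl y i β := by
    intro i hi
    induction i, hi using Nat.le_induction with
    | base =>
      intro hK
      apply Subtype.ext
      rw [Subgroup.coe_mul, Subgroup.coe_mul, hcoe k le_rfl hK]
      exact he
    | succ i hi ih =>
      intro hK
      have e : G.wallRefl y (i + 1) β = G.wallRefl y i β :=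
        Subtype.ext (by rw [hcoe _ (by omega) hK, hcoe i hi (by omega)])
      have hcm : Commute (G.wallRefl y i β) (prodOver (G.wallRefl y i) (c i)) :=
        prodOver_commute fun x hx =>
          hy.wallRefl_commute (hon i hi (by omega)) (leaving_subset y i (hc i hx))
      rw [foldElt, ← mul_assoc, ih (by omega), mul_assoc, hcm.eq, ← mul_assoc, e]
  have hβK : β ∈ G.leaving y K := by
    refine mem_leaving.mpr ⟨hon K hkK le_rfl, fun h => hj0 ?_⟩
    rw [ht, h, hpair K hkK le_rfl, sub_self]
  -- Reflecting toggles the choice for `β` at time `K`; all later group elements are multiplied by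
  -- `g` on the left.
  let c' := Function.update c K (symmDiff (c K) {β})
  have hc'K : ∀ i ≤ K, G.foldElt y c' i = G.foldElt y c i := fun i hi =>
    foldElt_congr fun j hj => Function.update_of_ne (by omega) _ _
  have hc'L : ∀ i, K + 1 ≤ i → G.foldElt y c' i = g * G.foldElt y c i := by
    intro i hi
    induction i, hi using Nat.le_induction with
    | base =>
      rw [foldElt, hc'K K le_rfl, foldElt, ← mul_assoc, hcomm K hkK le_rfl, mul_assoc]
      simp only [c', Function.update_self]
      rw [hy.prodOver_symmDiff (leaving_subset y K hβK) ((hc K).trans (leaving_subset y K))]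
    | succ i hi ih =>
      rw [foldElt, ih, foldElt, mul_assoc]
      simp only [c', Function.update_of_ne (show i ≠ K by omega)]
  refine ⟨c', fun i => ?_, funext fun i => ?_⟩
  · by_cases h : i = K
    · subst h
      simp only [c', Function.update_self]
      intro x hx
      rcases Finset.mem_symmDiff.mp hx with h | h
      · exact hc i h.1
      · rw [Finset.mem_singleton.mp h.1]; exact hβK
    · simp only [c', Function.update_of_ne h]; exact hc i
  · rcases le_total i k with hi | hi
    · rw [h1 i hi, foldPath, foldPath, hc'K i (by omega)]
    · rw [h2 i hi, ← refl_apply]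
      change (g.1 * (G.foldElt y c i).1) (y i) = (G.foldElt y c' i).1 (y i)
      rcases le_or_gt i K with hiK | hiK
      · rw [hc'K i hiK, ← Subgroup.coe_mul, hcomm i hi hiK, Subgroup.coe_mul, hcoe i hi hiK,
          Equiv.Perm.mul_apply, refl_apply,
          affineReflection_of_ht_eq_zero (hmin i hi (by omega))]
      · rw [hc'L i hiK, Subgroup.coe_mul]

lemma reachable_iff {q : ℕ → E r} : Relation.ReflTransGen G.ReflStep y q ↔
    ∃ c ∈ choices (G.leaving y) n, q = G.foldPath y c := by
  have hempty : ∀ {c : ℕ → Finset (E r)}, (∀ k, c k ⊆ G.leaving y k) → ∀ k, n ≤ k → c k = ∅ :=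
    fun hc k hk => Finset.subset_empty.mp (hy.leaving_eq_empty hk ▸ hc k)
  constructor
  · intro h
    suffices h : ∃ c : ℕ → Finset (E r), (∀ k, c k ⊆ G.leaving y k) ∧ q = G.foldPath y c by
      obtain ⟨c, hc, rfl⟩ := h
      exact ⟨c, mem_choices.mpr ⟨fun k _ => hc k, hempty hc⟩, rfl⟩
    induction h with
    | refl =>
      refine ⟨fun _ => ∅, fun _ => Finset.empty_subset _, funext fun k => ?_⟩
      rw [foldPath, foldElt_of_forall_empty (m := 0) (fun _ _ => rfl) (Nat.zero_le k)]
      rfl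
    | tail _ h2 ih =>
      obtain ⟨c, hc, rfl⟩ := ih
      exact hy.exists_foldPath_of_reflStep hc h2
  · rintro ⟨c, hc, rfl⟩
    obtain ⟨h1, h2⟩ := mem_choices.mp hc
    refine hy.reachable_foldPath (m := n) (fun k => ?_) h2
    rcases lt_or_ge k n with hk | hk
    · exact h1 k hk
    · rw [h2 k hk]; exact Finset.empty_subset _

end Folded
end Geometry
end SoergelPath
end

noncomputable section
open scoped LaurentPolynomial InnerProductSpace
namespace SoergelPath
namespace Geometry

variable {r : ℕ} {G : Geometry r}

/-! ### The graded character of the foldings is bar-invariant -/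

/-- The wall of the alcove of `w v` with root `α` at `w (y k)` separates this alcove from `v`. -/
def IsDescent (v : E r) (y : ℕ → E r) (w : G.W) (k : ℕ) (α : E r) : Prop :=
  w * G.wallRefl y k α * w⁻¹ ∈ inversions v w

open Classical in
/-- The degree contributed by leaving the hyperplanes at `y k`, folded at those in `I`. -/
def leaveDeg (v : E r) (y : ℕ → E r) (D : Finset (E r)) (w : G.W) (k : ℕ) (I : Finset (E r)) : ℤ :=
  ∑ α ∈ D \ I, if IsDescent v y w k α then -1 else 1

open Classical in
/-- The number of hyperplanes through the `k`-th point that separate the current alcove from the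
base point. -/
def potential (v : E r) (y : ℕ → E r) (w : G.W) (k : ℕ) : ℤ :=
  ∑ α ∈ G.onRoots y k, if IsDescent v y w k α then 1 else 0

namespace Folded

variable {n : ℕ} {v : E r} {y : ℕ → E r} (hy : G.Folded n v y)
include hy

/-- Translation by `w⁻¹` moves the question to the hyperplane through `y k` and the points `v` and
`w⁻¹ v`. -/
lemma isDescent_iff {k : ℕ} {α : E r} (hα : α ∈ G.onRoots y k) (w : G.W) :
    IsDescent v y w k α ↔ ht α (corootPairing α (y k)) v *
      ht α (corootPairing α (y k)) (w.1⁻¹ v) < 0 := by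
  obtain ⟨h1, h2⟩ := mem_onRoots.mp hα
  have hr := hy.isRefl_conj_wallRefl hα w
  have e := sepBy_conj hy.rootSystem (w⁻¹).2 (G.wallRefl y k α).1 v (w.1 v)
  simp only [Subgroup.coe_inv, inv_inv] at e
  have e1 : w.1⁻¹ (w.1 v) = v := by simp
  rw [e1, hy.coe_wallRefl hα, sepBy_refl (hy.ne_zero h1), mul_comm] at e
  rw [← e, IsDescent, ← hy.coe_wallRefl hα]
  exact ⟨fun h => h.2, fun h => ⟨hr, h⟩⟩

lemma ht_inv_ne_zero {k : ℕ} {α : E r} (hα : α ∈ G.onRoots y k) (w : G.W) :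
    ht α (corootPairing α (y k)) (w.1⁻¹ v) ≠ 0 :=
  reg_apply hy.rootSystem (w⁻¹).2 hy.reg_base α (hy.mem_roots (mem_onRoots.mp hα).1) _
    (mem_onRoots.mp hα).2

lemma isDescent_mul {k : ℕ} {α : E r} (hα : α ∈ G.onRoots y k) {I : Finset (E r)}
    (hI : I ⊆ G.onRoots y k) (w : G.W) :
    IsDescent v y (w * prodOver (G.wallRefl y k) I) k α ↔ Xor (IsDescent v y w k α) (α ∈ I) := by
  classical
  rw [hy.isDescent_iff hα, hy.isDescent_iff hα]
  set u := prodOver (G.wallRefl y k) I with hu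
  have e1 : (w * u).1⁻¹ v = u.1⁻¹ (w.1⁻¹ v) := by
    rw [Subgroup.coe_mul, mul_inv_rev, Equiv.Perm.mul_apply]
  have e2 := hy.ht_prodOver hα hI (u.1⁻¹ (w.1⁻¹ v))
  have e3 : u.1 (u.1⁻¹ (w.1⁻¹ v)) = w.1⁻¹ v := by simp
  rw [← hu, e3] at e2
  have h1 := hy.ht_inv_ne_zero hα w
  have h2 := hy.reg_base α (hy.mem_roots (mem_onRoots.mp hα).1) _ (mem_onRoots.mp hα).2
  rw [e1]
  by_cases h : α ∈ I
  · rw [if_pos h] at e2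
    rw [show ht α (corootPairing α (y k)) (u.1⁻¹ (w.1⁻¹ v)) =
      -ht α (corootPairing α (y k)) (w.1⁻¹ v) by linarith]
    simp only [h, Xor, not_true, and_false, true_and, false_or]
    have := mul_ne_zero h2 h1
    rw [mul_neg, not_lt, Left.neg_neg_iff]
    exact ⟨fun h => h.le, fun h => lt_of_le_of_ne h this.symm⟩
  · rw [if_neg h] at e2
    rw [← e2]
    simp [h, Xor]

/-- The points of `y` lie in the closure of the alcove of `v`, so off a hyperplane they are on the
side of `v`. Being on the side of `w⁻¹ v` then means that the hyperplane does not separate `v` from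
`w⁻¹ v`, that is, no descent. -/
lemma stepDeg_eq (k : ℕ) (w : G.W) {α : E r} (hα : α ∈ G.P) [Decidable (α ∈ G.leaving y k)]
    [Decidable (IsDescent v y w k α)] [Decidable (IsDescent v y w (k + 1) α)]
    [Decidable (α ∈ G.onRoots y (k + 1))] :
    G.stepDeg (w.1⁻¹ v) α (y k) (y (k + 1)) =
      (if α ∈ G.leaving y k then (if IsDescent v y w k α then 0 else 1) else 0) +
      (if α ∈ G.onRoots y (k + 1) ∧ corootPairing α (y k) ≠ corootPairing α (y (k + 1)) then
        (if IsDescent v y w (k + 1) α then -1 else 0) else 0) := by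
  have hΦ := hy.mem_roots hα
  have e1 : (∃ b ∈ levels G.e, ht α b (y k) = 0 ∧ 0 < ht α b (y (k + 1)) * ht α b (w.1⁻¹ v)) ↔
      α ∈ G.leaving y k ∧ ¬ IsDescent v y w k α := by
    constructor
    · rintro ⟨b, hb, h0, h1⟩
      obtain rfl : corootPairing α (y k) = b := sub_eq_zero.mp h0
      have hon : α ∈ G.onRoots y k := mem_onRoots.mpr ⟨hα, hb⟩
      have h2 := hy.near_base (k + 1) α hΦ _ hb
      refine ⟨mem_leaving.mpr ⟨hon, fun h => ?_⟩, ?_⟩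
      · rw [show ht α (corootPairing α (y k)) (y (k + 1)) = 0 from sub_eq_zero.mpr h] at h1
        simp at h1
      · rw [hy.isDescent_iff hon]
        intro h3
        nlinarith [mul_nonneg h2 h1.le, mul_neg_of_neg_of_pos h3
          (show 0 < ht α (corootPairing α (y k)) (y (k + 1)) ^ 2 by
            have : ht α (corootPairing α (y k)) (y (k + 1)) ≠ 0 := by
              intro h; rw [h] at h1; simp at h1
            positivity)]
    · rintro ⟨h1, h2⟩
      obtain ⟨hon, hne⟩ := mem_leaving.mp h1
      have hb := (mem_onRoots.mp hon).2
      refine ⟨_, hb, sub_self _, ?_⟩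
      rw [hy.isDescent_iff hon] at h2
      have h3 := hy.near_base (k + 1) α hΦ _ hb
      have h4 := hy.ht_inv_ne_zero hon w
      have h5 := hy.reg_base α hΦ _ hb
      have h6 : ht α (corootPairing α (y k)) (y (k + 1)) ≠ 0 := sub_ne_zero.mpr hne
      have h7 := lt_of_le_of_ne (not_lt.mp h2) (mul_ne_zero h5 h4).symm
      have h8 := lt_of_le_of_ne h3 (mul_ne_zero h6 h5).symm
      by_contra hcon
      nlinarith [mul_pos h7 h8, mul_nonneg (not_lt.mp hcon |> neg_nonneg.mpr)
        (mul_self_nonneg (ht α (corootPairing α (y k)) v))]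
  have e2 : (∃ b ∈ levels G.e, ht α b (y k) * ht α b (w.1⁻¹ v) < 0 ∧ ht α b (y (k + 1)) = 0) ↔
      (α ∈ G.onRoots y (k + 1) ∧ corootPairing α (y k) ≠ corootPairing α (y (k + 1))) ∧
        IsDescent v y w (k + 1) α := by
    constructor
    · rintro ⟨b, hb, h1, h0⟩
      obtain rfl : corootPairing α (y (k + 1)) = b := sub_eq_zero.mp h0
      have hon : α ∈ G.onRoots y (k + 1) := mem_onRoots.mpr ⟨hα, hb⟩
      have h6 : ht α (corootPairing α (y (k + 1))) (y k) ≠ 0 := by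
        intro h; rw [h] at h1; simp at h1
      have h2 := hy.near_base k α hΦ _ hb
      refine ⟨⟨hon, fun h => h6 (sub_eq_zero.mpr h)⟩, ?_⟩
      rw [hy.isDescent_iff hon]
      by_contra hcon
      have h4 := hy.ht_inv_ne_zero hon w
      have h5 := hy.reg_base α hΦ _ hb
      have h7 := lt_of_le_of_ne (not_lt.mp hcon) (mul_ne_zero h5 h4).symm
      nlinarith [mul_neg_of_neg_of_pos h1 h7, mul_nonneg h2 (mul_self_nonneg
        (ht α (corootPairing α (y (k + 1))) (w.1⁻¹ v)))]
    · rintro ⟨⟨hon, hne⟩, h1⟩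
      have hb := (mem_onRoots.mp hon).2
      refine ⟨_, hb, ?_, sub_self _⟩
      rw [hy.isDescent_iff hon] at h1
      have h6 : ht α (corootPairing α (y (k + 1))) (y k) ≠ 0 := sub_ne_zero.mpr hne
      have h2 := hy.near_base k α hΦ _ hb
      have h5 := hy.reg_base α hΦ _ hb
      have h8 := lt_of_le_of_ne h2 (mul_ne_zero h6 h5).symm
      by_contra hcon
      nlinarith [mul_neg_of_pos_of_neg h8 h1, mul_nonneg (not_lt.mp hcon)
        (mul_self_nonneg (ht α (corootPairing α (y (k + 1))) v))]
  classical
  refine congrArg₂ (· + ·) ((if_congr e1 rfl rfl).trans ?_) ((if_congr e2 rfl rfl).trans ?_)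
  · by_cases h1 : α ∈ G.leaving y k <;> by_cases h2 : IsDescent v y w k α <;> simp [h1, h2]
  · by_cases h2 : IsDescent v y w (k + 1) α <;> simp [h2]

/-- The potential at time `k` counts the hyperplanes through the point that lie between the current
alcove and the base. Arrivals from the far side are its new terms at time `k + 1`, with sign -1. A
departure contributes its old potential, plus `leaveDeg` when the hyperplane is not folded. -/
lemma sum_stepDeg_foldPath {c : ℕ → Finset (E r)} {k : ℕ} (hc : c k ⊆ G.leaving y k) :
    ∑ α ∈ G.P, G.stepDeg v α (G.foldPath y c k) (G.foldPath y c (k + 1)) =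
      potential v y (G.foldElt y c k) k - potential v y (G.foldElt y c (k + 1)) (k + 1) +
        leaveDeg v y (G.leaving y k) (G.foldElt y c k) k (c k) := by
  classical
  set w := G.foldElt y c k with hw
  set w' := G.foldElt y c (k + 1) with hw'
  have hww : w' = w * prodOver (G.wallRefl y k) (c k) := rfl
  have e0 : v = w'.1 (w'.1⁻¹ v) := by simp
  have e1 : ∑ α ∈ G.P, G.stepDeg v α (G.foldPath y c k) (G.foldPath y c (k + 1)) =
      ∑ α ∈ G.P, G.stepDeg (w'.1⁻¹ v) α (y k) (y (k + 1)) := by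
    have := sum_stepDeg hy.rootSystem hy.positive w'.2 (w'.1⁻¹ v) (y k) (y (k + 1))
    rw [← e0] at this
    rw [← this, hy.foldPath_eq hc]
    rfl
  have conv : ∀ (A : Finset (E r)) (f : E r → ℤ), A ⊆ G.P →
      ∑ α ∈ A, f α = ∑ α ∈ G.P, if α ∈ A then f α else 0 := by
    intro A f hA
    rw [Finset.sum_ite_mem, Finset.inter_eq_right.mpr hA]
  have hon : ∀ k, G.onRoots y k ⊆ G.P := fun k α hα => (mem_onRoots.mp hα).1
  rw [e1, potential, potential, leaveDeg, conv _ _ (hon k), conv _ _ (hon (k + 1)),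
    conv _ _ (Finset.sdiff_subset.trans ((leaving_subset y k).trans (hon k))),
    ← Finset.sum_sub_distrib, ← Finset.sum_add_distrib]
  refine Finset.sum_congr rfl fun α hα => ?_
  rw [hy.stepDeg_eq k w' hα]
  have hdesc : α ∈ G.onRoots y k → (IsDescent v y w' k α ↔ Xor (IsDescent v y w k α) (α ∈ c k)) :=
    fun h => hww ▸ hy.isDescent_mul h (hc.trans (leaving_subset y k)) w
  -- On a hyperplane direction along which the step does not move, there is no degree and the two
  -- potential terms cancel.
  by_cases he : corootPairing α (y (k + 1)) = corootPairing α (y k)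
  · have hnl : α ∉ G.leaving y k := fun h => (mem_leaving.mp h).2 he
    have hnc : α ∉ c k := fun h => hnl (hc h)
    have hiff : α ∈ G.onRoots y (k + 1) ↔ α ∈ G.onRoots y k := by
      rw [mem_onRoots, mem_onRoots, he]
    have hwr : G.wallRefl y (k + 1) α = G.wallRefl y k α := by
      simp only [wallRefl, he]
    have hd1 : IsDescent v y w' (k + 1) α ↔ IsDescent v y w' k α := by
      rw [IsDescent, IsDescent, hwr]
    simp only [hnl, Finset.mem_sdiff, if_false, false_and, he, ne_eq, not_true, and_false, hiff,
      hd1]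
    by_cases ho : α ∈ G.onRoots y k
    · have := hdesc ho
      simp only [hnc, Xor, not_false_iff, and_true, false_and, or_false] at this
      simp [ho, this]
    · simp [ho]
  · have hl : α ∈ G.leaving y k ↔ α ∈ G.onRoots y k := by
      rw [mem_leaving]; simp [he]
    simp only [hl, Finset.mem_sdiff, ne_eq, Ne.symm he, not_false_iff, and_true]
    by_cases ho : α ∈ G.onRoots y k
    · have hd := hdesc ho
      by_cases h1 : IsDescent v y w k α <;> by_cases h2 : α ∈ c k <;>
        simp only [h1, h2, Xor, not_true, not_false_iff, and_true, and_false,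
          or_false, or_true, iff_true, iff_false] at hd <;>
        simp only [ho, h1, h2, hd, if_true, if_false, not_true, not_false_iff, and_false, and_true]
        <;> split_ifs <;> rfl
    · simp only [ho, if_false, false_and]
      split_ifs <;> rfl

/-- The potentials telescope, and they vanish at both ends because the endpoints are regular. -/
lemma sum_degree_foldPath {c : ℕ → Finset (E r)} (hc : c ∈ choices (G.leaving y) n) :
    ∑ k ∈ Finset.range n,
      ∑ α ∈ G.P, G.stepDeg v α (G.foldPath y c k) (G.foldPath y c (k + 1)) =
    ∑ k ∈ Finset.range n, leaveDeg v y (G.leaving y k) (G.foldElt y c k) k (c k) := by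
  have h1 := (mem_choices.mp hc).1
  rw [Finset.sum_congr rfl fun k hk => hy.sum_stepDeg_foldPath (h1 k (Finset.mem_range.mp hk)),
    Finset.sum_add_distrib, Finset.sum_range_sub']
  have e0 : ∀ w : G.W, potential v y w 0 = 0 := fun w => by
    rw [potential, hy.onRoots_eq_empty (by rw [hy.good.start]; exact hy.reg_base),
      Finset.sum_empty]
  have en : ∀ w : G.W, potential v y w n = 0 := fun w => by
    rw [potential, hy.onRoots_eq_empty hy.good.reg, Finset.sum_empty]
  rw [e0, en, sub_zero, zero_add]

open LaurentPolynomial Finsupp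

/-- The bar involution attached to the alcove of `v`. -/
abbrev bar : (G.W →₀ ℤ[T;T⁻¹]) →+ (G.W →₀ ℤ[T;T⁻¹]) :=
  (isInversionCocycle hy.rootSystem hy.reg_base).bar

/-- The operator is the product of the wall-crossing operators of the roots in `D`. Expanding it,
`I` records where the summand `w * s` is taken, while each root of `D \ I` contributes `T (±1)`.
Since the walls are orthogonal, multiplying by one wall reflection does not affect the descents at
the others. -/
lemma exists_operator (k : ℕ) {D : Finset (E r)} (hD : D ⊆ G.onRoots y k) :
    ∃ O : (G.W →₀ ℤ[T;T⁻¹]) →ₗ[ℤ[T;T⁻¹]] (G.W →₀ ℤ[T;T⁻¹]),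
      (∀ x, hy.bar (O x) = O (hy.bar x)) ∧
      ∀ w : G.W, O (single w 1) = ∑ I ∈ D.powerset,
        (T (leaveDeg v y D w k I) : ℤ[T;T⁻¹]) •
          single (w * prodOver (G.wallRefl y k) I) (1 : ℤ[T;T⁻¹]) := by
  classical
  induction D using Finset.induction_on with
  | empty =>
    refine ⟨LinearMap.id, fun x => rfl, fun w => ?_⟩
    simp [leaveDeg, prodOver_empty]
  | insert a D ha ih =>
    have hD' : D ⊆ G.onRoots y k := fun x hx => hD (Finset.mem_insert_of_mem hx)
    have hao := hD (Finset.mem_insert_self a D)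
    obtain ⟨O, hO, hOw⟩ := ih hD'
    refine ⟨IsInversionCocycle.wallCross (inversions v) (G.wallRefl y k a) ∘ₗ O, fun x => ?_,
      fun w => ?_⟩
    · rw [LinearMap.comp_apply, LinearMap.comp_apply, ← hO]
      exact IsInversionCocycle.bar_wallCross _ (hy.wallRefl_mem_walls hao) _
    · rw [LinearMap.comp_apply, hOw, Finset.sum_powerset_insert ha, map_sum,
        ← Finset.sum_add_distrib]
      refine Finset.sum_congr rfl fun I hI => ?_
      rw [Finset.mem_powerset] at hI
      have haI : a ∉ I := fun h => ha (hI h)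
      have hd := hy.isDescent_mul hao (hI.trans hD') w
      simp only [haI, Xor, not_false_iff, and_true, false_and, or_false] at hd
      have e1 : leaveDeg v y (insert a D) w k I =
          (if IsDescent v y w k a then -1 else 1) + leaveDeg v y D w k I := by
        rw [leaveDeg, Finset.insert_sdiff_of_notMem _ haI, Finset.sum_insert (by simp [ha]),
          leaveDeg]
      have e2 : leaveDeg v y (insert a D) w k (insert a I) = leaveDeg v y D w k I := by
        rw [leaveDeg, Finset.insert_sdiff_of_mem _ (Finset.mem_insert_self a I),
          Finset.sdiff_insert_of_notMem ha, leaveDeg]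
      have e3 : w * prodOver (G.wallRefl y k) (insert a I) =
          w * prodOver (G.wallRefl y k) I * G.wallRefl y k a := by
        rw [hy.prodOver_wallRefl_insert (Finset.insert_subset hao (hI.trans hD')) haI,
          (prodOver_commute fun x hx => hy.wallRefl_commute hao (hD' (hI hx))).eq, mul_assoc]
      rw [map_smul, IsInversionCocycle.wallCross_single, e1, e2, e3, smul_add, smul_smul]
      congr 2
      have hd' : w * prodOver (G.wallRefl y k) I * G.wallRefl y k a *
          (w * prodOver (G.wallRefl y k) I)⁻¹ ∈ inversions v (w * prodOver (G.wallRefl y k) I) ↔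
          IsDescent v y w k a := hd
      rw [T_add, mul_comm]
      by_cases h : IsDescent v y w k a
      · rw [if_pos (hd'.mpr h), if_pos h]
      · rw [if_neg (fun hh => h (hd'.mp hh)), if_neg h]

/-- Splitting off the last choice writes the sum as the next operator applied to the previous sum,
starting from the bar-invariant identity element. -/
lemma bar_sum_choices (m : ℕ) :
    hy.bar (∑ c ∈ choices (G.leaving y) m,
      (T (∑ k ∈ Finset.range m, leaveDeg v y (G.leaving y k) (G.foldElt y c k) k (c k)) :
        ℤ[T;T⁻¹]) • single (G.foldElt y c m) (1 : ℤ[T;T⁻¹])) =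
    ∑ c ∈ choices (G.leaving y) m,
      (T (∑ k ∈ Finset.range m, leaveDeg v y (G.leaving y k) (G.foldElt y c k) k (c k)) :
        ℤ[T;T⁻¹]) • single (G.foldElt y c m) (1 : ℤ[T;T⁻¹]) := by
  classical
  induction m with
  | zero =>
    simp only [choices, Finset.sum_singleton, Finset.range_zero, Finset.sum_empty, T_zero, one_smul,
      foldElt]
    rw [bar, IsInversionCocycle.bar_single, map_one, one_smul, IsInversionCocycle.barBasis_one]
  | succ m ih =>
    obtain ⟨O, hO, hOw⟩ := hy.exists_operator m (leaving_subset y m)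
    have key : ∑ c ∈ choices (G.leaving y) (m + 1),
        (T (∑ k ∈ Finset.range (m + 1),
          leaveDeg v y (G.leaving y k) (G.foldElt y c k) k (c k)) : ℤ[T;T⁻¹]) •
            single (G.foldElt y c (m + 1)) (1 : ℤ[T;T⁻¹]) =
        O (∑ c ∈ choices (G.leaving y) m,
          (T (∑ k ∈ Finset.range m, leaveDeg v y (G.leaving y k) (G.foldElt y c k) k (c k)) :
            ℤ[T;T⁻¹]) • single (G.foldElt y c m) (1 : ℤ[T;T⁻¹])) := by
      rw [sum_choices_succ, map_sum]
      refine Finset.sum_congr rfl fun c _ => ?_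
      rw [map_smul, hOw, Finset.smul_sum]
      refine Finset.sum_congr rfl fun I _ => ?_
      have hw : ∀ i ≤ m, G.foldElt y (Function.update c m I) i = G.foldElt y c i :=
        fun i hi => foldElt_congr fun j hj => Function.update_of_ne (by omega) _ _
      rw [Finset.sum_range_succ, smul_smul, ← T_add, foldElt, hw m le_rfl, Function.update_self,
        Finset.sum_congr rfl fun k hk => by
          have hk := Finset.mem_range.mp hk
          rw [hw k hk.le, Function.update_of_ne hk.ne]]
    rw [key, hO, ih]

end Folded

/-! ### Paths indexed by `Fin (n + 1)` -/

variable (G) in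
/-- The path `p` in shifted coordinates, extended by a constant. -/
def extend {n : ℕ} (p : Fin (n + 1) → E r) (k : ℕ) : E r := p ⟨min k n, by omega⟩ + G.ρ

lemma extend_of_le {n : ℕ} (p : Fin (n + 1) → E r) (i : Fin (n + 1)) :
    G.extend p i = p i + G.ρ := by
  rw [extend]
  congr 2
  exact Fin.ext (min_eq_left (Nat.lt_succ_iff.mp i.2))

lemma extend_of_ge {n : ℕ} (p : Fin (n + 1) → E r) {k : ℕ} (hk : n ≤ k) :
    G.extend p k = p (Fin.last n) + G.ρ := by
  rw [extend]
  congr 2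
  exact Fin.ext (min_eq_right hk)

lemma extend_injective {n : ℕ} : Function.Injective (G.extend (n := n)) := by
  intro p q h
  funext i
  have := congrFun h i
  rw [extend_of_le, extend_of_le] at this
  exact add_right_cancel this

lemma IsReflectionOf.extend {n : ℕ} {p q : Fin (n + 1) → E r} (h : G.IsReflectionOf p q) :
    G.ReflStep (G.extend p) (G.extend q) := by
  obtain ⟨α, hα, b, hb, k, h0, h1, h2⟩ := h
  refine ⟨α, hα, b, hb, k, by rw [extend_of_le]; exact h0, fun i hi => ?_, fun i hi => ?_⟩
  · have hin : i < n + 1 := lt_of_le_of_lt hi k.2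
    have e := h1 ⟨i, hin⟩ hi
    rw [extend_of_le q ⟨i, hin⟩, extend_of_le p ⟨i, hin⟩, e]
  · rw [Geometry.extend, Geometry.extend, h2 _ (Fin.le_def.mpr (by
      have := k.2; simp only; omega)), sub_add_cancel]

lemma exists_of_reflStep_extend {n : ℕ} {p : Fin (n + 1) → E r} {Q : ℕ → E r}
    (h : G.ReflStep (G.extend p) Q) : ∃ q, G.IsReflectionOf p q ∧ Q = G.extend q := by
  obtain ⟨α, hα, b, hb, k, h0, h1, h2⟩ := h
  have hmin : G.extend p (min k n) = G.extend p k := by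
    rw [extend, extend]; congr 2; exact Fin.ext (by simp)
  -- An index beyond `n` is replaced by `n`: the constant tail lies on the hyperplane, so the
  -- reflection fixes it.
  refine ⟨fun i => Q i - G.ρ, ⟨α, hα, b, hb, ⟨min k n, by omega⟩, ?_, fun i hi => ?_,
    fun i hi => ?_⟩, ?_⟩
  · exact h0
  · have hi : (i : ℕ) ≤ min k n := hi
    simp only
    rw [h1 i (by omega), extend_of_le, add_sub_cancel_right]
  · have hi : min k n ≤ (i : ℕ) := hi
    simp only
    rw [← extend_of_le]
    rcases le_or_gt k i with hk | hk
    · rw [h2 i hk]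
    · have hin : n ≤ (i : ℕ) := by have := i.2; omega
      have e : G.extend p i = G.extend p k := by
        rw [extend_of_ge p hin, extend_of_ge p (by omega)]
      rw [h1 i hk.le, e, affineReflection_of_ht_eq_zero h0]
  · funext i
    rw [extend, sub_add_cancel]
    rcases le_total i n with hi | hi
    · simp [hi]
    · simp only [min_eq_right hi]
      have e : G.extend p i = G.extend p n := by rw [extend_of_ge p hi, extend_of_ge p le_rfl]
      rcases le_total k n with hk | hk
      · rw [h2 i (hk.trans hi), h2 n hk, e]
      · rw [h1 n hk]
        rcases le_total i k with hik | hik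
        · rw [h1 i hik, e]
        · have e' : G.extend p k = G.extend p n := by
            rw [extend_of_ge p hk, extend_of_ge p le_rfl]
          rw [h2 i hik, e, ← e', affineReflection_of_ht_eq_zero h0]

lemma reachable_iff_extend {n : ℕ} {p q : Fin (n + 1) → E r} :
    G.Reachable p q ↔ Relation.ReflTransGen G.ReflStep (G.extend p) (G.extend q) := by
  constructor
  · intro h
    induction h with
    | refl => exact .refl
    | tail _ h2 ih => exact ih.tail h2.extend
  · intro h
    suffices H : ∀ Q, Relation.ReflTransGen G.ReflStep (G.extend p) Q →
        ∃ q, G.Reachable p q ∧ Q = G.extend q by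
      obtain ⟨q', h1, h2⟩ := H _ h
      rwa [extend_injective h2]
    intro Q h
    induction h with
    | refl => exact ⟨p, .refl, rfl⟩
    | tail _ h2 ih =>
      obtain ⟨q, h3, rfl⟩ := ih
      obtain ⟨q', h4, rfl⟩ := exists_of_reflStep_extend h2
      exact ⟨q', h3.tail h4, rfl⟩

lemma exists_extend_of_reflTransGen {n : ℕ} {p : Fin (n + 1) → E r} {Q : ℕ → E r}
    (h : Relation.ReflTransGen G.ReflStep (G.extend p) Q) :
    ∃ q : Fin (n + 1) → E r, Q = G.extend q := by
  induction h with
  | refl => exact ⟨p, rfl⟩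
  | tail _ h2 ih =>
    obtain ⟨q, rfl⟩ := ih
    obtain ⟨q', -, rfl⟩ := exists_of_reflStep_extend h2
    exact ⟨q', rfl⟩

lemma degree_eq {n : ℕ} (p : Fin (n + 1) → E r) :
    G.degree p = ∑ k ∈ Finset.range n,
      ∑ α ∈ G.P, G.stepDeg (0 + G.ρ) α (G.extend p k) (G.extend p (k + 1)) := by
  rw [degree, degreeUpTo, Finset.filter_true_of_mem fun k _ => k.2, Finset.sum_range]
  refine Finset.sum_congr rfl fun k _ => Finset.sum_congr rfl fun α _ => ?_
  rw [stepDegree_eq, ← extend_of_le p k.castSucc, ← extend_of_le p k.succ]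
  rfl

lemma IsAdmissible.good (hG : G.IsAdmissibleGeometry) {n : ℕ} {p : Fin (n + 1) → E r}
    (hp : G.IsAdmissible p) (h0 : p 0 = 0) (hreg : G.IsRegular (p (Fin.last n))) :
    G.Good n (0 + G.ρ) (G.extend p) where
  start := by
    have := extend_of_le (G := G) p 0
    rwa [h0] at this
  const k hk := by rw [extend_of_ge p hk, extend_of_ge p le_rfl]
  reg := by
    rw [extend_of_ge p le_rfl]
    exact reg_of_isRegular hG.rootSystem hG.positive hreg
  orth k := by
    refine fun α hα β hβ b hb c hc => ?_
    revert α
    suffices H : ∀ β ∈ G.Φ, ∀ c ∈ levels G.e, ∀ α ∈ G.Φ, ∀ b ∈ levels G.e,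
        ht α b (G.extend p k) = 0 → ht β c (G.extend p k) = 0 →
          (β = α ∨ β = -α) ∨ corootPairing β α = 0 from
      fun α hα => H β hβ c hc α hα b hb
    clear! β b c
    refine forall_roots_of_forall_positive hG.rootSystem hG.positive ?_ fun β hβ c hc => ?_
    · intro β c H α hα b hb h1 h2
      rw [ht_neg, neg_eq_zero] at h2
      rcases H α hα b hb h1 h2 with (h | h) | h
      · exact Or.inl (Or.inr (by rw [h]))
      · exact Or.inl (Or.inl (by rw [h, neg_neg]))
      · right; rw [corootPairing_neg_left, h, neg_zero]
    refine forall_roots_of_forall_positive hG.rootSystem hG.positive ?_ fun α hα b hb => ?_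
    · intro α b H h1 h2
      rw [ht_neg, neg_eq_zero] at h1
      rcases H h1 h2 with (h | h) | h
      · exact Or.inl (Or.inr (by rw [h, neg_neg]))
      · exact Or.inl (Or.inl h)
      · right; rw [← neg_one_smul ℝ α, corootPairing_smul, h, mul_zero]
    intro h1 h2
    by_cases hαβ : α = β
    · exact Or.inl (Or.inl hαβ.symm)
    · exact Or.inr (hp.orthogonal _ α hα β hβ b hb c hc hαβ h1 h2)
  near k := by
    rcases lt_or_ge k n with hk | hk
    · refine forall_roots_of_forall_positive hG.rootSystem hG.positive
        (fun α b h => by rw [ht_neg, ht_neg]; linarith) fun α hα b hb => ?_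
      have := hp.no_jump ⟨k, hk⟩ α hα b hb
      rw [height_eq, height_eq, ← extend_of_le, ← extend_of_le] at this
      rw [mul_comm]
      exact this
    · rw [extend_of_ge p hk, extend_of_ge p (hk.trans (Nat.le_succ k))]
      exact near_self _

lemma reflTransGen_symm {x y : ℕ → E r} (h : Relation.ReflTransGen G.ReflStep x y) :
    Relation.ReflTransGen G.ReflStep y x := by
  induction h with
  | refl => exact .refl
  | tail _ h2 ih => exact .head h2.symm ih

open LaurentPolynomial Finsupp in
/-- The graded character of the paths obtained from an admissible path is bar-invariant. -/
theorem exists_bar_character (hG : G.IsAdmissibleGeometry) (hv : G.Reg (0 + G.ρ)) {n : ℕ}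
    {p : Fin (n + 1) → E r}
    (hp : G.IsAdmissible p) (h0 : p 0 = 0) (hreg : G.IsRegular (p (Fin.last n))) :
    ∃ (F : Finset (Fin (n + 1) → E r)) (g : (Fin (n + 1) → E r) → G.W) (y₀ : E r),
      (∀ q, q ∈ F ↔ G.Reachable p q) ∧ (∀ q ∈ F, q (Fin.last n) + G.ρ = (g q).1 y₀) ∧
      G.Near (0 + G.ρ) y₀ ∧ G.Reg y₀ ∧
      (isInversionCocycle hG.rootSystem hv).bar
        (∑ q ∈ F, (T (G.degree q) : ℤ[T;T⁻¹]) • single (g q) (1 : ℤ[T;T⁻¹])) =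
        ∑ q ∈ F, (T (G.degree q) : ℤ[T;T⁻¹]) • single (g q) (1 : ℤ[T;T⁻¹]) := by
  classical
  have hgood := hp.good hG h0 hreg
  obtain ⟨y, hpy, hyg, hyn⟩ := hgood.exists_folded hG.rootSystem hG.positive
  have hy : G.Folded n (0 + G.ρ) y := ⟨hG.rootSystem, hG.positive, hyg, hyn, hv⟩
  -- Reflections can be undone, so `p` and the folded path `y` reach the same paths.
  have hyp : Relation.ReflTransGen G.ReflStep y (G.extend p) :=
    reflTransGen_symm hpy
  have hreach : ∀ q : Fin (n + 1) → E r, G.Reachable p q ↔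
      ∃ c ∈ choices (G.leaving y) n, G.extend q = G.foldPath y c := by
    intro q
    rw [reachable_iff_extend, ← hy.reachable_iff]
    exact ⟨fun h => hyp.trans h, fun h => hpy.trans h⟩
  have hex : ∀ c ∈ choices (G.leaving y) n, ∃ q : Fin (n + 1) → E r,
      G.extend q = G.foldPath y c := by
    intro c hc
    obtain ⟨q, hq⟩ := exists_extend_of_reflTransGen
      (hpy.trans (hy.reachable_iff.mpr ⟨c, hc, rfl⟩))
    exact ⟨q, hq.symm⟩
  choose! Q hQ using hex
  have hleave : ∀ c ∈ choices (G.leaving y) n, ∀ k, c k ⊆ G.leaving y k := by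
    intro c hc k
    obtain ⟨h1, h2⟩ := mem_choices.mp hc
    rcases lt_or_ge k n with hk | hk
    · exact h1 k hk
    · rw [h2 k hk]; exact Finset.empty_subset _
  have hinj : ∀ c ∈ choices (G.leaving y) n, ∀ c' ∈ choices (G.leaving y) n,
      G.foldPath y c = G.foldPath y c' → c = c' := fun c hc c' hc' h =>
    hy.foldPath_injective (hleave c hc) (hleave c' hc') h
  have hexg : ∀ q ∈ (choices (G.leaving y) n).image Q, ∃ c ∈ choices (G.leaving y) n,
      G.extend q = G.foldPath y c := by
    intro q hq
    obtain ⟨c, hc, rfl⟩ := Finset.mem_image.mp hq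
    exact ⟨c, hc, hQ c hc⟩
  choose! C hC hC' using hexg
  have hCQ : ∀ c ∈ choices (G.leaving y) n, C (Q c) = c := fun c hc =>
    hinj _ (hC _ (Finset.mem_image_of_mem Q hc)) _ hc
      (by rw [← hC' _ (Finset.mem_image_of_mem Q hc), hQ c hc])
  have hsum : ∑ q ∈ (choices (G.leaving y) n).image Q,
      (T (G.degree q) : ℤ[T;T⁻¹]) • single (G.foldElt y (C q) n) (1 : ℤ[T;T⁻¹]) =
      ∑ c ∈ choices (G.leaving y) n,
      (T (∑ k ∈ Finset.range n,
        leaveDeg (0 + G.ρ) y (G.leaving y k) (G.foldElt y c k) k (c k)) :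
        ℤ[T;T⁻¹]) • single (G.foldElt y c n) (1 : ℤ[T;T⁻¹]) := by
    rw [Finset.sum_image fun c hc c' hc' h => by
      rw [← hCQ c hc, ← hCQ c' hc', h]]
    refine Finset.sum_congr rfl fun c hc => ?_
    rw [hCQ c hc, degree_eq, hQ c hc, hy.sum_degree_foldPath hc]
  refine ⟨(choices (G.leaving y) n).image Q, fun q => G.foldElt y (C q) n, y n, fun q => ?_,
    fun q hq => ?_, hyn n, hyg.reg, ?_⟩
  · rw [hreach]
    constructor
    · intro hq; exact ⟨C q, hC q hq, hC' q hq⟩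
    · rintro ⟨c, hc, h⟩
      refine Finset.mem_image.mpr ⟨c, hc, extend_injective (G := G) ?_⟩
      rw [hQ c hc, h]
  · rw [← extend_of_ge q le_rfl, hC' q hq]
    rfl
  · rw [hsum]
    exact hy.bar_sum_choices n

end Geometry
end SoergelPath
end

/-! ### Graded dimensions and existence of graded composition series. -/

noncomputable section

open scoped LaurentPolynomial InnerProductSpace

namespace SoergelPath

section GradedDimension

variable {A : Type*} [Ring A] [Algebra ℂ A]
variable {M : Type*} [AddCommGroup M] [Module ℂ M] [Module A M] [IsScalarTower ℂ A M]
variable {N : Type*} [AddCommGroup N] [Module ℂ N] [Module A N] [IsScalarTower ℂ A N]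

/-- The vectors of degree `j` that are fixed by `u`. -/
def fixedPart (u : A) (gr : ℤ → Submodule ℂ M) (j : ℤ) : Submodule ℂ M where
  carrier := {x | x ∈ gr j ∧ u • x = x}
  zero_mem' := ⟨Submodule.zero_mem _, smul_zero _⟩
  add_mem' := by
    rintro x y ⟨hx, hx'⟩ ⟨hy, hy'⟩
    exact ⟨Submodule.add_mem _ hx hy, by rw [smul_add, hx', hy']⟩
  smul_mem' := by
    rintro z x ⟨hx, hx'⟩
    refine ⟨Submodule.smul_mem _ _ hx, ?_⟩
    have : u • z • x = z • u • x := by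
      rw [← algebraMap_smul A z x, ← algebraMap_smul A z (u • x), smul_smul, smul_smul,
        Algebra.commutes]
    rw [this, hx']

/-- A graded isomorphism preserves the dimensions of the fixed parts. -/
lemma GradedIso.finrank_fixedPart {grM : ℤ → Submodule ℂ M} {grN : ℤ → Submodule ℂ N}
    (h : GradedIso A grM grN) (u : A) (j : ℤ) :
    Module.finrank ℂ (fixedPart u grM j) = Module.finrank ℂ (fixedPart u grN j) := by
  obtain ⟨f, hf⟩ := h
  have : (fixedPart u grM j).map (f.restrictScalars ℂ).toLinearMap = fixedPart u grN j := by
    ext y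
    constructor
    · rintro ⟨x, hx, rfl⟩
      refine ⟨(hf j x).mp hx.1, ?_⟩
      change u • f x = f x
      rw [← map_smul, hx.2]
    · rintro ⟨h1, h2⟩
      refine ⟨f.symm y, ⟨(hf j _).mpr (by rwa [f.apply_symm_apply]), ?_⟩, f.apply_symm_apply y⟩
      rw [← map_smul, h2]
  rw [← this]
  exact (LinearEquiv.finrank_eq (LinearEquiv.submoduleMap (f.restrictScalars ℂ) _))

/-- Additivity of the dimensions of the fixed parts of a factor `K₂ / K₁`. -/
lemma finrank_fixedPart_factor [FiniteDimensional ℂ M] {u : A} (hu : u * u = u)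
    {gr : ℤ → Submodule ℂ M} {j : ℤ} (hgr : ∀ x ∈ gr j, u • x ∈ gr j)
    {K₁ K₂ : Submodule A M} (hK : K₁ ≤ K₂) :
    Module.finrank ℂ ↥(fixedPart u gr j ⊓ K₂.restrictScalars ℂ) =
      Module.finrank ℂ ↥(fixedPart u gr j ⊓ K₁.restrictScalars ℂ) +
      Module.finrank ℂ (fixedPart u (quotGrading (subGrading gr K₂) (K₁.submoduleOf K₂)) j) := by
  let Q := K₁.submoduleOf K₂
  let f₀ : ↥(fixedPart u gr j ⊓ K₂.restrictScalars ℂ) →ₗ[ℂ] ↥K₂ :=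
    { toFun := fun x => ⟨x.1, x.2.2⟩
      map_add' := fun _ _ => rfl
      map_smul' := fun _ _ => rfl }
  let f : ↥(fixedPart u gr j ⊓ K₂.restrictScalars ℂ) →ₗ[ℂ] (↥K₂ ⧸ Q) :=
    (Q.mkQ.restrictScalars ℂ) ∘ₗ f₀
  have hrange : LinearMap.range f = fixedPart u (quotGrading (subGrading gr K₂) Q) j := by
    ext y
    constructor
    · rintro ⟨x, rfl⟩
      refine ⟨⟨f₀ x, x.2.1.1, rfl⟩, ?_⟩
      change u • Q.mkQ (f₀ x) = Q.mkQ (f₀ x)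
      rw [← map_smul]
      congr 1
      exact Subtype.ext x.2.1.2
    · rintro ⟨⟨x, hx, rfl⟩, h2⟩
      -- A lift of a fixed class need not be fixed; applying the idempotent `u` to it gives a fixed
      -- lift of the same class and degree.
      refine ⟨⟨u • x.1, ⟨hgr _ hx, ?_⟩, K₂.smul_mem u x.2⟩, ?_⟩
      · rw [smul_smul, hu]
      · refine Eq.trans ?_ h2
        change Q.mkQ (u • x) = u • Q.mkQ x
        rw [map_smul]
  have hker : Module.finrank ℂ (LinearMap.ker f) =
      Module.finrank ℂ ↥(fixedPart u gr j ⊓ K₁.restrictScalars ℂ) := by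
    have hmem : ∀ x : ↥(fixedPart u gr j ⊓ K₂.restrictScalars ℂ),
        x ∈ LinearMap.ker f ↔ x.1 ∈ K₁ := by
      intro x
      rw [LinearMap.mem_ker]
      exact (Submodule.Quotient.mk_eq_zero Q)
    refine LinearEquiv.finrank_eq
      { toFun := fun x => ⟨x.1.1, x.1.2.1, (hmem x.1).mp x.2⟩
        invFun := fun x => ⟨⟨x.1, x.2.1, hK x.2.2⟩, (hmem _).mpr x.2.2⟩
        map_add' := fun _ _ => rfl
        map_smul' := fun _ _ => rfl
        left_inv := fun _ => rfl
        right_inv := fun _ => rfl }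
  rw [← hrange, ← hker, add_comm]
  exact (LinearMap.finrank_range_add_finrank_ker f).symm

lemma apply_last_eq_add_sum : ∀ {n : ℕ} (f : Fin (n + 1) → ℕ) (g : Fin n → ℕ),
    (∀ i, f i.succ = f i.castSucc + g i) → f (Fin.last n) = f 0 + ∑ i, g i
  | 0, f, g, _ => by simp
  | n + 1, f, g, h => by
    have ih := apply_last_eq_add_sum (fun i => f i.castSucc) (fun i => g i.castSucc)
      fun i => h i.castSucc
    rw [Fin.sum_univ_castSucc, ← add_assoc]
    exact (h (Fin.last n)).trans (congrArg (· + g (Fin.last n)) ih)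

/-- The graded dimension of a module is the sum of those of the factors of a series. -/
lemma GradedCompositionSeries.finrank_fixedPart [FiniteDimensional ℂ M] {u : A} (hu : u * u = u)
    {gr : ℤ → Submodule ℂ M} {j : ℤ} (hgr : ∀ x ∈ gr j, u • x ∈ gr j)
    (s : GradedCompositionSeries A gr) :
    Module.finrank ℂ (fixedPart u gr j) = ∑ i : Fin s.length, Module.finrank ℂ
      (fixedPart u (quotGrading (subGrading gr (s.sub i.succ))
        ((s.sub i.castSucc).submoduleOf (s.sub i.succ))) j) := by
  have h := apply_last_eq_add_sum
    (fun i => Module.finrank ℂ ↥(fixedPart u gr j ⊓ (s.sub i).restrictScalars ℂ)) _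
    fun i => finrank_fixedPart_factor hu hgr (s.lt i).le
  rw [s.bot, s.top, Submodule.restrictScalars_bot, Submodule.restrictScalars_top, inf_bot_eq,
    inf_top_eq, finrank_bot, zero_add] at h
  exact h

lemma isHomogeneousSub_bot (gr : ℤ → Submodule ℂ M) :
    IsHomogeneousSub gr (⊥ : Submodule A M) := by
  rw [IsHomogeneousSub, Submodule.restrictScalars_bot]
  exact bot_le

/-- Graded composition series exist. -/
lemma exists_gradedCompositionSeries [FiniteDimensional ℂ M] {gr : ℤ → Submodule ℂ M}
    (htop : IsHomogeneousSub gr (⊤ : Submodule A M)) :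
    Nonempty (GradedCompositionSeries A gr) := by
  let H := {K : Submodule A M // IsHomogeneousSub gr K}
  let φ : H → Submodule ℂ M := fun K => K.1.restrictScalars ℂ
  have hφ : StrictMono φ := fun K K' h => (Submodule.restrictScalars_lt (S := ℂ)).mpr h
  have : WellFoundedLT H := hφ.wellFoundedLT
  have : WellFoundedGT H := hφ.wellFoundedGT
  let _ : BoundedOrder H :=
    { top := ⟨⊤, htop⟩
      le_top := fun K => (le_top : K.1 ≤ ⊤)
      bot := ⟨⊥, isHomogeneousSub_bot gr⟩
      bot_le := fun K => (bot_le : ⊥ ≤ K.1) }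
  -- Finite dimension gives both chain conditions on homogeneous submodules, so the trivial chain
  -- refines to one with covering steps.
  obtain ⟨t, -, -, hbot, hlast⟩ :=
    LTSeries.exists_relSeries_covBy_and_head_eq_bot_and_last_eq_bot
      (RelSeries.singleton _ (⊥ : H) : LTSeries H)
  refine ⟨⟨t.length, fun i => (t i).1, fun i => (t i).2, congrArg Subtype.val hbot,
    congrArg Subtype.val hlast, fun i => (t.step i).1, fun i K hK h1 h2 => ?_⟩⟩
  have h := t.step i
  rcases h.eq_or_eq (show t i.castSucc ≤ ⟨K, hK⟩ from h1) h2 with h3 | h3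
  · exact Or.inl (congrArg Subtype.val h3)
  · exact Or.inr (congrArg Subtype.val h3)

end GradedDimension

/-! ### Weight spaces of standard modules and the Gram matrix. -/

namespace CellDatum

universe u v w

variable {A : Type u} [Ring A] [Algebra ℂ A] {𝒜 : ℤ → Submodule ℂ A}
variable {Λ : Type v} [PartialOrder Λ] [Fintype Λ] (D : CellDatum.{u, v, w} 𝒜 Λ)

instance (l : Λ) : FiniteDimensional ℂ (D.Standard l) :=
  inferInstanceAs (FiniteDimensional ℂ (D.Tab l → ℂ))

lemma idem_mul_c (l m : Λ) (S U : D.Tab l) :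
    D.idem m * D.c ⟨l, S, U⟩ = open Classical in if S.1 = m then D.c ⟨l, S, U⟩ else 0 := by
  classical
  obtain ⟨s, S⟩ := S
  obtain ⟨u, U⟩ := U
  rw [← D.idem_c l s u S U, ← mul_assoc, ← mul_assoc]
  split_ifs with h
  · subst h
    rw [(D.idem_complete.idem s).eq]
  · rw [D.idem_complete.ortho (Ne.symm h), zero_mul, zero_mul]

lemma c_mul_idem (l m : Λ) (S U : D.Tab l) :
    D.c ⟨l, S, U⟩ * D.idem m = open Classical in if U.1 = m then D.c ⟨l, S, U⟩ else 0 := by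
  classical
  obtain ⟨s, S⟩ := S
  obtain ⟨u, U⟩ := U
  rw [← D.idem_c l s u S U, mul_assoc]
  split_ifs with h
  · subst h
    rw [(D.idem_complete.idem u).eq]
  · rw [D.idem_complete.ortho h, mul_zero]

lemma c_top (l : Λ) : D.c ⟨l, D.top l, D.top l⟩ = D.idem l := D.c_highest l

lemma idem_smul_apply (l m : Λ) (x : D.Standard l) (V : D.Tab l) :
    (D.idem m • x) V = open Classical in if V.1 = m then x V else 0 := by
  classical
  rw [smul_apply, Finset.sum_eq_single V]
  · rw [r, idem_mul_c]
    split_ifs <;> simp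
  · intro S _ hS
    rw [r, idem_mul_c]
    split_ifs
    · rw [Module.Basis.repr_self, Finsupp.single_apply, if_neg, mul_zero]
      intro h'
      exact hS (Prod.mk.inj (eq_of_heq (Sigma.mk.inj h').2)).1
    · simp
  · simp

/-- The degree of a basis element of `A`. -/
def basisDeg (b : Σ l, (Σ m, D.T l m) × (Σ m, D.T l m)) : ℤ := D.deg b.2.1 + D.deg b.2.2

/-- The anti-involution swaps the two factors up to order and preserves the coefficient at the pair
`(top, top)`. -/
lemma gram_symm (l : Λ) (S U : D.Tab l) : D.gram l S U = D.gram l U S := by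
  have h : ∀ x, D.c.repr (D.star x) ⟨l, D.top l, D.top l⟩ =
      D.c.repr x ⟨l, D.top l, D.top l⟩ := by
    intro x
    have : (D.c.coord ⟨l, D.top l, D.top l⟩) ∘ₗ D.star = D.c.coord ⟨l, D.top l, D.top l⟩ := by
      classical
      refine D.c.ext ?_
      rintro ⟨m, Q, R⟩
      simp only [LinearMap.comp_apply, D.star_c, Module.Basis.coord_apply,
        Module.Basis.repr_self, Finsupp.single_apply]
      refine if_congr ?_ rfl rfl
      constructor <;>
      · intro h'
        obtain ⟨rfl, h2⟩ := Sigma.mk.inj h'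
        obtain ⟨h3, h4⟩ := Prod.mk.inj (eq_of_heq h2)
        rw [h3, h4]
    exact LinearMap.congr_fun this x
  rw [gram, ← h, D.star_mul, D.star_c, D.star_c]
  rfl

lemma gram_weight {l : Λ} {S U : D.Tab l} (h : D.gram l S U ≠ 0) : S.1 = U.1 := by
  by_contra hne
  apply h
  have h1 := D.c_mul_idem l S.1 (D.top l) S
  rw [if_pos rfl] at h1
  have h2 := D.idem_mul_c l S.1 U (D.top l)
  rw [if_neg (Ne.symm hne)] at h2
  rw [gram, ← h1, mul_assoc, h2, mul_zero]
  simp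

lemma mem_radical {l : Λ} {x : D.Standard l} :
    x ∈ D.radical l ↔ ∀ U, ∑ S, x S * D.gram l S U = 0 := by
  classical
  constructor
  · intro h U
    have := h (fun V => if V = U then 1 else 0)
    simpa [form] using this
  · intro h y
    rw [form, Finset.sum_comm]
    refine Finset.sum_eq_zero fun U _ => ?_
    have : ∀ S, x S * y U * D.gram l S U = y U * (x S * D.gram l S U) := fun S => by ring
    simp only [this, ← Finset.mul_sum, h, mul_zero]

/-- The dimension of the part of weight `m` and degree `j` of `L(l)`. -/
def simpleDim (l m : Λ) (j : ℤ) : ℕ :=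
  Module.finrank ℂ (fixedPart (D.idem m) (D.simpleGrading l) j)

lemma mem_fixedPart_standard {l m : Λ} {j : ℤ} {x : D.Standard l} :
    x ∈ fixedPart (D.idem m) (D.standardGrading l) j ↔
      ∀ S, x S ≠ 0 → S.1 = m ∧ D.deg S = j := by
  classical
  constructor
  · rintro ⟨h1, h2⟩ S hS
    refine ⟨?_, h1 S hS⟩
    by_contra hm
    apply hS
    rw [← h2, idem_smul_apply, if_neg hm]
  · intro h
    refine ⟨fun S hS => (h S hS).2, ?_⟩
    funext S
    rw [idem_smul_apply]
    split_ifs with hm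
    · rfl
    · by_contra h0
      exact hm (h S (Ne.symm h0)).1

lemma finrank_fixedPart_standard (l m : Λ) (j : ℤ) :
    Module.finrank ℂ (fixedPart (D.idem m) (D.standardGrading l) j) =
      (Finset.univ.filter fun S : D.T l m => D.deg ⟨m, S⟩ = j).card := by
  classical
  let I := {S : D.T l m // D.deg ⟨m, S⟩ = j}
  have e : (fixedPart (D.idem m) (D.standardGrading l) j) ≃ₗ[ℂ] (I → ℂ) :=
    { toFun := fun x S => x.1 ⟨m, S.1⟩
      invFun := fun f => ⟨fun S => if h : ∃ s : I, S = ⟨m, s.1⟩ then f h.choose else 0, by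
        refine D.mem_fixedPart_standard.mpr fun S hS => ?_
        split_ifs at hS with h
        · obtain ⟨s, rfl⟩ := h
          exact ⟨rfl, s.2⟩
        · exact absurd rfl hS⟩
      map_add' := fun _ _ => rfl
      map_smul' := fun _ _ => rfl
      left_inv := by
        intro x
        apply Subtype.ext
        funext S
        change (if h : ∃ s : I, S = ⟨m, s.1⟩ then _ else _) = _
        split_ifs with h
        · exact congrArg x.1 h.choose_spec.symm
        · by_contra h0
          obtain ⟨h1, h2⟩ := D.mem_fixedPart_standard.mp x.2 S (Ne.symm h0)
          obtain ⟨s, S⟩ := S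
          obtain rfl : s = m := h1
          exact h ⟨⟨S, h2⟩, rfl⟩
      right_inv := by
        intro f
        funext s
        change (if h : ∃ s' : I, (⟨m, s.1⟩ : D.Tab l) = ⟨m, s'.1⟩ then _ else _) = _
        have h : ∃ s' : I, (⟨m, s.1⟩ : D.Tab l) = ⟨m, s'.1⟩ := ⟨s, rfl⟩
        rw [dif_pos h]
        congr 1
        exact (Subtype.ext (eq_of_heq (Sigma.mk.inj h.choose_spec).2)).symm }
  rw [e.finrank_eq, Module.finrank_fintype_fun_eq_card, Fintype.card_subtype]

end CellDatum

end SoergelPath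

end

/-! ### Symmetry of the graded dimensions of the simple modules. -/

noncomputable section

open scoped LaurentPolynomial InnerProductSpace

namespace SoergelPath

namespace CellDatum

universe u v w

variable {A : Type u} [Ring A] [Algebra ℂ A] {𝒜 : ℤ → Submodule ℂ A}
variable {Λ : Type v} [PartialOrder Λ] [Fintype Λ] (D : CellDatum.{u, v, w} 𝒜 Λ)

section Graded

variable [GradedAlgebra 𝒜]

lemma basisDeg_of_repr_ne_zero {i : ℤ} {x : A} (hx : x ∈ 𝒜 i)
    {b : Σ l, (Σ m, D.T l m) × (Σ m, D.T l m)} (hb : D.c.repr x b ≠ 0) : D.basisDeg b = i := by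
  classical
  by_contra hne
  apply hb
  have key : (D.c.coord b) ∘ₗ GradedAlgebra.proj 𝒜 i = 0 := by
    refine D.c.ext fun b' => ?_
    have hb' : D.c b' ∈ 𝒜 (D.basisDeg b') := D.homogeneous b'.1 b'.2.1 b'.2.2
    rw [LinearMap.comp_apply, LinearMap.zero_apply, GradedAlgebra.proj_apply]
    by_cases h : D.basisDeg b' = i
    · rw [h] at hb'
      rw [DirectSum.decompose_of_mem_same _ hb', Module.Basis.coord_apply,
        Module.Basis.repr_self, Finsupp.single_apply, if_neg]
      rintro rfl
      exact hne h
    · rw [DirectSum.decompose_of_mem_ne _ hb' h, map_zero]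
  have h1 := LinearMap.congr_fun key x
  rw [LinearMap.comp_apply, GradedAlgebra.proj_apply, DirectSum.decompose_of_mem_same _ hx] at h1
  exact h1

/-- A nonzero homogeneous idempotent lies in the degree of its square, so its degree is zero. -/
lemma deg_top (l : Λ) : D.deg (D.top l) = 0 := by
  have h1 : D.idem l ∈ 𝒜 (D.deg (D.top l) + D.deg (D.top l)) := by
    rw [← c_top]
    exact D.homogeneous _ _ _
  have h2 := SetLike.mul_mem_graded h1 h1
  rw [(D.idem_complete.idem l).eq] at h2
  have h3 : D.idem l ≠ 0 := by
    rw [← c_top]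
    exact D.c.ne_zero _
  have := DirectSum.degree_eq_of_mem_mem 𝒜 h1 h2 h3
  omega

lemma idem_mem (l : Λ) : D.idem l ∈ 𝒜 0 := by
  have := D.homogeneous l (D.top l) (D.top l)
  rwa [c_top, deg_top] at this

lemma smul_mem_standardGrading {l : Λ} {i j : ℤ} {a : A} (ha : a ∈ 𝒜 i) {x : D.Standard l}
    (hx : x ∈ D.standardGrading l j) : a • x ∈ D.standardGrading l (i + j) := by
  intro V hV
  rw [smul_apply] at hV
  obtain ⟨S, -, hS⟩ := Finset.exists_ne_zero_of_sum_ne_zero hV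
  have h1 := hx S (left_ne_zero_of_mul hS)
  have h2 := D.basisDeg_of_repr_ne_zero
    (SetLike.mul_mem_graded ha (D.homogeneous l S (D.top l))) (right_ne_zero_of_mul hS)
  simp only [basisDeg, deg_top] at h2
  omega

lemma gram_deg {l : Λ} {S U : D.Tab l} (h : D.gram l S U ≠ 0) : D.deg S + D.deg U = 0 := by
  have h1 := D.basisDeg_of_repr_ne_zero (SetLike.mul_mem_graded
    (D.homogeneous l (D.top l) S) (D.homogeneous l U (D.top l))) h
  simp only [basisDeg, deg_top] at h1
  omega

/-- The block of the Gram matrix pairing degree `j` and degree `-j` in weight `m`. -/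
def gramBlock (l m : Λ) (j : ℤ) : Matrix (D.Tab l) (D.Tab l) ℂ :=
  open Classical in fun U S => if S.1 = m ∧ D.deg S = j then D.gram l S U else 0

lemma gramBlock_transpose (l m : Λ) (j : ℤ) :
    (D.gramBlock l m j).transpose = D.gramBlock l m (-j) := by
  classical
  ext S U
  simp only [Matrix.transpose_apply, gramBlock]
  by_cases h : D.gram l S U = 0
  · rw [D.gram_symm l U S, h, ite_self, ite_self]
  · have h1 := D.gram_weight h
    have h2 := D.gram_deg h
    rw [D.gram_symm l U S]
    refine if_congr ?_ rfl rfl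
    rw [h1]
    constructor <;> rintro ⟨h3, h4⟩ <;> exact ⟨h3, by omega⟩

lemma finrank_fixedPart_eq_add (l m : Λ) (j : ℤ) :
    Module.finrank ℂ (fixedPart (D.idem m) (D.standardGrading l) j) =
      Module.finrank ℂ ↥(fixedPart (D.idem m) (D.standardGrading l) j ⊓
        (D.radical l).restrictScalars ℂ) + D.simpleDim l m j := by
  let V := fixedPart (D.idem m) (D.standardGrading l) j
  let f : ↥V →ₗ[ℂ] D.Simple l := ((D.radical l).mkQ.restrictScalars ℂ) ∘ₗ V.subtype
  have hrange : LinearMap.range f = fixedPart (D.idem m) (D.simpleGrading l) j := by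
    ext y
    constructor
    · rintro ⟨x, rfl⟩
      refine ⟨⟨x.1, x.2.1, rfl⟩, ?_⟩
      change D.idem m • (D.radical l).mkQ x.1 = (D.radical l).mkQ x.1
      rw [← map_smul, x.2.2]
    · rintro ⟨⟨x, hx, rfl⟩, h2⟩
      have h3 := D.smul_mem_standardGrading (D.idem_mem m) hx
      rw [zero_add] at h3
      refine ⟨⟨D.idem m • x, h3, ?_⟩, ?_⟩
      · rw [smul_smul, (D.idem_complete.idem m).eq]
      · refine Eq.trans ?_ h2
        change (D.radical l).mkQ (D.idem m • x) = D.idem m • (D.radical l).mkQ x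
        rw [map_smul]
  have hker : Module.finrank ℂ (LinearMap.ker f) =
      Module.finrank ℂ ↥(V ⊓ (D.radical l).restrictScalars ℂ) := by
    have hmem : ∀ x : ↥V, x ∈ LinearMap.ker f ↔ x.1 ∈ D.radical l := by
      intro x
      rw [LinearMap.mem_ker]
      exact (Submodule.Quotient.mk_eq_zero _)
    refine LinearEquiv.finrank_eq
      { toFun := fun x => ⟨x.1.1, x.1.2, (hmem x.1).mp x.2⟩
        invFun := fun x => ⟨⟨x.1, x.2.1⟩, (hmem _).mpr x.2.2⟩
        map_add' := fun _ _ => rfl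
        map_smul' := fun _ _ => rfl
        left_inv := fun _ => rfl
        right_inv := fun _ => rfl }
  rw [simpleDim, ← hrange, ← hker, add_comm]
  exact (LinearMap.finrank_range_add_finrank_ker f).symm

/-- On the part of weight `m` and degree `j`, the radical is the kernel of this block, so the
quotient has dimension its rank. The block is extended by zero to all tableaux so that transposing
it exchanges `j` and `-j`. -/
lemma simpleDim_eq_rank (l m : Λ) (j : ℤ) : D.simpleDim l m j = (D.gramBlock l m j).rank := by
  classical
  have h1 := D.finrank_fixedPart_eq_add l m j
  let V := fixedPart (D.idem m) (D.standardGrading l) j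
  let g : D.Standard l →ₗ[ℂ] (D.Tab l → ℂ) := (D.gramBlock l m j).mulVecLin
  have hg : ∀ x U, g x U = ∑ S, (if S.1 = m ∧ D.deg S = j then D.gram l S U else 0) * x S :=
    fun x U => rfl
  let f : ↥V →ₗ[ℂ] (D.Tab l → ℂ) := g ∘ₗ V.subtype
  have hfx : ∀ x : ↥V, ∀ U, f x U = ∑ S, x.1 S * D.gram l S U := by
    intro x U
    change g x.1 U = _
    rw [hg]
    refine Finset.sum_congr rfl fun S _ => ?_
    by_cases h : x.1 S = 0
    · rw [h, mul_zero, zero_mul]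
    · rw [if_pos (D.mem_fixedPart_standard.mp x.2 S h), mul_comm]
  have hrange : LinearMap.range f = LinearMap.range g := by
    apply le_antisymm
    · rintro _ ⟨x, rfl⟩
      exact ⟨x.1, rfl⟩
    · rintro _ ⟨x, rfl⟩
      let x' : D.Standard l := fun S => if S.1 = m ∧ D.deg S = j then x S else 0
      have hx' : x' ∈ V := by
        refine D.mem_fixedPart_standard.mpr fun S hS => ?_
        by_contra h
        exact hS (if_neg h)
      refine ⟨⟨x', hx'⟩, ?_⟩
      funext U
      rw [hfx, hg]
      refine Finset.sum_congr rfl fun S _ => ?_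
      change (if S.1 = m ∧ D.deg S = j then x S else 0) * _ = _
      split_ifs
      · rw [mul_comm]
      · rw [zero_mul, zero_mul]
  have hker : Module.finrank ℂ (LinearMap.ker f) =
      Module.finrank ℂ ↥(V ⊓ (D.radical l).restrictScalars ℂ) := by
    have hmem : ∀ x : ↥V, x ∈ LinearMap.ker f ↔ x.1 ∈ D.radical l := by
      intro x
      rw [LinearMap.mem_ker, mem_radical]
      constructor
      · intro h U
        rw [← hfx, h]
        rfl
      · intro h
        funext U
        rw [hfx, h]
        rfl
    refine LinearEquiv.finrank_eq
      { toFun := fun x => ⟨x.1.1, x.1.2, (hmem x.1).mp x.2⟩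
        invFun := fun x => ⟨⟨x.1, x.2.1⟩, (hmem _).mpr x.2.2⟩
        map_add' := fun _ _ => rfl
        map_smul' := fun _ _ => rfl
        left_inv := fun _ => rfl
        right_inv := fun _ => rfl }
  have h2 := LinearMap.finrank_range_add_finrank_ker f
  have h3 : Module.finrank ℂ (LinearMap.range f) = (D.gramBlock l m j).rank := by
    rw [hrange]
    rfl
  have h4 := h2.trans h1
  rw [h3, hker, add_comm] at h4
  exact (Nat.add_left_cancel h4).symm

/-- The graded dimensions of the weight spaces of `L(l)` are symmetric. -/
lemma simpleDim_neg (l m : Λ) (j : ℤ) : D.simpleDim l m (-j) = D.simpleDim l m j := by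
  rw [simpleDim_eq_rank, simpleDim_eq_rank, ← gramBlock_transpose, Matrix.rank_transpose]

lemma simpleDim_le (l m : Λ) (j : ℤ) : D.simpleDim l m j ≤
    (Finset.univ.filter fun S : D.T l m => D.deg ⟨m, S⟩ = j).card := by
  rw [← finrank_fixedPart_standard, finrank_fixedPart_eq_add]
  exact Nat.le_add_left _ _

lemma exists_of_simpleDim_ne_zero {l m : Λ} {j : ℤ} (h : D.simpleDim l m j ≠ 0) :
    ∃ S : D.T l m, D.deg ⟨m, S⟩ = j := by
  have h1 := D.simpleDim_le l m j
  obtain ⟨S, hS⟩ := Finset.card_pos.mp (by omega : 0 < (Finset.univ.filter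
    fun S : D.T l m => D.deg ⟨m, S⟩ = j).card)
  exact ⟨S, (Finset.mem_filter.mp hS).2⟩

lemma deg_highest (l : Λ) (S : D.T l l) : D.deg ⟨l, S⟩ = 0 := by
  have : S = (D.highest l).default := (D.highest l).uniq S
  rw [this]
  exact D.deg_top l

lemma card_highest (l : Λ) (j : ℤ) :
    (Finset.univ.filter fun S : D.T l l => D.deg ⟨l, S⟩ = j).card = if j = 0 then 1 else 0 := by
  classical
  have := D.highest l
  simp only [deg_highest]
  split_ifs with h
  · rw [h]
    simp
  · rw [Finset.filter_false_of_mem fun _ _ => Ne.symm h, Finset.card_empty]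

/-- The weight `l` part of the standard module is the line of the generator, which has degree zero
and is not in the radical. -/
lemma simpleDim_self (l : Λ) (j : ℤ) : D.simpleDim l l j = if j = 0 then 1 else 0 := by
  have h1 := D.finrank_fixedPart_eq_add l l j
  have h2 : fixedPart (D.idem l) (D.standardGrading l) j ⊓ (D.radical l).restrictScalars ℂ = ⊥ := by
    rw [eq_bot_iff]
    rintro x ⟨hx, hx'⟩
    have hx1 : x = x (D.top l) • D.topVec l := by
      classical
      funext S
      change x S = x (D.top l) * (if S = D.top l then 1 else 0)
      split_ifs with h
      · rw [h, mul_one]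
      · rw [mul_zero]
        by_contra h0
        obtain ⟨h3, -⟩ := D.mem_fixedPart_standard.mp hx S h0
        obtain ⟨s, S⟩ := S
        obtain rfl : s = l := h3
        apply h
        rw [(D.highest s).uniq S]
        rfl
    have h0 : x (D.top l) = 0 := by
      by_contra h0
      apply D.topVec_notMem_radical l
      have h3 : x ∈ (D.radical l).restrictScalars ℂ := hx'
      rw [hx1] at h3
      exact (Submodule.smul_mem_iff _ h0).mp h3
    rw [h0, zero_smul] at hx1
    exact hx1
  rw [h2, finrank_bot, zero_add, finrank_fixedPart_standard, card_highest] at h1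
  exact h1.symm

end Graded

end CellDatum

end SoergelPath

end

/-! ### Graded composition factors of standard modules. -/

noncomputable section

open scoped LaurentPolynomial InnerProductSpace

namespace SoergelPath

namespace CellDatum

universe u v w

variable {A : Type u} [Ring A] [Algebra ℂ A] {𝒜 : ℤ → Submodule ℂ A}
variable {Λ : Type v} [PartialOrder Λ] [Fintype Λ] (D : CellDatum.{u, v, w} 𝒜 Λ)

/-- The homogeneous component of degree `j` of an element of `Δ(l)`. -/
def component (l : Λ) (j : ℤ) : D.Standard l →ₗ[ℂ] D.Standard l where
  toFun x S := if D.deg S = j then x S else 0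
  map_add' x y := by
    funext S
    change (if D.deg S = j then x S + y S else 0) =
      (if D.deg S = j then x S else 0) + (if D.deg S = j then y S else 0)
    split_ifs <;> simp
  map_smul' z x := by
    funext S
    change (if D.deg S = j then z * x S else 0) = z * (if D.deg S = j then x S else 0)
    split_ifs <;> simp

lemma component_apply {l : Λ} (j : ℤ) (x : D.Standard l) (S : D.Tab l) :
    D.component l j x S = if D.deg S = j then x S else 0 := rfl

lemma component_mem {l : Λ} (j : ℤ) (x : D.Standard l) :
    D.component l j x ∈ D.standardGrading l j := by
  intro S hS
  by_contra h
  exact hS (if_neg h)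

lemma component_of_mem {l : Λ} {i : ℤ} {x : D.Standard l} (hx : x ∈ D.standardGrading l i)
    (j : ℤ) : D.component l j x = if i = j then x else 0 := by
  funext S
  rw [component_apply]
  by_cases h : x S = 0
  · rw [h, ite_self]
    split_ifs
    · exact h.symm
    · rfl
  · rw [hx S h]
    split_ifs <;> rfl

lemma sum_component {l : Λ} (x : D.Standard l) :
    ∑ j ∈ Finset.univ.image (D.deg (l := l)), D.component l j x = x := by
  classical
  funext S
  have h : ∀ s : Finset ℤ, (∑ j ∈ s, D.component l j x) S = ∑ j ∈ s, D.component l j x S :=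
    fun s => Finset.sum_apply S s (fun j => D.component l j x)
  rw [h]
  simp only [component_apply]
  rw [Finset.sum_ite_eq, if_pos (Finset.mem_image_of_mem _ (Finset.mem_univ S))]

lemma isHomogeneousSub_iff {l : Λ} {K : Submodule A (D.Standard l)} :
    IsHomogeneousSub (D.standardGrading l) K ↔ ∀ j, ∀ x ∈ K, D.component l j x ∈ K := by
  constructor
  · intro h j x hx
    have hx' : x ∈ ⨆ i, K.restrictScalars ℂ ⊓ D.standardGrading l i := h hx
    refine Submodule.iSup_induction _ (motive := fun x => D.component l j x ∈ K) hx' ?_ ?_ ?_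
    · rintro i y ⟨hy, hy'⟩
      rw [D.component_of_mem hy']
      split_ifs
      · exact hy
      · exact K.zero_mem
    · rw [map_zero]
      exact K.zero_mem
    · intro y z hy hz
      rw [map_add]
      exact K.add_mem hy hz
  · intro h x hx
    rw [← D.sum_component x]
    refine Submodule.sum_mem _ fun j _ => ?_
    exact Submodule.mem_iSup_of_mem j ⟨h j x hx, D.component_mem j x⟩

lemma isHomogeneousSub_top (l : Λ) :
    IsHomogeneousSub (D.standardGrading l) (⊤ : Submodule A (D.Standard l)) :=
  D.isHomogeneousSub_iff.mpr fun _ _ _ => Submodule.mem_top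

/-- The element `∑ z_V c_{VU}` of `A`. -/
def cellElement (l : Λ) (U : D.Tab l) : D.Standard l →ₗ[ℂ] A where
  toFun z := ∑ V, z V • D.c ⟨l, V, U⟩
  map_add' z z' := by
    rw [← Finset.sum_add_distrib]
    exact Finset.sum_congr rfl fun V _ => add_smul _ _ _
  map_smul' t z := by
    rw [RingHom.id_apply, Finset.smul_sum]
    exact Finset.sum_congr rfl fun V _ => mul_smul _ _ _

lemma cellElement_apply (l : Λ) (U : D.Tab l) (z : D.Standard l) :
    D.cellElement l U z = ∑ V, z V • D.c ⟨l, V, U⟩ := rfl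

lemma mul_cellElement_sub_mem (l : Λ) (U : D.Tab l) (a : A) (z : D.Standard l) :
    a * D.cellElement l U z - D.cellElement l U (a • z) ∈ D.above l := by
  have : a * D.cellElement l U z - D.cellElement l U (a • z) =
      ∑ S, z S • (a * D.c ⟨l, S, U⟩ - ∑ V, D.r l a S V • D.c ⟨l, V, U⟩) := by
    simp only [cellElement_apply, smul_apply, smul_sub, Finset.sum_sub_distrib, Finset.mul_sum,
      mul_smul_comm, Finset.smul_sum, Finset.sum_smul, mul_smul]
    rw [Finset.sum_comm]
  rw [this]
  exact Submodule.sum_mem _ fun S _ => Submodule.smul_mem _ _ (D.mul_c l a S U)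

/-- The basis vector `c_S` of `Δ(l)`. -/
def basisVec (l : Λ) (S : D.Tab l) : D.Standard l :=
  open Classical in fun V => if V = S then 1 else 0

lemma cellElement_basisVec (l : Λ) (U S : D.Tab l) :
    D.cellElement l U (D.basisVec l S) = D.c ⟨l, S, U⟩ := by
  classical
  rw [cellElement_apply, Finset.sum_eq_single S]
  · rw [basisVec, if_pos rfl, one_smul]
  · intro V _ hV
    rw [basisVec, if_neg hV, zero_smul]
  · simp

lemma c_smul_top (l : Λ) (S : D.Tab l) :
    D.c ⟨l, S, D.top l⟩ • D.basisVec l (D.top l) = D.basisVec l S := by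
  classical
  funext V
  rw [smul_apply, Finset.sum_eq_single (D.top l)]
  · have h := D.c_mul_idem l l S (D.top l)
    rw [if_pos (show (D.top l).1 = l from rfl)] at h
    rw [r, c_top, h, Module.Basis.repr_self, Finsupp.single_apply, basisVec, if_pos rfl, one_mul,
      basisVec]
    refine if_congr ⟨fun h' => ?_, fun h' => by rw [h']⟩ rfl rfl
    exact (Prod.mk.inj (eq_of_heq (Sigma.mk.inj h').2)).1.symm
  · intro W _ hW
    rw [basisVec, if_neg hW, zero_mul]
  · simp

lemma eq_top_of_top_mem {l : Λ} {K : Submodule A (D.Standard l)}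
    (h : D.basisVec l (D.top l) ∈ K) : K = ⊤ := by
  classical
  rw [eq_top_iff]
  intro x _
  have hx : x = ∑ S, x S • D.basisVec l S := by
    funext V
    have h' : ∀ s : Finset (D.Tab l), (∑ S ∈ s, x S • D.basisVec l S) V =
        ∑ S ∈ s, (x S • D.basisVec l S) V :=
      fun s => Finset.sum_apply V s (fun S => x S • D.basisVec l S)
    rw [h']
    change x V = ∑ S, x S * (if V = S then 1 else 0)
    rw [Finset.sum_eq_single V]
    · rw [if_pos rfl, mul_one]
    · intro S _ hS
      rw [if_neg (Ne.symm hS), mul_zero]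
    · simp
  rw [hx]
  refine Submodule.sum_mem _ fun S _ => Submodule.smul_of_tower_mem _ _ ?_
  rw [← c_smul_top]
  exact K.smul_mem _ h

/-- The image has weight `l`, hence lies on the line of the generator. The coefficient is a value of
the form, which is why a vector outside the radical generates the module. -/
lemma c_top_smul_apply (l : Λ) (S : D.Tab l) (x : D.Standard l) :
    D.c ⟨l, D.top l, S⟩ • x = (∑ V, x V * D.gram l V S) • D.basisVec l (D.top l) := by
  classical
  have hidem : D.idem l • (D.c ⟨l, D.top l, S⟩ • x) = D.c ⟨l, D.top l, S⟩ • x := by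
    have h := D.idem_mul_c l l (D.top l) S
    rw [if_pos (show (D.top l).1 = l from rfl)] at h
    rw [smul_smul, h]
  funext W
  change _ = (∑ V, x V * D.gram l V S) * (if W = D.top l then 1 else 0)
  split_ifs with hW
  · subst hW
    rw [smul_apply, mul_one]
    refine Finset.sum_congr rfl fun V _ => ?_
    rw [D.gram_symm l V S]
    rfl
  · rw [mul_zero, ← hidem, idem_smul_apply, if_neg]
    intro h
    obtain ⟨w, W⟩ := W
    obtain rfl : w = l := h
    apply hW
    rw [(D.highest w).uniq W]
    rfl

/-- Every proper submodule of `Δ(l)` lies in the radical. -/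
lemma le_radical {l : Λ} {K : Submodule A (D.Standard l)} (hK : K ≠ ⊤) : K ≤ D.radical l := by
  intro x hx
  rw [mem_radical]
  intro U
  by_contra h
  apply hK
  apply D.eq_top_of_top_mem
  have h1 := K.smul_mem (D.c ⟨l, D.top l, U⟩) hx
  rw [c_top_smul_apply] at h1
  have h2 := Submodule.smul_of_tower_mem K (∑ V, x V * D.gram l V U)⁻¹ h1
  rwa [smul_smul, inv_mul_cancel₀ h, one_smul] at h2

lemma radical_ne_top (l : Λ) : D.radical l ≠ ⊤ := by
  intro h
  apply D.topVec_notMem_radical l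
  rw [h]
  exact Submodule.mem_top

lemma cellElement_mem {l : Λ} (U : D.Tab l) {i : ℤ} {z : D.Standard l}
    (hz : z ∈ D.standardGrading l i) : D.cellElement l U z ∈ 𝒜 (i + D.deg U) := by
  rw [cellElement_apply]
  refine Submodule.sum_mem _ fun V _ => ?_
  by_cases h : z V = 0
  · rw [h, zero_smul]
    exact Submodule.zero_mem _
  · rw [← hz V h]
    exact Submodule.smul_mem _ _ (D.homogeneous l V U)

section Graded

variable [GradedAlgebra 𝒜]

/-- The map that sends `z` to the action of its cell element on `x` is homogeneous of degree `D.deg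
U + k`. -/
lemma component_cellElement_smul {l n : Λ} (U : D.Tab n) {k : ℤ} {x : D.Standard l}
    (hx : x ∈ D.standardGrading l k) (z : D.Standard n) (j : ℤ) :
    D.component l j (D.cellElement n U z • x) =
      D.cellElement n U (D.component n (j - (D.deg U + k)) z) • x := by
  classical
  have hmem : ∀ i, D.cellElement n U (D.component n i z) • x ∈
      D.standardGrading l (i + D.deg U + k) := fun i =>
    D.smul_mem_standardGrading (D.cellElement_mem U (D.component_mem i z)) hx
  conv_lhs => rw [← D.sum_component z]
  rw [map_sum, Finset.sum_smul, map_sum]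
  simp only [D.component_of_mem (hmem _)]
  have hiff : ∀ i, i + D.deg U + k = j ↔ j - (D.deg U + k) = i := fun i => by omega
  simp only [hiff]
  rw [Finset.sum_ite_eq]
  split_ifs with h
  · rfl
  · have h0 : D.component n (j - (D.deg U + k)) z = 0 := by
      funext S
      rw [component_apply, if_neg]
      · rfl
      · intro hS
        exact h (hS ▸ Finset.mem_image_of_mem _ (Finset.mem_univ S))
    rw [h0, map_zero, zero_smul]

/-- A tableau of degree `-j` pairs only with degree `j`, so pairing it with `x` and with the
component of degree `j` gives the same value; any other tableau pairs to zero with this component.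
-/
lemma isHomogeneousSub_radical (l : Λ) :
    IsHomogeneousSub (D.standardGrading l) (D.radical l) := by
  rw [isHomogeneousSub_iff]
  intro j x hx
  rw [mem_radical] at hx ⊢
  intro U
  by_cases hU : D.deg U = -j
  · rw [← hx U]
    refine Finset.sum_congr rfl fun S _ => ?_
    rw [component_apply]
    split_ifs with h
    · rfl
    · by_cases hg : D.gram l S U = 0
      · rw [hg, mul_zero, mul_zero]
      · have := D.gram_deg hg
        omega
  · refine Finset.sum_eq_zero fun S _ => ?_
    rw [component_apply]
    split_ifs with h
    · by_cases hg : D.gram l S U = 0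
      · rw [hg, mul_zero]
      · have := D.gram_deg hg
        omega
    · rw [zero_mul]

/-- A factor `K₂ / K₁` of `Δ(l)` without proper homogeneous submodules is a shift of some
`L(n)`. -/
lemma exists_gradedIso_simple {l : Λ} {K₁ K₂ : Submodule A (D.Standard l)}
    (h₁ : IsHomogeneousSub (D.standardGrading l) K₁)
    (h₂ : IsHomogeneousSub (D.standardGrading l) K₂) (hlt : K₁ < K₂)
    (hs : ∀ K : Submodule A (D.Standard l), IsHomogeneousSub (D.standardGrading l) K →
      K₁ ≤ K → K ≤ K₂ → K = K₁ ∨ K = K₂) :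
    ∃ (n : Λ) (k : ℤ), GradedIso A
      (quotGrading (subGrading (D.standardGrading l) K₂) (K₁.submoduleOf K₂))
      (shift k (D.simpleGrading n)) := by
  classical
  rw [isHomogeneousSub_iff] at h₁ h₂
  -- These are the cells that act nontrivially on the factor; there are some because the idempotents
  -- sum to 1. For a maximal such `n`, everything above `n` acts by zero.
  let X : Set Λ := {n | ∃ S U : D.Tab n, ∃ x ∈ K₂, D.c ⟨n, S, U⟩ • x ∉ K₁}
  have hX : X.Nonempty := by
    obtain ⟨x, hx2, hx1⟩ := SetLike.exists_of_lt hlt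
    by_contra hne
    rw [Set.not_nonempty_iff_eq_empty] at hne
    apply hx1
    rw [← one_smul A x, ← D.idem_complete.complete, Finset.sum_smul]
    refine Submodule.sum_mem _ fun n _ => ?_
    by_contra hn
    have : n ∈ X := ⟨D.top n, D.top n, x, hx2, by rwa [c_top]⟩
    rw [hne] at this
    exact this
  obtain ⟨n, ⟨S, U, x₀, hx₀, hx₀'⟩, hmax⟩ := (Set.toFinite X).exists_maximal hX
  have habove : ∀ y ∈ D.above n, ∀ x ∈ K₂, y • x ∈ K₁ := by
    intro y hy x hx
    induction hy using Submodule.span_induction with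
    | mem y hy =>
      obtain ⟨m, Q, R, hm, rfl⟩ := hy
      by_contra hne
      exact hm.not_ge (hmax ⟨Q, R, x, hx, hne⟩ hm.le)
    | zero => rw [zero_smul]; exact K₁.zero_mem
    | add y y' _ _ hy hy' => rw [add_smul]; exact K₁.add_mem hy hy'
    | smul t y _ hy => rw [smul_assoc]; exact Submodule.smul_of_tower_mem _ _ hy
  -- Some homogeneous component of `x₀` is also not sent into `K₁`.
  obtain ⟨j, x, hxj, hx2, hx1⟩ : ∃ j, ∃ x ∈ D.standardGrading l j, x ∈ K₂ ∧
      D.c ⟨n, S, U⟩ • x ∉ K₁ := by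
    by_contra hne
    apply hx₀'
    rw [← D.sum_component x₀, Finset.smul_sum]
    refine Submodule.sum_mem _ fun j _ => ?_
    by_contra hj
    exact hne ⟨j, _, D.component_mem j x₀, h₂ j _ hx₀, hj⟩
  have hlin : ∀ (a : A) (z : D.Standard n),
      a • (D.cellElement n U z • x) - D.cellElement n U (a • z) • x ∈ K₁ := by
    intro a z
    rw [smul_smul, ← sub_smul]
    exact habove _ (D.mul_cellElement_sub_mem n U a z) x hx2
  have hK2 : ∀ z : D.Standard n, D.cellElement n U z • x ∈ K₂ := fun z => K₂.smul_mem _ hx2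
  let Q := K₁.submoduleOf K₂
  -- Modulo higher cells, the column `U` of the cell `n` is a copy of the standard module. Since
  -- higher cells kill the factor, acting on `x` is a homomorphism to it.
  let ψ : D.Standard n →ₗ[A] (↥K₂ ⧸ Q) :=
    { toFun := fun z => Q.mkQ ⟨D.cellElement n U z • x, hK2 z⟩
      map_add' := fun z z' => by
        rw [← map_add]
        congr 1
        apply Subtype.ext
        change D.cellElement n U (z + z') • x = D.cellElement n U z • x + D.cellElement n U z' • x
        rw [map_add, add_smul]
      map_smul' := fun a z => by
        rw [RingHom.id_apply, ← map_smul]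
        apply Eq.symm
        rw [← sub_eq_zero, ← map_sub]
        exact (Submodule.Quotient.mk_eq_zero Q).mpr (hlin a z) }
  have hψ : ∀ z, ψ z = Q.mkQ ⟨D.cellElement n U z • x, hK2 z⟩ := fun z => rfl
  have hψ_eq : ∀ (z : D.Standard n) (y : ↥K₂), Q.mkQ y = ψ z ↔
      y.1 - D.cellElement n U z • x ∈ K₁ := by
    intro z y
    rw [hψ, ← sub_eq_zero, ← map_sub]
    exact Submodule.Quotient.mk_eq_zero Q
  -- The image of a homogeneous submodule pulls back to a homogeneous one between `K₁` and `K₂`, so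
  -- it is zero or everything.
  have himage : ∀ R : Submodule A (D.Standard n), IsHomogeneousSub (D.standardGrading n) R →
      R ≤ LinearMap.ker ψ ∨ R.map ψ = ⊤ := by
    intro R hR
    rw [isHomogeneousSub_iff] at hR
    let K : Submodule A (D.Standard l) := ((R.map ψ).comap Q.mkQ).map K₂.subtype
    have hKmem : ∀ y, y ∈ K ↔ y ∈ K₂ ∧ ∃ z ∈ R, y - D.cellElement n U z • x ∈ K₁ := by
      intro y
      constructor
      · rintro ⟨y', ⟨z, hz, hz'⟩, rfl⟩
        exact ⟨y'.2, z, hz, (hψ_eq z y').mp hz'.symm⟩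
      · rintro ⟨hy, z, hz, hz'⟩
        exact ⟨⟨y, hy⟩, ⟨z, hz, ((hψ_eq z ⟨y, hy⟩).mpr hz').symm⟩, rfl⟩
    have hKhom : IsHomogeneousSub (D.standardGrading l) K := by
      rw [isHomogeneousSub_iff]
      intro i y hy
      rw [hKmem] at hy ⊢
      obtain ⟨hy2, z, hz, hz'⟩ := hy
      refine ⟨h₂ i y hy2, D.component n (i - (D.deg U + j)) z, hR _ z hz, ?_⟩
      rw [← D.component_cellElement_smul U hxj, ← map_sub]
      exact h₁ i _ hz'
    rcases hs K hKhom (fun y hy => (hKmem y).mpr ⟨hlt.le hy, 0, R.zero_mem, by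
      rwa [map_zero, zero_smul, sub_zero]⟩) (fun y hy => ((hKmem y).mp hy).1) with h | h
    · left
      intro z hz
      have h3 : D.cellElement n U z • x ∈ K := (hKmem _).mpr ⟨hK2 z, z, hz, by
        rw [sub_self]; exact K₁.zero_mem⟩
      rw [h] at h3
      rw [LinearMap.mem_ker, hψ]
      exact (Submodule.Quotient.mk_eq_zero Q).mpr h3
    · right
      rw [eq_top_iff]
      intro q _
      obtain ⟨y, rfl⟩ := Q.mkQ_surjective q
      have h3 : y.1 ∈ K := h.ge y.2
      obtain ⟨-, z, hz, hz'⟩ := (hKmem _).mp h3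
      exact ⟨z, hz, ((hψ_eq z y).mpr hz').symm⟩
  have hker_ne : LinearMap.ker ψ ≠ ⊤ := by
    intro h
    have h3 : D.basisVec n S ∈ LinearMap.ker ψ := h ▸ Submodule.mem_top
    rw [LinearMap.mem_ker, hψ] at h3
    have h4 : D.cellElement n U (D.basisVec n S) • x ∈ K₁ :=
      (Submodule.Quotient.mk_eq_zero Q).mp h3
    rw [cellElement_basisVec] at h4
    exact hx1 h4
  have hsurj : Function.Surjective ψ := by
    rcases himage ⊤ (D.isHomogeneousSub_top n) with h | h
    · exact absurd (top_le_iff.mp h) hker_ne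
    · rw [← LinearMap.range_eq_top, ← Submodule.map_top]
      exact h
  -- The kernel is proper, hence inside the radical. If the radical were not killed it would map
  -- onto the factor, and together with the kernel it would be the whole standard module.
  have hker : LinearMap.ker ψ = D.radical n := by
    apply le_antisymm (D.le_radical hker_ne)
    rcases himage _ (D.isHomogeneousSub_radical n) with h | h
    · exact h
    · exfalso
      apply D.radical_ne_top n
      rw [eq_top_iff]
      intro z _
      have h3 : ψ z ∈ (D.radical n).map ψ := h ▸ Submodule.mem_top
      obtain ⟨z', hz', h4⟩ := h3
      have h5 : z - z' ∈ LinearMap.ker ψ := by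
        rw [LinearMap.mem_ker, map_sub, h4, sub_self]
      have h6 := (D.radical n).add_mem (D.le_radical hker_ne h5) hz'
      rwa [sub_add_cancel] at h6
  let e : D.Simple n ≃ₗ[A] (↥K₂ ⧸ Q) :=
    (Submodule.quotEquivOfEq _ _ hker.symm).trans (ψ.quotKerEquivOfSurjective hsurj)
  have he : ∀ z, e ((D.radical n).mkQ z) = ψ z := fun z => rfl
  refine ⟨n, D.deg U + j, e.symm, fun i q => ?_⟩
  obtain ⟨q, rfl⟩ := e.surjective q
  rw [e.symm_apply_apply]
  obtain ⟨z, rfl⟩ := (D.radical n).mkQ_surjective q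
  rw [he]
  constructor
  · rintro ⟨y, hy, hyz⟩
    have h3 : y.1 - D.cellElement n U z • x ∈ K₁ := (hψ_eq z y).mp hyz
    have h4 := h₁ i _ h3
    have hy' : y.1 ∈ D.standardGrading l i := hy
    rw [map_sub, D.component_of_mem hy', if_pos rfl, D.component_cellElement_smul U hxj,
      ← hψ_eq] at h4
    refine ⟨D.component n (i - (D.deg U + j)) z, D.component_mem _ _, ?_⟩
    apply e.injective
    change e ((D.radical n).mkQ _) = e ((D.radical n).mkQ _)
    rw [he, he, ← h4]
    exact hyz
  · rintro ⟨z', hz', h3⟩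
    have h4 : ψ z' = ψ z := by
      rw [← he, ← he]
      exact congrArg e h3
    rw [← h4]
    refine ⟨⟨D.cellElement n U z' • x, hK2 z'⟩, ?_, rfl⟩
    have h5 := D.smul_mem_standardGrading (D.cellElement_mem U hz') hxj
    have h6 : i - (D.deg U + j) + D.deg U + j = i := by omega
    rw [h6] at h5
    exact h5

/-- The graded modules `L(n)⟨k⟩` are pairwise non-isomorphic. -/
lemma eq_of_simpleDim_eq {n n' : Λ} {k k' : ℤ}
    (h : ∀ m j, D.simpleDim n m (j - k) = D.simpleDim n' m (j - k')) : n = n' ∧ k = k' := by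
  have h1 : D.simpleDim n' n (k - k') ≠ 0 := by
    rw [← h, sub_self, simpleDim_self, if_pos rfl]
    exact one_ne_zero
  have h2 : D.simpleDim n n' (k' - k) ≠ 0 := by
    rw [h, sub_self, simpleDim_self, if_pos rfl]
    exact one_ne_zero
  -- Weights of a simple module lie below its label, so the labels bound each other; the degree of
  -- the one-dimensional top weight space then fixes the shift.
  obtain ⟨S, -⟩ := D.exists_of_simpleDim_ne_zero h1
  obtain ⟨S', -⟩ := D.exists_of_simpleDim_ne_zero h2
  obtain rfl := le_antisymm (D.le_of_T S) (D.le_of_T S')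
  rw [simpleDim_self] at h1
  refine ⟨rfl, ?_⟩
  by_contra hne
  exact h1 (if_neg (sub_ne_zero.mpr hne))

open Classical in
/-- The graded dimensions of the weight spaces of `Δ(l)` in terms of decomposition numbers. -/
lemma exists_factors (l : Λ) : ∃ (t : ℕ) (ν : Fin t → Λ) (κ : Fin t → ℤ),
    (∀ n k, D.decMult l n k = (Finset.univ.filter fun i => ν i = n ∧ κ i = k).card) ∧
    ∀ m j, (Finset.univ.filter fun S : D.T l m => D.deg ⟨m, S⟩ = j).card =
      ∑ i, D.simpleDim (ν i) m (j - κ i) := by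
  have hne : Nonempty (GradedCompositionSeries A (D.standardGrading l)) :=
    exists_gradedCompositionSeries (D.isHomogeneousSub_top l)
  -- This is the very series that `gradedMult` chooses, so no comparison of series is needed.
  let s := hne.some
  have hex : ∀ i : Fin s.length, ∃ (n : Λ) (k : ℤ),
      s.FactorIso i (shift k (D.simpleGrading n)) := fun i =>
    D.exists_gradedIso_simple (s.homogeneous _) (s.homogeneous _) (s.lt i) (s.simple i)
  choose ν κ hνκ using hex
  have hdim : ∀ i (n : Λ) (k : ℤ), s.FactorIso i (shift k (D.simpleGrading n)) → ∀ m j,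
      Module.finrank ℂ (fixedPart (D.idem m) (quotGrading
        (subGrading (D.standardGrading l) (s.sub i.succ))
        ((s.sub i.castSucc).submoduleOf (s.sub i.succ))) j) = D.simpleDim n m (j - k) :=
    fun i n k h m j => GradedIso.finrank_fixedPart h (D.idem m) j
  refine ⟨s.length, ν, κ, fun n k => ?_, fun m j => ?_⟩
  · rw [decMult, gradedMult, dif_pos hne]
    refine congrArg Finset.card ?_
    ext i
    simp only [Finset.mem_filter, Finset.mem_univ, true_and]
    constructor
    · intro h
      exact D.eq_of_simpleDim_eq fun m j => by rw [← hdim i _ _ (hνκ i), ← hdim i _ _ h]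
    · rintro ⟨rfl, rfl⟩
      exact hνκ i
  · rw [← finrank_fixedPart_standard, s.finrank_fixedPart (D.idem_complete.idem m).eq]
    · exact Finset.sum_congr rfl fun i _ => hdim i _ _ (hνκ i) m j
    · intro x hx
      have := D.smul_mem_standardGrading (D.idem_mem m) hx
      rwa [zero_add] at this

end Graded

end CellDatum

end SoergelPath

end

/-! ### Characters as Laurent polynomials and the decomposition matrix. -/

noncomputable section

open scoped LaurentPolynomial InnerProductSpace

namespace SoergelPath

namespace CellDatum

universe u v w

variable {A : Type u} [Ring A] [Algebra ℂ A] {𝒜 : ℤ → Submodule ℂ A}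
variable {Λ : Type v} [PartialOrder Λ] [Fintype Λ] (D : CellDatum.{u, v, w} 𝒜 Λ)

open LaurentPolynomial

lemma coeff_sum_smul_T (s : Finset ℤ) (f : ℤ → ℤ) (hf : ∀ k, f k ≠ 0 → k ∈ s) (k : ℤ) :
    (∑ i ∈ s, f i • (LaurentPolynomial.T i : ℤ[T;T⁻¹])).coeff k = f k := by
  rw [AddMonoidAlgebra.coeff_sum, Finset.sum_apply']
  simp only [AddMonoidAlgebra.coeff_smul, Finsupp.smul_apply, T_apply, smul_eq_mul, mul_ite,
    mul_one, mul_zero]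
  rw [Finset.sum_ite_eq']
  split_ifs with h
  · rfl
  · by_contra h0
    exact h (hf k (Ne.symm h0))

/-- The graded decomposition number `d_{lm}(t)` with integer coefficients. -/
def decPoly (l m : Λ) : ℤ[T;T⁻¹] :=
  ∑ k ∈ Finset.univ.image fun S : D.Tab l => D.deg S - D.deg (D.top m),
    (D.decMult l m k : ℤ) • LaurentPolynomial.T k

/-- The graded character of the weight space of weight `m` of `Δ(l)`. -/
def standardChar (l m : Λ) : ℤ[T;T⁻¹] := ∑ S : D.T l m, LaurentPolynomial.T (D.deg ⟨m, S⟩)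

/-- The graded character of the weight space of weight `m` of `L(n)`. -/
def simpleChar (n m : Λ) : ℤ[T;T⁻¹] :=
  ∑ j ∈ Finset.univ.image fun S : D.T n m => D.deg ⟨m, S⟩, (D.simpleDim n m j : ℤ) • LaurentPolynomial.T j

lemma coeff_decPoly (l m : Λ) (k : ℤ) : (D.decPoly l m).coeff k = D.decMult l m k :=
  coeff_sum_smul_T _ (fun k => (D.decMult l m k : ℤ))
    (fun k hk => D.decMult_support l m k (by exact_mod_cast hk)) k

lemma coeff_standardChar (l m : Λ) (j : ℤ) : (D.standardChar l m).coeff j =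
    ((Finset.univ.filter fun S : D.T l m => D.deg ⟨m, S⟩ = j).card : ℤ) := by
  rw [standardChar, AddMonoidAlgebra.coeff_sum, Finset.sum_apply']
  simp only [T_apply]
  rw [Finset.sum_boole]

lemma decNumber_eq_of_decPoly_eq {l m l' m' : Λ} (h : D.decPoly l m = D.decPoly l' m') :
    D.decNumber l m = D.decNumber l' m' := by
  refine LaurentPolynomial.ext fun k => ?_
  change D.decMult l m k = D.decMult l' m' k
  have : (D.decMult l m k : ℤ) = D.decMult l' m' k := by
    rw [← coeff_decPoly, ← coeff_decPoly, h]
  exact_mod_cast this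

lemma coeff_T_mul {R : Type*} [Semiring R] (k : ℤ) (f : R[T;T⁻¹]) (j : ℤ) :
    (LaurentPolynomial.T k * f).coeff j = f.coeff (j - k) := by
  rw [LaurentPolynomial.T, AddMonoidAlgebra.coeff_single_mul_apply, one_mul]
  congr 1
  ring

lemma nonempty_of_simpleChar_ne_zero {n m : Λ} (h : D.simpleChar n m ≠ 0) :
    Nonempty (D.T n m) := by
  by_contra hne
  rw [not_nonempty_iff] at hne
  apply h
  rw [simpleChar, Finset.univ_eq_empty, Finset.image_empty, Finset.sum_empty]

section Graded

variable [GradedAlgebra 𝒜]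

lemma coeff_simpleChar (n m : Λ) (j : ℤ) : (D.simpleChar n m).coeff j = D.simpleDim n m j := by
  refine coeff_sum_smul_T _ (fun j => (D.simpleDim n m j : ℤ)) (fun j hj => ?_) j
  obtain ⟨S, hS⟩ := D.exists_of_simpleDim_ne_zero (by exact_mod_cast hj)
  exact Finset.mem_image.mpr ⟨S, Finset.mem_univ _, hS⟩

lemma invert_simpleChar (n m : Λ) : invert (D.simpleChar n m) = D.simpleChar n m := by
  refine LaurentPolynomial.ext fun j => ?_
  rw [invert_apply, coeff_simpleChar, coeff_simpleChar, simpleDim_neg]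

lemma simpleChar_self (m : Λ) : D.simpleChar m m = 1 := by
  refine LaurentPolynomial.ext fun j => ?_
  rw [coeff_simpleChar, simpleDim_self, ← T_zero, T_apply]
  by_cases h : j = 0
  · rw [if_pos h, if_pos h.symm, Nat.cast_one]
  · rw [if_neg h, if_neg (Ne.symm h), Nat.cast_zero]

/-- The characters of standard modules are determined by the decomposition numbers and the
characters of simple modules. -/
lemma standardChar_eq (l m : Λ) :
    D.standardChar l m = ∑ n, D.decPoly l n * D.simpleChar n m := by
  classical
  obtain ⟨t, ν, κ, h1, h2⟩ := D.exists_factors l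
  have hd : ∀ n, D.decPoly l n = ∑ i ∈ Finset.univ.filter (fun i => ν i = n), LaurentPolynomial.T (κ i) := by
    intro n
    refine LaurentPolynomial.ext fun k => ?_
    rw [coeff_decPoly, h1, AddMonoidAlgebra.coeff_sum, Finset.sum_apply']
    simp only [T_apply]
    rw [Finset.sum_boole, Finset.filter_filter]
  have hrhs : ∑ n, D.decPoly l n * D.simpleChar n m =
      ∑ i, LaurentPolynomial.T (κ i) * D.simpleChar (ν i) m := by
    rw [← Finset.sum_fiberwise Finset.univ ν]
    refine Finset.sum_congr rfl fun n _ => ?_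
    rw [hd, Finset.sum_mul]
    refine Finset.sum_congr rfl fun i hi => ?_
    rw [(Finset.mem_filter.mp hi).2]
  rw [hrhs]
  refine LaurentPolynomial.ext fun j => ?_
  rw [coeff_standardChar, AddMonoidAlgebra.coeff_sum, Finset.sum_apply']
  simp only [coeff_T_mul, coeff_simpleChar]
  rw [← Nat.cast_sum, ← h2]

/-- Each factor L(n)⟨k⟩ contributes one dimension to weight `n` and degree `k`. In particular
`decPoly l n` vanishes unless `n ≤ l`. -/
lemma decMult_le (l n : Λ) (k : ℤ) : D.decMult l n k ≤
    (Finset.univ.filter fun S : D.T l n => D.deg ⟨n, S⟩ = k).card := by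
  classical
  obtain ⟨t, ν, κ, h1, h2⟩ := D.exists_factors l
  have h3 := h2 n k
  have h4 : D.decMult l n k ≤ ∑ i, D.simpleDim (ν i) n (k - κ i) := by
    rw [h1, Finset.card_filter]
    refine Finset.sum_le_sum fun i _ => ?_
    split_ifs with h
    · rw [h.1, h.2, sub_self, simpleDim_self, if_pos rfl]
    · exact Nat.zero_le _
  rw [← h3] at h4
  convert h4

lemma nonempty_of_decPoly_ne_zero {l n : Λ} (h : D.decPoly l n ≠ 0) : Nonempty (D.T l n) := by
  by_contra hne
  rw [not_nonempty_iff] at hne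
  apply h
  refine LaurentPolynomial.ext fun k => ?_
  have := D.decMult_le l n k
  rw [Finset.univ_eq_empty, Finset.filter_empty, Finset.card_empty, Nat.le_zero] at this
  rw [coeff_decPoly, this]
  rfl

lemma standardChar_self (l : Λ) : D.standardChar l l = 1 := by
  have := D.highest l
  rw [standardChar, Fintype.sum_unique, deg_highest, T_zero]

/-- In weight `l` only a label that is both at most and at least `l` contributes. -/
lemma decPoly_self (l : Λ) : D.decPoly l l = 1 := by
  have h := D.standardChar_eq l l
  rw [standardChar_self, Finset.sum_eq_single l, simpleChar_self, mul_one] at h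
  · exact h.symm
  · intro n _ hn
    by_contra h0
    obtain ⟨S⟩ := D.nonempty_of_decPoly_ne_zero (left_ne_zero_of_mul h0)
    obtain ⟨S'⟩ := D.nonempty_of_simpleChar_ne_zero (right_ne_zero_of_mul h0)
    exact hn (le_antisymm (D.le_of_T S) (D.le_of_T S'))
  · simp

end Graded

end CellDatum

end SoergelPath

end

/-! ### Bar-invariance of the columns of the decomposition matrix. -/

noncomputable section

open scoped LaurentPolynomial InnerProductSpace

namespace SoergelPath

lemma wordPath_zero {r n : ℕ} (w : Fin n → Fin r) : wordPath w 0 = 0 := by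
  rw [wordPath, Finset.filter_false_of_mem, Finset.sum_empty]
  intro i _
  exact Nat.not_lt_zero _

namespace Geometry

variable {r : ℕ} {G : Geometry r}

/-- A regular point lies in the closure of one alcove only. -/
lemma Near.trans_symm {a b y : E r} (ha : G.Near a y) (hb : G.Near b y) (hy : G.Reg y) :
    G.Near a b := by
  intro α hα c hc
  have h1 := ha α hα c hc
  have h2 := hb α hα c hc
  have h3 : 0 < ht α c y ^ 2 := by
    have := hy α hα c hc
    positivity
  have h4 : 0 ≤ ht α c b * ht α c a * ht α c y ^ 2 := by
    have := mul_nonneg h1 h2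
    linarith
  exact nonneg_of_mul_nonneg_left h4 h3

lemma eq_of_near_of_near (hG : G.IsAdmissibleGeometry) {v y : E r} (hv : G.Reg v) {z z' : G.W}
    (h : G.Near (z.1 v) y) (h' : G.Near (z'.1 v) y) (hy : G.Reg y) : z = z' :=
  eq_of_near hG.rootSystem hv (h.trans_symm h' hy)

end Geometry

namespace SoergelPathBasis

open SoergelPath.Geometry

universe u v w

variable {A : Type u} [Ring A] [Algebra ℂ A] {𝒜 : ℤ → Submodule ℂ A}
variable {Λ : Type v} [PartialOrder Λ] [Fintype Λ] {D : CellDatum.{u, v, w} 𝒜 Λ}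
variable {r : ℕ} {G : Geometry r} {ι : Λ ↪ E r}

variable (G ι) in
/-- The element `x` of `W^e` for which the weight `l` lies in the closure of the image under `x`
of the alcove of the origin. -/
def alcoveElt (l : Λ) : G.W :=
  open Classical in
  -- The default value is harmless: a weight with a nonzero coefficient in the sums for a regular
  -- column has a path ending at it, and hence such an element `z`.
  if h : ∃ z : G.W, G.Near (z.1 (0 + G.ρ)) (ι l + G.ρ) then h.choose else 1

variable (hG : G.IsAdmissibleGeometry)

include hG

lemma reg_origin : G.Reg (0 + G.ρ) := reg_of_isRegular hG.rootSystem hG.positive hG.origin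

omit [PartialOrder Λ] [Fintype Λ] in
lemma alcoveElt_eq {l : Λ} (hl : G.Reg (ι l + G.ρ)) {z : G.W}
    (hz : G.Near (z.1 (0 + G.ρ)) (ι l + G.ρ)) : alcoveElt G ι l = z := by
  have h : ∃ z : G.W, G.Near (z.1 (0 + G.ρ)) (ι l + G.ρ) := ⟨z, hz⟩
  rw [alcoveElt, dif_pos h]
  exact eq_of_near_of_near hG (reg_origin hG) h.choose_spec hz hl

omit [PartialOrder Λ] [Fintype Λ] in
lemma alcoveElt_congr {c : Set (E r)} (hc : G.IsAlcove c) {n n' : Λ} (hn : ι n ∈ c)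
    (hn' : ι n' ∈ c) (h : G.Near ((alcoveElt G ι n).1 (0 + G.ρ)) (ι n + G.ρ)) :
    alcoveElt G ι n' = alcoveElt G ι n :=
  alcoveElt_eq hG (reg_of_isRegular hG.rootSystem hG.positive ⟨c, hc, hn'⟩)
    (h.trans_symm
      (fun α hα b hb => (pos_of_mem_alcove hG.rootSystem hG.positive hc hn hn' α hα b hb).le)
      (reg_of_isRegular hG.rootSystem hG.positive ⟨c, hc, hn⟩))

variable (B : SoergelPathBasis D G ι)

include B

/-- The graded character of the paths of a regular weight is bar-invariant; the shapes of these
paths are regular weights in the same orbit. -/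
lemma bar_standardChar {m : Λ} (hm : G.IsRegular (ι m)) :
    (∀ l, Nonempty (D.T l m) → G.IsRegular (ι l) ∧ G.Linked (ι l) (ι m) ∧
      G.Near ((alcoveElt G ι l).1 (0 + G.ρ)) (ι l + G.ρ)) ∧
    (isInversionCocycle hG.rootSystem (reg_origin hG)).bar
      (∑ l, D.standardChar l m • Finsupp.single (alcoveElt G ι l) (1 : ℤ[T;T⁻¹])) =
      ∑ l, D.standardChar l m • Finsupp.single (alcoveElt G ι l) (1 : ℤ[T;T⁻¹]) := by
  classical
  have h0 : B.ω m 0 = 0 := by rw [B.ω_eq, wordPath_zero]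
  have hlast : G.IsRegular (B.ω m (Fin.last _)) := by rwa [B.ω_last]
  obtain ⟨F, g, y₀, hF, hend, hnear, hreg, hbar⟩ :=
    exists_bar_character hG (reg_origin hG) (B.ω_admissible m hm) h0 hlast
  have hP : G.P ⊆ G.Φ := by
    obtain ⟨f, -, hf⟩ := hG.positive
    exact fun α hα => ((hf α).mp hα).1
  have he : G.e ≠ 0 := (bot_le.trans_lt hG.coxeter_lt).ne'
  have hpath : ∀ l (S : D.T l m), (B.toPath l m S).1 ∈ F ∧
      ι l + G.ρ = (g (B.toPath l m S).1).1 y₀ := by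
    intro l S
    obtain ⟨h1, h2⟩ := (B.toPath l m S).2
    have h3 := (hF _).mpr h1
    exact ⟨h3, (congrArg (· + G.ρ) h2.symm).trans (hend _ h3)⟩
  have hregl : ∀ l (S : D.T l m), G.Reg (ι l + G.ρ) ∧
      G.Near ((g (B.toPath l m S).1).1 (0 + G.ρ)) (ι l + G.ρ) := by
    intro l S
    rw [(hpath l S).2]
    exact ⟨reg_apply hG.rootSystem (g _).2 hreg, near_apply hG.rootSystem (g _).2 hnear⟩
  have helt : ∀ l (S : D.T l m), alcoveElt G ι l = g (B.toPath l m S).1 := fun l S =>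
    alcoveElt_eq hG (hregl l S).1 (hregl l S).2
  refine ⟨?_, ?_⟩
  · rintro l ⟨S⟩
    refine ⟨isRegular_of_reg he hP (hregl l S).1, ?_, ?_⟩
    · let S₀ : D.T m m := (D.highest m).default
      refine ⟨g (B.toPath m m S₀).1 * (g (B.toPath l m S).1)⁻¹,
        G.W.mul_mem (g _).2 (G.W.inv_mem (g _).2), ?_⟩
      refine eq_sub_of_add_eq ((hpath m S₀).2.trans (congrArg (g (B.toPath m m S₀).1).1 ?_))
      rw [(hpath l S).2]
      exact (Equiv.symm_apply_apply (g (B.toPath l m S).1).1 y₀).symm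
    · rw [helt l S]
      exact (hregl l S).2
  · have hsum : ∑ l, D.standardChar l m • Finsupp.single (alcoveElt G ι l) (1 : ℤ[T;T⁻¹]) =
        ∑ q ∈ F, (LaurentPolynomial.T (G.degree q) : ℤ[T;T⁻¹]) •
          Finsupp.single (g q) (1 : ℤ[T;T⁻¹]) := by
      simp only [CellDatum.standardChar, Finset.sum_smul]
      rw [Finset.sum_sigma']
      refine Finset.sum_bij (fun p _ => (B.toPath p.1 m p.2).1) ?_ ?_ ?_ ?_
      · exact fun p _ => (hpath p.1 p.2).1
      · rintro ⟨l, S⟩ _ ⟨l', S'⟩ _ h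
        have h1 := (B.toPath l m S).2.2
        have h2 := (B.toPath l' m S').2.2
        have h3 : (B.toPath l m S).1 = (B.toPath l' m S').1 := h
        rw [h3, h2] at h1
        obtain rfl := ι.injective h1
        rw [(B.toPath l' m).injective (Subtype.ext h3)]
      · intro q hq
        have h1 := (hF q).mp hq
        obtain ⟨l, hl⟩ := B.last_mem m q h1
        refine ⟨⟨l, (B.toPath l m).symm ⟨q, h1, hl⟩⟩, by simp, ?_⟩
        rw [Equiv.apply_symm_apply]
      · rintro ⟨l, S⟩ _
        rw [B.toPath_degree, helt l S]
    rw [hsum]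
    exact hbar

variable [GradedAlgebra 𝒜]

/-- The column `m` of the decomposition matrix, as a bar-invariant element. -/
lemma bar_decPoly {m : Λ} (hm : G.IsRegular (ι m)) :
    (isInversionCocycle hG.rootSystem (reg_origin hG)).bar
      (∑ l, D.decPoly l m • Finsupp.single (alcoveElt G ι l) (1 : ℤ[T;T⁻¹])) =
      ∑ l, D.decPoly l m • Finsupp.single (alcoveElt G ι l) (1 : ℤ[T;T⁻¹]) := by
  classical
  -- Induction downwards on `m`: in the expansion of the standard characters into columns, `d m` has
  -- coefficient 1 and the other columns belong to larger, again regular, weights.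
  have key : WellFounded fun a b : Λ => b < a := Finite.wellFounded_of_trans_of_irrefl _
  induction m using key.induction with
  | _ m ih =>
  let d : Λ → (G.W →₀ ℤ[T;T⁻¹]) := fun n =>
    ∑ l, D.decPoly l n • Finsupp.single (alcoveElt G ι l) (1 : ℤ[T;T⁻¹])
  obtain ⟨h1, h2⟩ := bar_standardChar hG B hm
  have h3 : ∑ l, D.standardChar l m • Finsupp.single (alcoveElt G ι l) (1 : ℤ[T;T⁻¹]) =
      ∑ n, D.simpleChar n m • d n := by
    simp only [d, D.standardChar_eq, Finset.sum_smul, Finset.smul_sum, smul_smul]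
    rw [Finset.sum_comm]
    refine Finset.sum_congr rfl fun n _ => Finset.sum_congr rfl fun l _ => ?_
    rw [mul_comm]
  have h4 : ∀ n ∈ Finset.univ.erase m,
      (isInversionCocycle hG.rootSystem (reg_origin hG)).bar (D.simpleChar n m • d n) =
        D.simpleChar n m • d n := by
    intro n hn
    rw [IsInversionCocycle.bar_smul, D.invert_simpleChar]
    by_cases h0 : D.simpleChar n m = 0
    · rw [h0, zero_smul, zero_smul]
    · obtain ⟨S⟩ := D.nonempty_of_simpleChar_ne_zero h0
      have hlt : m < n := lt_of_le_of_ne (D.le_of_T S) (Finset.ne_of_mem_erase hn).symm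
      exact congrArg (D.simpleChar n m • ·) (ih n hlt (h1 n ⟨S⟩).1)
  rw [h3, ← Finset.add_sum_erase _ _ (Finset.mem_univ m), D.simpleChar_self, one_smul, map_add,
    map_sum _ _ (Finset.univ.erase m), Finset.sum_congr rfl h4] at h2
  exact add_right_cancel h2

omit [GradedAlgebra 𝒜] in
/-- Two linked weights in the closure of the same alcove agree. -/
lemma eq_of_alcoveElt_eq {l κ m : Λ} (hm : G.IsRegular (ι m)) (hκ : Nonempty (D.T κ m))
    (hl : G.Near ((alcoveElt G ι l).1 (0 + G.ρ)) (ι l + G.ρ)) (hlm : G.Linked (ι l) (ι m))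
    (h : alcoveElt G ι κ = alcoveElt G ι l) : κ = l := by
  obtain ⟨h1, ⟨g, hg, hgm⟩, h3⟩ := (bar_standardChar hG B hm).1 κ hκ
  obtain ⟨g', hg', hgm'⟩ := hlm
  -- Both weights are linked to `m`, hence to each other; the element relating them fixes their
  -- common alcove and is therefore trivial.
  have hκl : ι κ + G.ρ = (g⁻¹ * g') (ι l + G.ρ) := by
    rw [Equiv.Perm.mul_apply]
    refine (Equiv.symm_apply_eq g).mpr ?_ |>.symm
    exact sub_left_injective (hgm'.symm.trans hgm)
  have hmem : g⁻¹ * g' ∈ G.W := G.W.mul_mem (G.W.inv_mem hg) hg'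
  have h4 := near_apply hG.rootSystem hmem hl
  rw [← hκl] at h4
  have h5 : (⟨g⁻¹ * g', hmem⟩ * alcoveElt G ι l : G.W) = alcoveElt G ι κ :=
    eq_of_near_of_near hG (reg_origin hG) h4 h3
      (reg_of_isRegular hG.rootSystem hG.positive h1)
  rw [h, mul_eq_right] at h5
  have h6 : g⁻¹ * g' = 1 := congrArg Subtype.val h5
  rw [h6, Equiv.Perm.one_apply] at hκl
  exact ι.injective (add_right_cancel hκl)

end SoergelPathBasis

end SoergelPath

end

/-! ### The translation principle. -/

open SoergelPath in
theorem mainTheorem9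
    {A : Type*} [Ring A] [Algebra ℂ A] (𝒜 : ℤ → Submodule ℂ A) [GradedAlgebra 𝒜]
    {Λ : Type*} [PartialOrder Λ] [Fintype Λ] (D : CellDatum 𝒜 Λ)
    {r : ℕ} (G : Geometry r) (hG : G.IsAdmissibleGeometry) (ι : Λ ↪ E r)
    (hS : Nonempty (SoergelPathBasis D G ι))
    (hpos : ∀ l m : Λ, l ≠ m →
      ∃ p : Polynomial ℕ, D.decNumber l m = Polynomial.toLaurent (Polynomial.X * p))
    (a b : Set (E r)) (ha : G.IsAlcove a) (hb : G.IsAlcove b)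
    (l l' m m' : Λ) (hl : ι l ∈ a) (hl' : ι l' ∈ a) (hm : ι m ∈ b) (hm' : ι m' ∈ b)
    (hlm : G.Linked (ι l) (ι m)) (hlm' : G.Linked (ι l') (ι m')) :
    D.decNumber l m = D.decNumber l' m' := by
  classical
  obtain ⟨B⟩ := hS
  -- Divisibility by `t` makes all coefficients in degrees at most zero vanish off the diagonal.
  have hmult : ∀ κ n : Λ, κ ≠ n → ∀ k : ℤ, k ≤ 0 → (D.decPoly κ n).coeff k = 0 := by
    intro κ n hκ k hk
    obtain ⟨p, hp⟩ := hpos κ n hκ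
    have h1 : D.decMult κ n k = (D.decNumber κ n).coeff k := rfl
    rw [D.coeff_decPoly, h1, hp, map_mul, Polynomial.toLaurent_X, CellDatum.coeff_T_mul,
      LaurentPolynomial.coeff_toLaurent, Finsupp.mapDomain_of_notMem_range, Nat.cast_zero]
    rintro ⟨i, hi⟩
    have : (i : ℤ) = k - 1 := hi
    omega
  have hmr : G.IsRegular (ι m) := ⟨b, hb, hm⟩
  have hmr' : G.IsRegular (ι m') := ⟨b, hb, hm'⟩
  have hnear := fun {n : Λ} (hn : G.IsRegular (ι n)) =>
    ((SoergelPathBasis.bar_standardChar hG B hn).1 n ⟨(D.highest n).default⟩).2.2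
  let x := SoergelPathBasis.alcoveElt G ι
  have hxm : x m' = x m := SoergelPathBasis.alcoveElt_congr hG hb hm hm' (hnear hmr)
  have hxl : x l' = x l := SoergelPathBasis.alcoveElt_congr hG ha hl hl' (hnear ⟨a, ha, hl⟩)
  let d : Λ → (G.W →₀ LaurentPolynomial ℤ) := fun n =>
    ∑ κ, D.decPoly κ n • Finsupp.single (x κ) (1 : LaurentPolynomial ℤ)
  have hd : ∀ n w, d n w = ∑ κ, if x κ = w then D.decPoly κ n else 0 := by
    intro n w
    simp only [d, Finsupp.coe_finsetSum, Finset.sum_apply, Finsupp.smul_apply,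
      Finsupp.single_apply, smul_eq_mul, mul_ite, mul_one, mul_zero]
  -- Modulo positive powers of `t`, a column is the basis element of the alcove of its weight.
  have hcoeff : ∀ n w, ∀ k : ℤ, k ≤ 0 →
      (d n w).coeff k = if x n = w then (1 : LaurentPolynomial ℤ).coeff k else 0 := by
    intro n w k hk
    rw [hd, AddMonoidAlgebra.coeff_sum, Finset.sum_apply', Finset.sum_eq_single n]
    · rw [D.decPoly_self]
      split_ifs <;> rfl
    · intro κ _ hκ
      split_ifs
      · exact hmult κ n hκ k hk
      · rfl
    · simp
  -- The difference of the two columns is bar-invariant and, as `m` and `m'` share an alcove, has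
  -- only positive powers of `t`.
  have hdd : d m = d m' := by
    rw [← sub_eq_zero]
    refine (Geometry.isInversionCocycle hG.rootSystem
      (SoergelPathBasis.reg_origin hG)).eq_zero_of_bar_eq ?_ ?_
    · rw [map_sub]
      exact congrArg₂ (· - ·) (SoergelPathBasis.bar_decPoly hG B hmr)
        (SoergelPathBasis.bar_decPoly hG B hmr')
    · intro w k hk
      rw [Finsupp.sub_apply, AddMonoidAlgebra.coeff_sub, Finsupp.sub_apply, hcoeff m w k hk,
        hcoeff m' w k hk, hxm, sub_self]
  -- Several weights may share the alcove of `κ`, but among them only `κ` is linked to `n`, so the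
  -- coefficient is a single decomposition number.
  have hcolumn : ∀ {n κ : Λ}, G.IsRegular (ι n) → G.IsRegular (ι κ) → G.Linked (ι κ) (ι n) →
      d n (x κ) = D.decPoly κ n := by
    intro n κ hn hκ hκn
    rw [hd, Finset.sum_eq_single κ, if_pos rfl]
    · intro κ' _ hne
      by_contra h0
      have h1 : x κ' = x κ := by
        by_contra h1
        exact h0 (if_neg h1)
      rw [if_pos h1] at h0
      exact hne (SoergelPathBasis.eq_of_alcoveElt_eq hG B hn (D.nonempty_of_decPoly_ne_zero h0)
        (hnear hκ) hκn h1)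
    · simp
  apply D.decNumber_eq_of_decPoly_eq
  rw [← hcolumn hmr ⟨a, ha, hl⟩ hlm, ← hcolumn hmr' ⟨a, ha, hl'⟩ hlm', hdd, hxl]
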